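/- Let $\xi(s)=\tfrac12\pi^{-s/2}\Gamma(s/2)\,s(s-1)\zeta(s)$, let $f(z)=\xi(\tfrac12+z)$ (an entire, even function), and let $T_m$ be the Taylor polynomial of $f$ at $0$ of degree $m$. Let $W$ be the Lambert function (the inverse of $w\mapsto we^{w}$, increasing on $(-e^{-1},\infty)$), $\operatorname{erfc}(s)=1-\frac{2}{\sqrt\pi}\int_0^s e^{-u^2}\,du$ for $s\in\mathbb C$, and let $\chi$ be the characteristic function of the strip $|\Re z|<1$. For $\lambda>\tfrac12$ and $n\ge1$ let $$\phi_\lambda(z)=2\log z+\frac1n\log\frac{f(\lambda)}{f(\lambda z)}\qquad\Bigl(\Re z>\frac1{2\lambda}\Bigr),$$ in the branch with $\phi_\lambda(1)=0$, and write $e^{n\phi_\lambda(z)}=z^{2n}f(\lambda)/f(\lambda z)$ for all $z\in\mathbb C$ (so that $f(\lambda z)e^{n\phi_\lambda(z)}=z^{2n}f(\lambda)$, also at the zeros of $f(\lambda z)$). **Theorem.** There are $n_0\ge1$ and $\delta_0>0$ such that the following holds. (i) For every $n\ge n_0$ there is exactly one $\lambda=\lambda(n)>\tfrac12$ with $\phi_\lambda'(1)=2-\frac{\lambda}{n}\frac{f'(\lambda)}{f(\lambda)}=0$,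 and $\lambda(n)=\frac{4n}{W(2n/\pi)}\bigl[1+O(n^{-1})\bigr]$. From now on $\lambda=\lambda(n)$. (ii) For every $n\ge n_0$ the relation $w^2=\phi_\lambda(z)$ defines a conformal map $w$ from an open neighbourhood $U_n$ of $z=1$, contained in $\Re z>\frac1{2\lambda}$, onto the disc $|w|<\delta_0$, in the branch with $w'(1)=-i\sqrt{-\phi_\lambda''(1)/2}$. It is extended to $-U_n$ by $w(-z)=w(z)$. For $0<\delta\le\delta_0$ let $B_\delta=\{z\in U_n\cup(-U_n):|w(z)|<\delta\}$, let $\partial S_1=\{|\Re z|=1\}$, and put $$h_0(z)=\frac{1}{\sqrt{2\pi|\phi_\lambda''(1)|}}\,\frac{2}{1-z^2}.$$ (iii) For every $0<\delta\le\delta_0$ and all $n\ge n_0$ there is a function $\mathcal E=\mathcal E_{n,\delta}$ on $\mathbb C$ such that $$T_{2n-2}(\lambda z)=T_{2n-1}(\lambda z)=\begin{cases} f(\lambda z)\Bigl[\chi(z)-\dfrac{e^{n\phi_\lambda(z)}}{\sqrt n}\,h_0(z)\bigl(1+\mathcal E(z)\bigr)\Bigr], & z\in\mathbb C\setminus B_\delta,\\[2ex]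 f(\lambda z)\Bigl[\tfrac12\operatorname{erfc}\bigl(i\sqrt n\,w(z)\bigr)-\dfrac{e^{n\phi_\lambda(z)}}{\sqrt n}\,\mathcal E(z)\Bigr], & z\in B_\delta,\end{cases}$$ where $\mathcal E$ is bounded, is analytic in $\mathbb C\setminus\bigl((\partial S_1\setminus B_\delta)\cup\partial B_\delta\bigr)$, and satisfies $$\mathcal E(z)=\begin{cases} O(n^{-1}), & z\in\mathbb C\setminus B_\delta,\\[1ex] h_0(z)+\dfrac{1}{2i\sqrt\pi\,w(z)}+O(n^{-1}), & z\in B_\delta,\ z\ne\pm1.\end{cases}$$ The bound for $\mathcal E$ and the constants in both $O(n^{-1})$ depend only on $\delta$; they are uniform in $z$ and in $n\ge n_0$. -/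

import Mathlib

namespace XiTaylor

open Complex

noncomputable section

/-- Riemann's entire function `ξ(s) = (1/2) π^(-s/2) Γ(s/2) s (s-1) ζ(s)`.  It is written here through
Mathlib's entire completed zeta function `Λ₀(s) = π^(-s/2) Γ(s/2) ζ(s) + 1/s + 1/(1-s)`, so that the
removable singularities of the product formula carry the right values; see `xi_eq`. -/
def xi (s : ℂ) : ℂ := (s * (s - 1) * completedRiemannZeta₀ s + 1) / 2

/-- The defining product formula for `ξ`, wherever none of its factors is singular. -/
theorem xi_eq {s : ℂ} (hs1 : s ≠ 1) (hs : ∀ k : ℕ, s ≠ -(2 * k)) :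
    xi s = 1 / 2 * (Real.pi : ℂ) ^ (-s / 2) * Gamma (s / 2) * (s * (s - 1)) * riemannZeta s := by
  have hs0 : s ≠ 0 := by simpa using hs 0
  have hG : Gammaℝ s ≠ 0 := by
    rw [Ne, Gammaℝ_eq_zero_iff]
    rintro ⟨k, hk⟩
    exact hs k hk
  have h1 : riemannZeta s * Gammaℝ s = completedRiemannZeta s := by
    rw [riemannZeta_def_of_ne_zero hs0, div_mul_cancel₀ _ hG]
  have h2 := completedRiemannZeta_eq s
  have h3 : completedRiemannZeta₀ s = riemannZeta s * Gammaℝ s + 1 / s + 1 / (1 - s) := by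
    rw [h1, h2]; ring
  have h4 : (1 : ℂ) - s ≠ 0 := sub_ne_zero.mpr (Ne.symm hs1)
  have h5 : xi s = 1 / 2 * Gammaℝ s * (s * (s - 1)) * riemannZeta s := by
    rw [xi, h3]
    field_simp
    ring
  rw [h5, Gammaℝ_def]
  ring

theorem differentiable_xi : Differentiable ℂ xi := by
  have := differentiable_completedZeta₀
  unfold xi
  fun_prop

/-- `f(z) = ξ(1/2 + z)`. -/
def f (z : ℂ) : ℂ := xi (1 / 2 + z)

theorem differentiable_f : Differentiable ℂ f :=
  differentiable_xi.comp (differentiable_id.const_add _)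

/-- `f` has no zeros to the right of the (shifted) critical strip. -/
theorem f_ne_zero {z : ℂ} (hz : 1 / 2 < z.re) : f z ≠ 0 := by
  have hre : 1 < (1 / 2 + z).re := by
    have : (1 / 2 + z).re = 1 / 2 + z.re := by simp
    linarith
  have h1 : (1 / 2 + z) ≠ 1 := by
    intro h; rw [h] at hre; simp at hre
  have h0 : (1 / 2 + z) ≠ 0 := by
    intro h; rw [h] at hre; norm_num at hre
  have hk : ∀ k : ℕ, (1 / 2 + z) ≠ -(2 * k) := by
    intro k h
    rw [h] at hre
    have : (-(2 * (k : ℂ))).re = -(2 * (k : ℝ)) := by simp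
    rw [this] at hre
    have : (0 : ℝ) ≤ k := k.cast_nonneg
    linarith
  have hpi : (Real.pi : ℂ) ≠ 0 := by exact_mod_cast Real.pi_ne_zero
  rw [f, xi_eq h1 hk]
  refine mul_ne_zero (mul_ne_zero (mul_ne_zero (mul_ne_zero (by norm_num) ?_) ?_) ?_) ?_
  · simp [cpow_eq_zero_iff, hpi]
  · apply Gamma_ne_zero_of_re_pos
    have : ((1 / 2 + z) / 2).re = (1 / 2 + z).re / 2 := by
      rw [show ((2 : ℂ)) = ((2 : ℝ) : ℂ) by norm_num, div_ofReal_re]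
    rw [this]; linarith
  · exact mul_ne_zero h0 (sub_ne_zero.mpr h1)
  · exact riemannZeta_ne_zero_of_one_le_re hre.le

/-- The Taylor (Maclaurin) polynomial of `f` of degree `m`. -/
def T (m : ℕ) (z : ℂ) : ℂ :=
  ∑ k ∈ Finset.range (m + 1), iteratedDeriv k f 0 / (k.factorial : ℂ) * z ^ k

/-- The branch of the inverse of `w ↦ w e^w` that is real and increasing on `(-1/e, ∞)`: the largest
`w ≥ -1` with `w e^w ≤ x`. -/
def lambertW (x : ℝ) : ℝ := sSup {w : ℝ | -1 ≤ w ∧ w * Real.exp w ≤ x}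

/-- `lambertW` inverts `w ↦ w e^w` on `[-1, ∞)`. -/
theorem lambertW_mul_exp {w : ℝ} (hw : -1 ≤ w) : lambertW (w * Real.exp w) = w := by
  have hmono : ∀ v : ℝ, w < v → w * Real.exp w < v * Real.exp v := by
    intro v hv
    have h1 : w * Real.exp (w - v) < v := by
      have he : w - v + 1 < Real.exp (w - v) := Real.add_one_lt_exp (by linarith)
      have he1 : Real.exp (w - v) < 1 := Real.exp_lt_one_iff.mpr (by linarith)
      rcases le_or_gt 0 w with h | h
      · nlinarith
      · nlinarith
    have h2 : Real.exp w = Real.exp (w - v) * Real.exp v := by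
      rw [← Real.exp_add]; ring_nf
    rw [h2, ← mul_assoc]
    exact mul_lt_mul_of_pos_right h1 (Real.exp_pos v)
  refine IsGreatest.csSup_eq ⟨⟨hw, le_rfl⟩, ?_⟩
  rintro v ⟨-, hv⟩
  by_contra h
  exact absurd (hmono v (not_le.mp h)) (not_lt.mpr hv)

/-- The complementary error function on `ℂ`: `erfc s = 1 - (2/√π) ∫_0^s e^(-u²) du`, the integral
being taken along the segment from `0` to `s`. -/
def erfc (s : ℂ) : ℂ :=
  1 - 2 / (Real.sqrt Real.pi : ℂ) * ∫ t in (0 : ℝ)..1, s * exp (-((t : ℂ) * s) ^ 2)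

/-- The phase `φ_λ(z) = 2 log z + (1/n) log (f(λ) / f(λ z))` on the half plane `Re z > 1/(2λ)`, in
which `f(λ z)` has no zeros, in the branch that is real on the real axis (so `φ_λ(1) = 0`): the
logarithm of `f(λ z) / f(λ)` is the integral of its logarithmic derivative over the segment from `1`
to `z`. -/
def phase (n : ℕ) (lam : ℝ) (z : ℂ) : ℂ :=
  2 * log z - 1 / (n : ℂ) *
    ∫ t in (0 : ℝ)..1, (lam : ℂ) * (z - 1) * logDeriv f ((lam : ℂ) * (1 + (t : ℂ) * (z - 1)))

/-- `e^(n φ_λ(z)) = z^(2n) f(λ) / f(λ z)`, which is meromorphic in the whole plane. -/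
def expPhase (n : ℕ) (lam : ℝ) (z : ℂ) : ℂ := z ^ (2 * n) * f lam / f (lam * z)

/-- On the half plane where the phase is defined, `expPhase` is its exponential. -/
theorem exp_phase {n : ℕ} {lam : ℝ} (hn : n ≠ 0) (hlam : 1 / 2 < lam) {z : ℂ}
    (hz : 1 / 2 < lam * z.re) : exp (n * phase n lam z) = expPhase n lam z := by
  have hlam0 : 0 < lam := by linarith
  have hzre : 0 < z.re := by
    by_contra h
    have := mul_nonpos_of_nonneg_of_nonpos hlam0.le (not_lt.mp h)
    linarith
  have hz0 : z ≠ 0 := by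
    intro h; rw [h] at hzre; simp at hzre
  have hnC : (n : ℂ) ≠ 0 := by exact_mod_cast hn
  set g : ℝ → ℂ := fun t => (lam : ℂ) * (1 + (t : ℂ) * (z - 1)) with hg
  set F : ℝ → ℂ := fun t => (lam : ℂ) * (z - 1) * logDeriv f (g t) with hF
  have hgre : ∀ t : ℝ, (g t).re = lam * (1 + t * (z.re - 1)) := by
    intro t
    simp [hg]
  have hopen : IsOpen {t : ℝ | 1 / 2 < (g t).re} := by
    apply isOpen_lt continuous_const
    simp only [hgre]
    fun_prop
  have hsub : Set.Icc (0 : ℝ) 1 ⊆ {t : ℝ | 1 / 2 < (g t).re} := by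
    intro t ht
    show 1 / 2 < (g t).re
    rw [hgre]
    have h1 : lam * (1 + t * (z.re - 1)) = (1 - t) * lam + t * (lam * z.re) := by ring
    rw [h1]
    rcases eq_or_lt_of_le ht.1 with h0 | h0
    · rw [← h0]; linarith
    · nlinarith [mul_nonneg (sub_nonneg.mpr ht.2) (sub_nonneg.mpr hlam.le),
        mul_pos h0 (sub_pos.mpr hz)]
  have hderivf : Differentiable ℂ (deriv f) := by
    have h : ContDiff ℂ 2 f := differentiable_f.contDiff
    exact ((contDiff_succ_iff_deriv (n := 1)).1 h).2.2.differentiable (by norm_num)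
  have hgc : Continuous g := by simp only [hg]; fun_prop
  have hFcont : ContinuousOn F {t : ℝ | 1 / 2 < (g t).re} := by
    intro t ht
    have h1 : ContinuousAt (logDeriv f) (g t) := by
      unfold logDeriv
      exact hderivf.continuous.continuousAt.div differentiable_f.continuous.continuousAt (f_ne_zero ht)
    exact ((continuousAt_const).mul
      (ContinuousAt.comp (f := g) (g := logDeriv f) h1 hgc.continuousAt)).continuousWithinAt
  have hgd : ∀ t : ℝ, HasDerivAt g ((lam : ℂ) * (z - 1)) t := by
    intro t
    have h := (((Complex.ofRealCLM.hasDerivAt (x := t)).mul_const (z - 1)).const_add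
      (1 : ℂ)).const_mul (lam : ℂ)
    simpa [hg] using h
  set P : ℝ → ℂ := fun u => ∫ t in (0 : ℝ)..u, F t with hP
  have hPd : ∀ u ∈ Set.Icc (0 : ℝ) 1, HasDerivAt P (F u) u := by
    intro u hu
    have hci : ContinuousOn F (Set.uIcc 0 u) := by
      rw [Set.uIcc_of_le hu.1]
      exact hFcont.mono ((Set.Icc_subset_Icc_right hu.2).trans hsub)
    refine intervalIntegral.integral_hasDerivAt_right hci.intervalIntegrable ?_
      (hFcont.continuousAt (hopen.mem_nhds (hsub hu)))
    exact hFcont.stronglyMeasurableAtFilter hopen u (hsub hu)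
  have hHd : ∀ u ∈ Set.Icc (0 : ℝ) 1,
      HasDerivAt (fun u => f (g u) * exp (-P u)) 0 u := by
    intro u hu
    have hf1 : HasDerivAt (fun u => f (g u)) (deriv f (g u) * ((lam : ℂ) * (z - 1))) u :=
      HasDerivAt.comp (h₂ := f) u (differentiable_f (g u)).hasDerivAt (hgd u)
    have h2 := hf1.mul ((hPd u hu).neg.cexp)
    have hne := f_ne_zero (hsub hu)
    have key : deriv f (g u) * ((lam : ℂ) * (z - 1)) * exp (-P u) +
        f (g u) * (exp (-P u) * -((lam : ℂ) * (z - 1) * (deriv f (g u) / f (g u)))) = 0 := by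
      field_simp
      ring
    exact key ▸ h2
  have hconst : f (g 1) * exp (-P 1) = f (g 0) * exp (-P 0) := by
    refine constant_of_has_deriv_right_zero (f := fun u => f (g u) * exp (-P u)) (a := 0) (b := 1)
      (fun u hu => (hHd u hu).continuousAt.continuousWithinAt)
      (fun u hu => (hHd u (Set.Ico_subset_Icc_self hu)).hasDerivWithinAt) 1 (by simp)
  have hg1 : g 1 = lam * z := by simp [hg]
  have hg0 : g 0 = lam := by simp [hg]
  have hP0 : P 0 = 0 := by simp [hP]
  rw [hg1, hg0, hP0, neg_zero, exp_zero, mul_one] at hconst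
  have hfne : f (lam * z) ≠ 0 := f_ne_zero (by simpa using hz)
  have hphase : (n : ℂ) * phase n lam z = (2 * n : ℕ) * log z + (-P 1) := by
    simp only [phase, hP, hF, hg]
    push_cast
    field_simp
    ring
  rw [hphase, exp_add, exp_nat_mul, exp_log hz0, expPhase, ← hconst]
  field_simp

/-- `φ_λ''(1)`. -/
def phaseSecond (n : ℕ) (lam : ℝ) : ℂ := iteratedDeriv 2 (phase n lam) 1

/-- `λ > 1/2` is the scaling that puts a stationary point of the phase at `z = 1`:
`∂_z φ_λ(1) = 2 - (λ/n) ∂_λ log f(λ) = 0`. -/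
def IsSaddleScale (n : ℕ) (lam : ℝ) : Prop :=
  1 / 2 < lam ∧ 2 - (lam : ℂ) / (n : ℂ) * logDeriv f lam = 0

/-- The leading order stationary phase approximation
`h₀(z) = (2π |φ_λ''(1)|)^(-1/2) · 2 / (1 - z²)`. -/
def h0 (n : ℕ) (lam : ℝ) (z : ℂ) : ℂ :=
  1 / (Real.sqrt (2 * Real.pi * ‖phaseSecond n lam‖) : ℂ) * (2 / (1 - z ^ 2))

/-- The characteristic function of the strip `|Re z| < 1`. -/
def chi (z : ℂ) : ℂ := Set.indicator {z : ℂ | |z.re| < 1} (fun _ => 1) z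

/-- `w` is the local coordinate `w² = φ_λ` on the neighbourhood `U` of `1`: it maps `U` conformally
onto the disc of radius `r` about `0`, in the branch with
`w(z) = -i √(-φ_λ''(1)/2) (z - 1) (1 + O(z - 1))`, and it is extended to `-U` by `w(-z) = w(z)`. -/
structure IsLocalCoordinate (n : ℕ) (lam r : ℝ) (w : ℂ → ℂ) (U : Set ℂ) : Prop where
  isOpen : IsOpen U
  one_mem : 1 ∈ U
  subset_halfPlane : ∀ z ∈ U, 1 / 2 < lam * z.re
  analytic : AnalyticOnNhd ℂ w U
  injOn : Set.InjOn w U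
  image_eq : w '' U = Metric.ball 0 r
  sq_eq : ∀ z ∈ U, w z ^ 2 = phase n lam z
  deriv_one : deriv w 1 = -I * (Real.sqrt (-(phaseSecond n lam).re / 2) : ℂ)
  even : ∀ z ∈ U, w (-z) = w z

/-- `B_δ = B_{1,δ} ∪ B_{-1,δ}`, where `B_{1,δ} ⊆ U` and `B_{-1,δ} ⊆ -U` are the two preimages of the
disc of radius `δ` under the local coordinate. -/
def B (w : ℂ → ℂ) (U : Set ℂ) (δ : ℝ) : Set ℂ :=
  {z : ℂ | (z ∈ U ∨ -z ∈ U) ∧ w z ∈ Metric.ball (0 : ℂ) δ}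

/-- The contour `(∂S₁ \ B_δ) ∪ ∂B_δ`, where `S₁` is the strip `|Re z| < 1`, so that `∂S₁` consists of
the two lines `|Re z| = 1`. -/
def errContour (w : ℂ → ℂ) (U : Set ℂ) (δ : ℝ) : Set ℂ :=
  ({z : ℂ | |z.re| = 1} \ B w U δ) ∪ frontier (B w U δ)

end

end XiTaylor

namespace XiTaylor

open Complex Filter Topology MeasureTheory Set

/-! ### Symmetry, growth and logarithmic derivative of `f` -/


/-! The factor `e^(-nφ(t)) = f(λt)/(f(λ) t^(2n))` is, up to the constant `f(λ)`, the quotient whose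
Laurent expansion at `0` carries both the Taylor polynomial and its remainder: its principal part is
`T_{2n-1}(λt)/t^(2n)` and the rest is the even entire function `R(t) = (f(λt) -
T_{2n-1}(λt))/t^(2n)`. Integrating `f(λt)/t^(2n)` against the even Cauchy kernel `2t/(t² - z²)` over
a vertical line `Re t = x` gives `2π R(z)` if `|Re z| < x` and `-2π T_{2n-1}(λz)/z^(2n)` if `x < Re
z` (`lineIntegral_f_div_pow`). So the whole problem is a saddle point analysis of one integral, and
the jump of `χ` is the residue at `t = z`.

The saddle is at `t = 1` by the choice of `λ`. Removing from `log (f(λz)/f(λ))` its linear part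
leaves a defect of size `O(λ)` near `1`, while `λ/n → 0`; hence `φ` is uniformly close to `2(log z -
z + 1)`, which behaves like `-(z - 1)²`. The defect is controlled without a complex Stirling
formula. On the real axis, log-convexity of `Γ` gives `f'/f = ½ log(x/2π) + O(1/x)`. Off the axis,
`|Γ(s)|` and `|ζ(s)|` are largest at `Re s` on each vertical line to the right of `1`, which bounds
the real part of the defect from above, and the Borel–Carathéodory theorem does the rest
(`exists_norm_logDefect_le`). The same comparison with the real axis makes the integrand decay like
`(1 + y²/4)^(-n)`, up to small factors, away from the saddle.

For `z` at a fixed distance from `±1` the line is placed at `1 + η` or `1 - η`, on the side that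
keeps it away from `z`; near the saddle it is pushed back to `Re t = 1` and Laplace's method applies
with a relative error `O(1/n)`, uniformly in `z` (`exists_line_bound`, `exists_outer_bound`). By
evenness only `Re z ≥ 0` has to be treated.

Near `1` the square root `w` of `φ` is a small perturbation of `-i(z - 1)`, so a contraction
argument shows that it is conformal onto a disc of fixed radius. With the residual defined by the
asserted formula inside this disc, the function `innerError` is analytic there, and so is `h₀ +
1/(2i√π w)`, because the two poles at `1` cancel. On the circle `|w| = δ` the expansion of `erfc`
and the outer estimate show that the two differ by `O(1/n)` (`exists_boundary_bound`); the maximum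
principle carries this to the interior (`exists_inner_bound`). -/

theorem f_neg (z : ℂ) : f (-z) = f z := by
  have h := completedRiemannZeta₀_one_sub (1 / 2 + z)
  have h1 : (1 : ℂ) - (1 / 2 + z) = 1 / 2 + -z := by ring
  rw [h1] at h
  simp only [f, xi, h]
  ring

theorem f_eq_Gammaℝ {z : ℂ} (hz : 1 / 2 < z.re) :
    f z = 1 / 2 * Gammaℝ (1 / 2 + z) * (z ^ 2 - 1 / 4) * riemannZeta (1 / 2 + z) := by
  have hre : 1 < (1 / 2 + z).re := by
    have : (1 / 2 + z).re = 1 / 2 + z.re := by simp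
    linarith
  have h1 : (1 / 2 + z) ≠ 1 := by
    intro h; rw [h] at hre; simp at hre
  have hk : ∀ k : ℕ, (1 / 2 + z) ≠ -(2 * k) := by
    intro k h
    rw [h] at hre
    have : (-(2 * (k : ℂ))).re = -(2 * (k : ℝ)) := by simp
    rw [this] at hre
    have : (0 : ℝ) ≤ k := k.cast_nonneg
    linarith
  rw [f, xi_eq h1 hk, Gammaℝ_def]
  ring

/-- Serves to show that `f'/f` and its derivative are real on the real axis, hence that the saddle
equation is a real equation and `φ''(1)` a real number. -/
theorem f_conj {z : ℂ} (hz : 1 / 2 < z.re) :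
    f ((starRingEnd ℂ) z) = (starRingEnd ℂ) (f z) := by
  have hz' : 1 / 2 < ((starRingEnd ℂ) z).re := by simpa using hz
  have c2 : (starRingEnd ℂ) 2 = 2 := map_ofNat _ 2
  have c4 : (starRingEnd ℂ) 4 = 4 := map_ofNat _ 4
  have h2 : (1 / 2 + (starRingEnd ℂ) z) = (starRingEnd ℂ) (1 / 2 + z) := by simp [c2]
  have harg : ((Real.pi : ℂ)).arg ≠ Real.pi := by
    rw [arg_ofReal_of_nonneg Real.pi_pos.le]; exact Real.pi_ne_zero.symm
  have h3 : Gammaℝ ((starRingEnd ℂ) (1 / 2 + z)) = (starRingEnd ℂ) (Gammaℝ (1 / 2 + z)) := by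
    rw [Gammaℝ_def, Gammaℝ_def, map_mul, ← Gamma_conj]
    congr 1
    · have e : -(starRingEnd ℂ) (1 / 2 + z) / 2 = (starRingEnd ℂ) (-(1 / 2 + z) / 2) := by
        simp [c2]
      rw [e, cpow_conj _ _ harg, conj_ofReal]
    · simp [c2]
  rw [f_eq_Gammaℝ hz, f_eq_Gammaℝ hz', h2, h3, riemannZeta_conj]
  simp [c2, c4]

/-- In Euler's integral the modulus of `t^(s-1)` depends on `Re s` only. -/
theorem norm_Gamma_le {s : ℂ} (hs : 0 < s.re) : ‖Gamma s‖ ≤ ‖Gamma (s.re : ℂ)‖ := by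
  have h1 : Gamma (s.re : ℂ) = (Real.Gamma s.re : ℂ) := Gamma_ofReal _
  rw [h1, norm_real, Real.norm_of_nonneg (Real.Gamma_pos_of_pos hs).le, Gamma_eq_integral hs,
    GammaIntegral, Real.Gamma_eq_integral hs]
  refine (norm_integral_le_integral_norm _).trans (le_of_eq ?_)
  refine setIntegral_congr_fun measurableSet_Ioi fun x hx => ?_
  simp only [mem_Ioi] at hx
  simp only [norm_mul, norm_real, Real.norm_of_nonneg (Real.exp_pos _).le]
  rw [norm_cpow_eq_rpow_re_of_pos hx]
  simp

theorem norm_zeta_le {s : ℂ} (hs : 1 < s.re) : ‖riemannZeta s‖ ≤ ‖riemannZeta (s.re : ℂ)‖ := by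
  have hs' : 1 < (s.re : ℂ).re := by simpa using hs
  have hsum : Summable fun n : ℕ => 1 / ((n : ℝ) + 1) ^ s.re := by
    have := (summable_nat_add_iff 1).2 (Real.summable_one_div_nat_rpow.2 hs)
    simpa using this
  have hn : ∀ n : ℕ, ‖1 / ((n : ℂ) + 1) ^ s‖ = 1 / ((n : ℝ) + 1) ^ s.re := by
    intro n
    have h0 : (0 : ℝ) < (n : ℝ) + 1 := by positivity
    have : ((n : ℂ) + 1) = (((n : ℝ) + 1 : ℝ) : ℂ) := by push_cast; ring
    rw [norm_div, norm_one, this, norm_cpow_eq_rpow_re_of_pos h0]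
  have hz : riemannZeta (s.re : ℂ) = ((∑' n : ℕ, 1 / ((n : ℝ) + 1) ^ s.re : ℝ) : ℂ) := by
    rw [zeta_eq_tsum_one_div_nat_add_one_cpow hs', ofReal_tsum]
    refine tsum_congr fun n => ?_
    have h0 : (0 : ℝ) ≤ (n : ℝ) + 1 := by positivity
    push_cast [ofReal_cpow h0]
    rfl
  rw [hz, norm_real, Real.norm_of_nonneg (tsum_nonneg fun n => by positivity),
    zeta_eq_tsum_one_div_nat_add_one_cpow hs]
  refine (norm_tsum_le_tsum_norm (by simpa only [hn] using hsum)).trans (le_of_eq ?_)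
  exact tsum_congr hn

/-- The factors `Γ` and `ζ` are largest on the real axis and `|π^(-s/2)|` depends on `Re s` only, so
along a vertical line `f` can grow at most like its quadratic factor. -/
theorem norm_f_mul_le {z : ℂ} (hz : 1 / 2 < z.re) :
    ‖f z‖ * (z.re ^ 2 - 1 / 4) ≤ ‖z ^ 2 - 1 / 4‖ * ‖f z.re‖ := by
  have hx : 1 / 2 < ((z.re : ℂ)).re := by simpa using hz
  rw [f_eq_Gammaℝ hz, f_eq_Gammaℝ hx, Gammaℝ_def, Gammaℝ_def]
  simp only [norm_mul]
  have hpi : ∀ s : ℂ, ‖(Real.pi : ℂ) ^ s‖ = Real.pi ^ s.re :=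
    fun s => norm_cpow_eq_rpow_re_of_pos Real.pi_pos s
  have e1 : (-(1 / 2 + (z.re : ℂ)) / 2).re = (-(1 / 2 + z) / 2).re := by
    simp
  have hG : ‖Gamma ((1 / 2 + z) / 2)‖ ≤ ‖Gamma ((1 / 2 + (z.re : ℂ)) / 2)‖ := by
    have e : ((1 / 2 + z) / 2).re = (1 / 2 + z.re) / 2 := by
      simp
    have := norm_Gamma_le (s := (1 / 2 + z) / 2) (by rw [e]; linarith)
    rw [e] at this
    refine this.trans (le_of_eq ?_)
    push_cast; rfl
  have hZ : ‖riemannZeta (1 / 2 + z)‖ ≤ ‖riemannZeta (1 / 2 + (z.re : ℂ))‖ := by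
    have e : (1 / 2 + z).re = 1 / 2 + z.re := by simp
    have := norm_zeta_le (s := 1 / 2 + z) (by rw [e]; linarith)
    rw [e] at this
    refine this.trans (le_of_eq ?_)
    push_cast; rfl
  have hq : ‖(z.re : ℂ) ^ 2 - 1 / 4‖ = z.re ^ 2 - 1 / 4 := by
    have : (z.re : ℂ) ^ 2 - 1 / 4 = ((z.re ^ 2 - 1 / 4 : ℝ) : ℂ) := by push_cast; ring
    rw [this, norm_real, Real.norm_of_nonneg]
    nlinarith
  have hq0 : 0 ≤ z.re ^ 2 - 1 / 4 := by nlinarith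
  rw [hpi, hpi, e1, hq]
  have hp : 0 ≤ Real.pi ^ (-(1 / 2 + z) / 2).re := by positivity
  calc ‖(1 / 2 : ℂ)‖ * (Real.pi ^ (-(1 / 2 + z) / 2).re * ‖Gamma ((1 / 2 + z) / 2)‖)
        * ‖z ^ 2 - 1 / 4‖ * ‖riemannZeta (1 / 2 + z)‖ * (z.re ^ 2 - 1 / 4)
      ≤ ‖(1 / 2 : ℂ)‖ * (Real.pi ^ (-(1 / 2 + z) / 2).re * ‖Gamma ((1 / 2 + (z.re : ℂ)) / 2)‖)
        * ‖z ^ 2 - 1 / 4‖ * ‖riemannZeta (1 / 2 + (z.re : ℂ))‖ * (z.re ^ 2 - 1 / 4) := by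
        gcongr
    _ = _ := by ring

/-- `Λ₀` is half the Mellin transform, at `s/2`, of a theta function modified so that all its
moments converge. On a strip `|t^(s/2-1)|` is at most the sum of the two real powers `t^(X-1)` and
`t^(-X-1)`, one for `t ≥ 1` and one for `t ≤ 1`. -/
theorem norm_completedZeta₀_le (X : ℝ) :
    ∃ C : ℝ, 0 ≤ C ∧ ∀ s : ℂ, |s.re| ≤ X → ‖completedRiemannZeta₀ s‖ ≤ C := by
  set P := HurwitzZeta.hurwitzEvenFEPair 0
  have hconv : ∀ s : ℂ, MellinConvergent P.f_modif s := fun s =>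
    (P.isStrongFEPair_toStrongFEPair.hasMellin s).1
  have hnorm : ∀ σ : ℝ, IntegrableOn (fun t : ℝ => t ^ (σ - 1) * ‖P.f_modif t‖) (Ioi 0) := by
    intro σ
    have := (hconv σ).norm
    refine (integrableOn_congr_fun (fun t ht => ?_) measurableSet_Ioi).1 this
    simp only [mem_Ioi] at ht
    simp only [norm_smul]
    rw [norm_cpow_eq_rpow_re_of_pos ht]
    simp
  refine ⟨∫ t in Ioi (0 : ℝ), (t ^ (X - 1) * ‖P.f_modif t‖ + t ^ (-X - 1) * ‖P.f_modif t‖), ?_, ?_⟩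
  · refine setIntegral_nonneg measurableSet_Ioi fun t ht => ?_
    simp only [mem_Ioi] at ht
    positivity
  intro s hs
  have h0 : completedRiemannZeta₀ s = mellin P.f_modif (s / 2) / 2 := rfl
  rw [h0, mellin, norm_div]
  have hI : 0 ≤ ∫ t in Ioi (0 : ℝ), (t ^ (X - 1) * ‖P.f_modif t‖ + t ^ (-X - 1) * ‖P.f_modif t‖) := by
    refine setIntegral_nonneg measurableSet_Ioi fun t ht => ?_
    simp only [mem_Ioi] at ht
    positivity
  have h2 : ‖∫ t in Ioi (0 : ℝ), (t : ℂ) ^ (s / 2 - 1) • P.f_modif t‖ ≤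
      ∫ t in Ioi (0 : ℝ), (t ^ (X - 1) * ‖P.f_modif t‖ + t ^ (-X - 1) * ‖P.f_modif t‖) := by
    refine norm_integral_le_of_norm_le ((hnorm X).add (hnorm (-X))) ?_
    refine (ae_restrict_iff' measurableSet_Ioi).2 (Eventually.of_forall fun t ht => ?_)
    simp only [mem_Ioi] at ht
    rw [norm_smul, norm_cpow_eq_rpow_re_of_pos ht, ← add_mul]
    refine mul_le_mul_of_nonneg_right ?_ (norm_nonneg _)
    have e : (s / 2 - 1).re = s.re / 2 - 1 := by
      simp
    rw [e]
    have hX := abs_le.1 hs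
    rcases le_total 1 t with h | h
    · exact (Real.rpow_le_rpow_of_exponent_le h (by linarith)).trans
        (le_add_of_nonneg_right (by positivity))
    · exact (Real.rpow_le_rpow_of_exponent_ge ht h (by linarith)).trans
        (le_add_of_nonneg_left (by positivity))
  have : ‖(2 : ℂ)‖ = 2 := by norm_num
  rw [this]
  linarith

/-- Polynomial growth on strips that contain the critical strip, where the bounds of the right half
plane do not reach. It is what allows vertical lines to be moved across `Re t = 0`. -/
theorem norm_f_le_strip (X : ℝ) :
    ∃ C : ℝ, 0 ≤ C ∧ ∀ z : ℂ, |z.re| ≤ X → ‖f z‖ ≤ C * (1 + ‖z‖ ^ 2) := by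
  obtain ⟨C, hC, h⟩ := norm_completedZeta₀_le (X + 1)
  refine ⟨C + 1, by linarith, fun z hz => ?_⟩
  have hs : |(1 / 2 + z).re| ≤ X + 1 := by
    have : (1 / 2 + z).re = 1 / 2 + z.re := by simp
    rw [this]
    refine (abs_add_le _ _).trans ?_
    norm_num
    linarith
  have h1 := h _ hs
  have e : f z = ((z ^ 2 - 1 / 4) * completedRiemannZeta₀ (1 / 2 + z) + 1) / 2 := by
    rw [f, xi]; ring
  rw [e, norm_div, Complex.norm_ofNat]
  have h2 : ‖z ^ 2 - 1 / 4‖ ≤ ‖z‖ ^ 2 + 1 / 4 := by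
    refine (norm_sub_le _ _).trans ?_
    rw [norm_pow]; norm_num
  have h3 : ‖(z ^ 2 - 1 / 4) * completedRiemannZeta₀ (1 / 2 + z) + 1‖ ≤
      (‖z‖ ^ 2 + 1 / 4) * C + 1 := by
    refine (norm_add_le _ _).trans ?_
    rw [norm_mul, norm_one]
    gcongr
  have : 0 ≤ ‖z‖ ^ 2 := by positivity
  nlinarith


/-! ### The logarithmic derivative of `f` and Stirling's formula on the real axis. -/

theorem isOpen_half_lt_re : IsOpen {z : ℂ | 1 / 2 < z.re} :=
  isOpen_lt continuous_const continuous_re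

theorem differentiable_deriv_f : Differentiable ℂ (deriv f) := by
  have h : ContDiff ℂ 2 f := differentiable_f.contDiff
  exact ((contDiff_succ_iff_deriv (n := 1)).1 h).2.2.differentiable (by norm_num)

theorem differentiableOn_logDeriv_f : DifferentiableOn ℂ (logDeriv f) {z : ℂ | 1 / 2 < z.re} := by
  intro z hz
  exact ((differentiable_deriv_f z).div (differentiable_f z) (f_ne_zero hz)).differentiableWithinAt

theorem conj_deriv_f {z : ℂ} (hz : 1 / 2 < z.re) :
    deriv f ((starRingEnd ℂ) z) = (starRingEnd ℂ) (deriv f z) := by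
  have h1 : (⇑(starRingEnd ℂ) ∘ f ∘ ⇑(starRingEnd ℂ)) =ᶠ[𝓝 z] f := by
    filter_upwards [isOpen_half_lt_re.mem_nhds hz] with u hu
    simp only [Function.comp_apply]
    rw [f_conj hu, conj_conj]
  have h2 := h1.deriv_eq
  rw [deriv_conj_conj] at h2
  simp only [Function.comp_apply] at h2
  rw [← h2, conj_conj]

theorem logDeriv_f_conj {z : ℂ} (hz : 1 / 2 < z.re) :
    logDeriv f ((starRingEnd ℂ) z) = (starRingEnd ℂ) (logDeriv f z) := by
  rw [logDeriv_apply, logDeriv_apply, f_conj hz, conj_deriv_f hz, map_div₀]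

theorem logDeriv_f_ofReal {x : ℝ} (hx : 1 / 2 < x) : logDeriv f x = ((logDeriv f x).re : ℂ) := by
  have h := logDeriv_f_conj (z := x) (by simpa using hx)
  rw [conj_ofReal] at h
  exact (conj_eq_iff_re.1 h.symm).symm

theorem hasDerivAt_log_Gamma {x : ℝ} (hx : 0 < x) :
    HasDerivAt (Real.log ∘ Real.Gamma) (digamma x).re x := by
  have hne : ∀ m : ℕ, (x : ℂ) ≠ -m := by
    intro m h
    have := congrArg re h
    simp at this
    have : (0 : ℝ) ≤ m := m.cast_nonneg
    linarith
  have h1 := (differentiableAt_Gamma x hne).hasDerivAt.real_of_complex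
  have h2 : (fun y : ℝ => (Gamma y).re) = Real.Gamma := by
    funext y; rw [Gamma_ofReal, ofReal_re]
  rw [h2] at h1
  have h3 := h1.log (Real.Gamma_pos_of_pos hx).ne'
  have e : (digamma x).re = (deriv Gamma x).re / Real.Gamma x := by
    rw [digamma_def, logDeriv_apply, Gamma_ofReal, div_ofReal_re]
  rw [e]
  exact h3

theorem digamma_im {x : ℝ} : (digamma x).im = 0 := by
  have h2 : (⇑(starRingEnd ℂ) ∘ Gamma ∘ ⇑(starRingEnd ℂ)) = Gamma := by
    funext u
    simp only [Function.comp_apply]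
    rw [Gamma_conj, conj_conj]
  have h3 := congrFun (deriv_conj_conj (f := Gamma)) x
  rw [h2] at h3
  simp only [Function.comp_apply, conj_ofReal] at h3
  have h4 : (starRingEnd ℂ) (digamma x) = digamma x := by
    rw [digamma_def, logDeriv_apply, map_div₀, ← h3, ← Gamma_conj, conj_ofReal]
  exact conj_eq_iff_im.1 h4

/-- `log Γ` is convex and its slope over `[x, x+1]` is exactly `log x`, so `log x` lies between
`ψ(x)` and `ψ(x+1) = ψ(x) + 1/x`. -/
theorem norm_digamma_sub_log_le {x : ℝ} (hx : 0 < x) :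
    ‖digamma x - Real.log x‖ ≤ 1 / x := by
  have hmul : Real.log (Real.Gamma (x + 1)) = Real.log x + Real.log (Real.Gamma x) := by
    rw [Real.Gamma_add_one hx.ne', Real.log_mul hx.ne' (Real.Gamma_pos_of_pos hx).ne']
  have hx1 : x < x + 1 := by linarith
  have hs : slope (Real.log ∘ Real.Gamma) x (x + 1) = Real.log x := by
    rw [slope_def_field]
    simp only [Function.comp_apply, hmul]
    ring
  have hup := Real.convexOn_log_Gamma.le_slope_of_hasDerivAt (mem_Ioi.2 hx)
    (mem_Ioi.2 (by linarith)) hx1 (hasDerivAt_log_Gamma hx)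
  have hlow := Real.convexOn_log_Gamma.slope_le_of_hasDerivAt (mem_Ioi.2 hx)
    (mem_Ioi.2 (by linarith)) hx1 (hasDerivAt_log_Gamma (by linarith : 0 < x + 1))
  rw [hs] at hup hlow
  have hne : ∀ m : ℕ, (x : ℂ) ≠ -m := by
    intro m h
    have := congrArg re h
    simp at this
    have : (0 : ℝ) ≤ m := m.cast_nonneg
    linarith
  have hrec := digamma_apply_add_one (x : ℂ) hne
  have hrec' : (digamma ((x + 1 : ℝ) : ℂ)).re = (digamma x).re + 1 / x := by
    push_cast
    rw [hrec, add_re, ← ofReal_inv, ofReal_re, one_div]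
  have he : digamma x - Real.log x = (((digamma x).re - Real.log x : ℝ) : ℂ) := by
    apply Complex.ext <;> simp [digamma_im]
  rw [he, norm_real, Real.norm_eq_abs, abs_le]
  constructor <;> linarith [one_div_pos.2 hx]

/-- The von Mangoldt series is exponentially small in `x`; a decay `1/x` is all that is needed, and
it follows term by term from `x log m / m^x ≤ 4/m²` for `x ≥ 3`. -/
theorem norm_logDeriv_zeta_le :
    ∃ C : ℝ, 0 ≤ C ∧ ∀ x : ℝ, 3 ≤ x → ‖deriv riemannZeta x / riemannZeta x‖ ≤ C / x := by
  have hsum : Summable fun n : ℕ => 4 * (1 / (n : ℝ) ^ (2 : ℕ)) :=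
    (Real.summable_one_div_nat_pow.2 one_lt_two).mul_left 4
  refine ⟨∑' n : ℕ, 4 * (1 / (n : ℝ) ^ (2 : ℕ)), tsum_nonneg fun n => by positivity,
    fun x hx => ?_⟩
  have hx0 : 0 < x := by linarith
  have h1 := ArithmeticFunction.LSeries_vonMangoldt_eq_deriv_riemannZeta_div
    (s := x) (by simp; linarith)
  rw [neg_div] at h1
  have hxn : ‖(x : ℂ)‖ = x := by rw [norm_real, Real.norm_of_nonneg hx0.le]
  rw [← norm_neg, ← h1, LSeries, le_div_iff₀ hx0, mul_comm]
  nth_rewrite 1 [← hxn]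
  rw [← norm_mul, ← tsum_mul_left]
  have hterm : ∀ n : ℕ, ‖(x : ℂ) * LSeries.term (fun n => (ArithmeticFunction.vonMangoldt n : ℂ)) x n‖
      ≤ 4 * (1 / (n : ℝ) ^ (2 : ℕ)) := by
    intro n
    rcases Nat.eq_zero_or_pos n with hn | hn
    · subst hn; simp
    have hnR : (0 : ℝ) < n := by exact_mod_cast hn
    have hn1 : (1 : ℝ) ≤ n := by exact_mod_cast hn
    rw [LSeries.term_of_ne_zero hn.ne', norm_mul, norm_div, norm_real, norm_real,
      Real.norm_of_nonneg hx0.le, Real.norm_of_nonneg ArithmeticFunction.vonMangoldt_nonneg,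
      norm_natCast_cpow_of_pos hn, ofReal_re]
    have hlog : 0 ≤ Real.log n := Real.log_nonneg hn1
    have hexp : (n : ℝ) ^ x = Real.exp (x * Real.log n) := by
      rw [Real.rpow_def_of_pos hnR, mul_comm]
    have hexp2 : (n : ℝ) ^ (2 : ℕ) = Real.exp (2 * Real.log n) := by
      rw [two_mul, Real.exp_add, Real.exp_log hnR, sq]
    have hL := ArithmeticFunction.vonMangoldt_le_log (n := n)
    rw [hexp, hexp2]
    -- Here `e^u ≥ 1 + u` is used at `u = x log n / 4`, and `x/4 ≤ x - 2` because `x ≥ 3`.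
    have key : x * Real.log n ≤ 4 * Real.exp (x * Real.log n - 2 * Real.log n) := by
      have := Real.add_one_le_exp (x * Real.log n / 4)
      have h2 : Real.exp (x * Real.log n / 4) ≤ Real.exp (x * Real.log n - 2 * Real.log n) := by
        apply Real.exp_le_exp.2
        nlinarith
      linarith
    rw [Real.exp_sub] at key
    have hE := Real.exp_pos (x * Real.log n)
    have hE2 := Real.exp_pos (2 * Real.log n)
    calc x * (ArithmeticFunction.vonMangoldt n / Real.exp (x * Real.log n))
        ≤ x * (Real.log n / Real.exp (x * Real.log n)) := by gcongr
      _ = x * Real.log n / Real.exp (x * Real.log n) := by ring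
      _ ≤ 4 * (Real.exp (x * Real.log n) / Real.exp (2 * Real.log n)) /
            Real.exp (x * Real.log n) := by gcongr
      _ = _ := by field_simp
  exact tsum_of_norm_bounded hsum.hasSum hterm

theorem logDeriv_f_eq {z : ℂ} (hz : 1 / 2 < z.re) :
    logDeriv f z = -Real.log Real.pi / 2 + digamma ((1 / 2 + z) / 2) / 2 + 2 * z / (z ^ 2 - 1 / 4) +
      deriv riemannZeta (1 / 2 + z) / riemannZeta (1 / 2 + z) := by
  have hpi : (Real.pi : ℂ) ≠ 0 := by exact_mod_cast Real.pi_ne_zero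
  have hre : (1 / 2 + z).re = 1 / 2 + z.re := by simp
  have hq : z ^ 2 - 1 / 4 ≠ 0 := by
    have : z ^ 2 - 1 / 4 = (z - 1 / 2) * (z + 1 / 2) := by ring
    rw [this]
    refine mul_ne_zero (fun h => ?_) (fun h => ?_)
    · have := congrArg re h; simp at this; linarith
    · have := congrArg re h; simp at this; linarith
  have hζ1 : (1 / 2 + z) ≠ 1 := by
    intro h; have := congrArg re h; rw [hre] at this; simp at this; linarith
  have hζ : riemannZeta (1 / 2 + z) ≠ 0 := riemannZeta_ne_zero_of_one_le_re (by rw [hre]; linarith)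
  have hGre : 0 < ((1 / 2 + z) / 2).re := by
    have : ((1 / 2 + z) / 2).re = (1 / 2 + z.re) / 2 := by simp
    rw [this]; linarith
  have hG : Gamma ((1 / 2 + z) / 2) ≠ 0 := Gamma_ne_zero_of_re_pos hGre
  have hne : ∀ m : ℕ, (1 / 2 + z) / 2 ≠ -m := by
    intro m h
    rw [h] at hGre
    simp at hGre
    have : (0 : ℝ) ≤ m := m.cast_nonneg
    linarith
  have hpne : (Real.pi : ℂ) ^ (-(1 / 2 + z) / 2) ≠ 0 := by simp [cpow_eq_zero_iff, hpi]
  have ha : HasDerivAt (fun z : ℂ => 1 / 2 + z) 1 z := (hasDerivAt_id z).const_add _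
  have hP : HasDerivAt (fun z : ℂ => (Real.pi : ℂ) ^ (-(1 / 2 + z) / 2))
      ((Real.pi : ℂ) ^ (-(1 / 2 + z) / 2) * log Real.pi * (-1 / 2)) z :=
    (ha.neg.div_const 2).const_cpow (Or.inl hpi)
  have hΓ : HasDerivAt (fun z : ℂ => Gamma ((1 / 2 + z) / 2))
      (deriv Gamma ((1 / 2 + z) / 2) * (1 / 2)) z :=
    HasDerivAt.comp (h₂ := Gamma) z (differentiableAt_Gamma _ hne).hasDerivAt (ha.div_const 2)
  have hQ : HasDerivAt (fun z : ℂ => z ^ 2 - 1 / 4) (2 * z) z := by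
    simpa using ((hasDerivAt_id z).pow 2).sub_const (1 / 4 : ℂ)
  have hZ : HasDerivAt (fun z : ℂ => riemannZeta (1 / 2 + z)) (deriv riemannZeta (1 / 2 + z) * 1) z :=
    HasDerivAt.comp (h₂ := riemannZeta) z (differentiableAt_riemannZeta hζ1).hasDerivAt ha
  have hprod := ((((hP.mul hΓ).const_mul (1 / 2 : ℂ)).mul hQ).mul hZ)
  have heq : f =ᶠ[𝓝 z] fun z => 1 / 2 * ((Real.pi : ℂ) ^ (-(1 / 2 + z) / 2) *
      Gamma ((1 / 2 + z) / 2)) * (z ^ 2 - 1 / 4) * riemannZeta (1 / 2 + z) := by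
    filter_upwards [isOpen_half_lt_re.mem_nhds hz] with u hu
    rw [f_eq_Gammaℝ hu, Gammaℝ_def]
  have hlog : log (Real.pi : ℂ) = (Real.log Real.pi : ℂ) := (ofReal_log Real.pi_pos.le).symm
  rw [logDeriv_apply, heq.deriv_eq, heq.eq_of_nhds]
  have hd := hprod.deriv
  simp only [Pi.mul_def] at hd
  rw [hd, digamma_def, logDeriv_apply, hlog]
  generalize Gamma ((1 / 2 + z) / 2) = G at *
  generalize riemannZeta (1 / 2 + z) = ζ at *
  generalize (Real.pi : ℂ) ^ (-(1 / 2 + z) / 2) = P at *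
  generalize z ^ 2 - 1 / 4 = q at *
  field_simp

/-- Stirling's formula for the logarithmic derivative of `f` on the real axis. -/
theorem norm_logDeriv_f_sub_log_le :
    ∃ C : ℝ, 0 ≤ C ∧ ∀ x : ℝ, 3 ≤ x →
      ‖logDeriv f x - (Real.log (x / (2 * Real.pi)) / 2 : ℝ)‖ ≤ C / x := by
  obtain ⟨C, hC, hζ⟩ := norm_logDeriv_zeta_le
  refine ⟨C + 10, by linarith, fun x hx => ?_⟩
  have hx0 : 0 < x := by linarith
  have hs0 : 0 < (1 / 2 + x) / 2 := by linarith
  rw [logDeriv_f_eq (by simp; linarith)]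
  have h1 := norm_digamma_sub_log_le hs0
  have h2 := hζ (1 / 2 + x) (by linarith)
  have h3 : C / (1 / 2 + x) ≤ C / x := by gcongr; linarith
  have h4 : ‖2 * (x : ℂ) / ((x : ℂ) ^ 2 - 1 / 4)‖ ≤ 4 / x := by
    have : 2 * (x : ℂ) / ((x : ℂ) ^ 2 - 1 / 4) = ((2 * x / (x ^ 2 - 1 / 4) : ℝ) : ℂ) := by
      push_cast; ring
    rw [this, norm_real, Real.norm_of_nonneg (div_nonneg (by linarith) (by nlinarith)),
      div_le_div_iff₀ (by nlinarith) hx0]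
    nlinarith
  have hlog : Real.log ((1 / 2 + x) / 2) - Real.log Real.pi - Real.log (x / (2 * Real.pi)) =
      Real.log (1 + 1 / (2 * x)) := by
    rw [← Real.log_div hs0.ne' Real.pi_ne_zero, ← Real.log_div (by positivity) (by positivity)]
    congr 1
    field_simp
    ring
  have h5 : |Real.log (1 + 1 / (2 * x))| ≤ 1 / x := by
    have hp : 0 < 1 / (2 * x) := by positivity
    rw [abs_of_nonneg (Real.log_nonneg (by linarith))]
    refine (Real.log_le_sub_one_of_pos (by linarith)).trans ?_
    rw [add_sub_cancel_left]
    gcongr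
    linarith
  have h6 : 1 / ((1 / 2 + x) / 2) ≤ 2 / x := by
    rw [div_le_div_iff₀ hs0 hx0]; linarith
  push_cast at h1 h2
  have key : -(Real.log Real.pi : ℂ) / 2 + digamma ((1 / 2 + x) / 2) / 2 +
      2 * x / ((x : ℂ) ^ 2 - 1 / 4) + deriv riemannZeta (1 / 2 + x) / riemannZeta (1 / 2 + x) -
      (Real.log (x / (2 * Real.pi)) / 2 : ℝ) =
      (1 / 2) * (digamma ((1 / 2 + x) / 2) - (Real.log ((1 / 2 + x) / 2) : ℂ)) +
      ((Real.log (1 + 1 / (2 * x)) / 2 : ℝ) : ℂ) + 2 * x / ((x : ℂ) ^ 2 - 1 / 4) +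
      deriv riemannZeta (1 / 2 + x) / riemannZeta (1 / 2 + x) := by
    rw [← hlog]; push_cast; ring
  rw [key]
  refine (norm_add_le _ _).trans ?_
  refine (add_le_add_left ((norm_add_le _ _).trans (add_le_add_left (norm_add_le _ _) _)) _).trans ?_
  rw [norm_mul, norm_real, Real.norm_eq_abs, abs_div, abs_two]
  have h7 : ‖(1 / 2 : ℂ)‖ = 1 / 2 := by norm_num
  rw [h7]
  have h8 : (C + 10) / x = C / x + 2 / x + 4 / x + 1 / x + 3 / x := by ring
  have h9 : 0 < 1 / x := by positivity
  have h10 : 2 / x = 2 * (1 / x) := by ring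
  have h11 : 4 / x = 4 * (1 / x) := by ring
  have h12 : 3 / x = 3 * (1 / x) := by ring
  rw [h8]
  linarith


/-! ### The complementary error function -/

/-- The moments `∫_0^∞ u^k e^(-u² - 2su) du`. -/
noncomputable def erfcMoment (k : ℕ) (s : ℂ) : ℂ :=
  ∫ u in Ioi (0 : ℝ), (u : ℂ) ^ k * exp (-(u : ℂ) ^ 2 - 2 * s * u)

theorem integrableOn_exp_quadratic (b : ℝ) :
    IntegrableOn (fun u : ℝ => Real.exp (-u ^ 2 + b * u)) (Ioi 0) := by
  have h := (integrable_cexp_quadratic (b := 1) (by simp) (b : ℂ) 0).norm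
  refine (h.congr (Eventually.of_forall fun u => ?_)).integrableOn
  simp only [norm_exp]
  congr 1
  have : -1 * (u : ℂ) ^ 2 + b * u + 0 = ((-u ^ 2 + b * u : ℝ) : ℂ) := by push_cast; ring
  rw [this, ofReal_re]

theorem norm_pow_mul_exp_le (k : ℕ) (s : ℂ) {u : ℝ} (hu : 0 ≤ u) :
    ‖(u : ℂ) ^ k * exp (-(u : ℂ) ^ 2 - 2 * s * u)‖ ≤
      k.factorial * Real.exp (-u ^ 2 + (1 - 2 * s.re) * u) := by
  have e : (-(u : ℂ) ^ 2 - 2 * s * u).re = -u ^ 2 - 2 * s.re * u := by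
    simp [← ofReal_pow]
  rw [norm_mul, norm_pow, norm_real, Real.norm_of_nonneg hu, norm_exp, e]
  have h1 : u ^ k ≤ k.factorial * Real.exp u := by
    have := Real.pow_div_factorial_le_exp u hu k
    rwa [div_le_iff₀ (by positivity), mul_comm] at this
  have h2 : Real.exp (-u ^ 2 + (1 - 2 * s.re) * u) =
      Real.exp u * Real.exp (-u ^ 2 - 2 * s.re * u) := by
    rw [← Real.exp_add]; ring_nf
  rw [h2, ← mul_assoc]
  gcongr

theorem integrableOn_erfcMoment (k : ℕ) (s : ℂ) :
    IntegrableOn (fun u : ℝ => (u : ℂ) ^ k * exp (-(u : ℂ) ^ 2 - 2 * s * u)) (Ioi 0) := by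
  refine Integrable.mono' ((integrableOn_exp_quadratic (1 - 2 * s.re)).const_mul
    (k.factorial : ℝ)) ?_ ?_
  · exact (by fun_prop : Continuous fun u : ℝ => (u : ℂ) ^ k *
      exp (-(u : ℂ) ^ 2 - 2 * s * u)).aestronglyMeasurable
  · exact (ae_restrict_iff' measurableSet_Ioi).2
      (Eventually.of_forall fun u hu => norm_pow_mul_exp_le k s (le_of_lt hu))

theorem exists_norm_erfcMoment_le (k : ℕ) :
    ∃ C : ℝ, 0 ≤ C ∧ ∀ s : ℂ, 0 ≤ s.re → ‖erfcMoment k s‖ ≤ C := by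
  refine ⟨∫ u in Ioi (0 : ℝ), k.factorial * Real.exp (-u ^ 2 + 1 * u),
    setIntegral_nonneg measurableSet_Ioi fun u _ => by positivity, fun s hs => ?_⟩
  refine norm_integral_le_of_norm_le ((integrableOn_exp_quadratic 1).const_mul _) ?_
  refine (ae_restrict_iff' measurableSet_Ioi).2 (Eventually.of_forall fun u hu => ?_)
  refine (norm_pow_mul_exp_le k s (le_of_lt hu)).trans ?_
  have hu' : 0 < u := hu
  gcongr
  linarith

theorem hasDerivAt_pow_mul_exp (k : ℕ) (s : ℂ) (u : ℝ) :
    HasDerivAt (fun u : ℝ => (u : ℂ) ^ (k + 1) * exp (-(u : ℂ) ^ 2 - 2 * s * u))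
      ((k + 1) * ((u : ℂ) ^ k * exp (-(u : ℂ) ^ 2 - 2 * s * u)) -
        2 * ((u : ℂ) ^ (k + 2) * exp (-(u : ℂ) ^ 2 - 2 * s * u)) -
        2 * s * ((u : ℂ) ^ (k + 1) * exp (-(u : ℂ) ^ 2 - 2 * s * u))) u := by
  have hid : HasDerivAt (fun u : ℝ => (u : ℂ)) 1 u := ofRealCLM.hasDerivAt
  have h1 := (hid.pow (k + 1)).mul (((hid.pow 2).neg.sub (hid.const_mul (2 * s))).cexp)
  refine h1.congr_deriv ?_
  simp only [Pi.pow_apply, Pi.neg_apply, Pi.sub_apply, Nat.add_sub_cancel]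
  push_cast
  ring

theorem hasDerivAt_exp_quadratic (s : ℂ) (u : ℝ) :
    HasDerivAt (fun u : ℝ => exp (-(u : ℂ) ^ 2 - 2 * s * u))
      (- 2 * ((u : ℂ) ^ 1 * exp (-(u : ℂ) ^ 2 - 2 * s * u)) -
        2 * s * ((u : ℂ) ^ 0 * exp (-(u : ℂ) ^ 2 - 2 * s * u))) u := by
  have hid : HasDerivAt (fun u : ℝ => (u : ℂ)) 1 u := ofRealCLM.hasDerivAt
  have h1 := ((hid.pow 2).neg.sub (hid.const_mul (2 * s))).cexp
  refine h1.congr_deriv ?_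
  simp only [Pi.pow_apply, Pi.neg_apply, Pi.sub_apply]
  push_cast
  ring

/-- The integral over the half line of the derivative of `e^(-u²-2su)`, whose boundary value at `u =
0` is `1`; the higher relations have vanishing boundary terms. -/
theorem erfcMoment_rec_zero (s : ℂ) : 2 * erfcMoment 1 s + 2 * s * erfcMoment 0 s = 1 := by
  have hint : IntegrableOn (fun u : ℝ => - 2 * ((u : ℂ) ^ 1 * exp (-(u : ℂ) ^ 2 - 2 * s * u)) -
        2 * s * ((u : ℂ) ^ 0 * exp (-(u : ℂ) ^ 2 - 2 * s * u))) (Ioi 0) :=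
    ((integrableOn_erfcMoment 1 s).const_mul _).sub ((integrableOn_erfcMoment 0 s).const_mul _)
  have h0 : IntegrableOn (fun u : ℝ => exp (-(u : ℂ) ^ 2 - 2 * s * u)) (Ioi 0) := by
    simpa using integrableOn_erfcMoment 0 s
  have ht := tendsto_zero_of_hasDerivAt_of_integrableOn_Ioi
    (fun u _ => hasDerivAt_exp_quadratic s u) hint h0
  have h := integral_Ioi_of_hasDerivAt_of_tendsto' (a := (0 : ℝ))
    (fun u _ => hasDerivAt_exp_quadratic s u) hint ht
  rw [integral_sub ((integrableOn_erfcMoment 1 s).const_mul _)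
    ((integrableOn_erfcMoment 0 s).const_mul _), integral_const_mul, integral_const_mul] at h
  simp only [ofReal_zero] at h
  norm_num at h
  simp only [erfcMoment]
  norm_num
  linear_combination -h

theorem erfcMoment_rec (k : ℕ) (s : ℂ) :
    (k + 1) * erfcMoment k s = 2 * erfcMoment (k + 2) s + 2 * s * erfcMoment (k + 1) s := by
  have hint : IntegrableOn (fun u : ℝ => (k + 1) * ((u : ℂ) ^ k * exp (-(u : ℂ) ^ 2 - 2 * s * u)) -
        2 * ((u : ℂ) ^ (k + 2) * exp (-(u : ℂ) ^ 2 - 2 * s * u)) -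
        2 * s * ((u : ℂ) ^ (k + 1) * exp (-(u : ℂ) ^ 2 - 2 * s * u))) (Ioi 0) :=
    (((integrableOn_erfcMoment k s).const_mul _).sub
      ((integrableOn_erfcMoment (k + 2) s).const_mul _)).sub
      ((integrableOn_erfcMoment (k + 1) s).const_mul _)
  have ht := tendsto_zero_of_hasDerivAt_of_integrableOn_Ioi
    (fun u _ => hasDerivAt_pow_mul_exp k s u) hint (integrableOn_erfcMoment (k + 1) s)
  have h := integral_Ioi_of_hasDerivAt_of_tendsto' (a := (0 : ℝ))
    (fun u _ => hasDerivAt_pow_mul_exp k s u) hint ht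
  have hi1 : IntegrableOn (fun u : ℝ => (k + 1) * ((u : ℂ) ^ k * exp (-(u : ℂ) ^ 2 - 2 * s * u)) -
      2 * ((u : ℂ) ^ (k + 2) * exp (-(u : ℂ) ^ 2 - 2 * s * u))) (Ioi 0) :=
    ((integrableOn_erfcMoment k s).const_mul _).sub
      ((integrableOn_erfcMoment (k + 2) s).const_mul _)
  rw [integral_sub hi1 ((integrableOn_erfcMoment (k + 1) s).const_mul _),
    integral_sub ((integrableOn_erfcMoment k s).const_mul _)
      ((integrableOn_erfcMoment (k + 2) s).const_mul _),
    integral_const_mul, integral_const_mul, integral_const_mul] at h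
  simp only [ofReal_zero, zero_pow (Nat.succ_ne_zero k), zero_mul, sub_zero] at h
  simp only [erfcMoment]
  linear_combination h

/-- Three recurrences express `2s² (2sM₀ - 1)` as `-(1 - 6M₁ + 4M₃)`, and the moments are bounded on
`Re s ≥ 0`. The estimate therefore holds up to the imaginary axis. -/
theorem exists_norm_erfcMoment_sub_le :
    ∃ C : ℝ, 0 ≤ C ∧ ∀ s : ℂ, 0 ≤ s.re → s ≠ 0 →
      ‖2 * s * erfcMoment 0 s - 1‖ ≤ C / ‖s‖ ^ 2 := by
  obtain ⟨C1, hC1, h1⟩ := exists_norm_erfcMoment_le 1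
  obtain ⟨C3, hC3, h3⟩ := exists_norm_erfcMoment_le 3
  refine ⟨1 + 6 * C1 + 4 * C3, by positivity, fun s hs hs0 => ?_⟩
  have r0 := erfcMoment_rec_zero s
  have r1 := erfcMoment_rec 0 s
  have r2 := erfcMoment_rec 1 s
  norm_num at r1 r2
  have key : (2 * s * erfcMoment 0 s - 1) * (2 * s ^ 2) =
      -(1 - 6 * erfcMoment 1 s + 4 * erfcMoment 3 s) := by
    linear_combination (2 * s ^ 2) * r0 + (2 * s) * r1 - r0 - 2 * r2
  have hn : 0 < ‖s‖ := norm_pos_iff.2 hs0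
  rw [le_div_iff₀ (by positivity)]
  have h4 := congrArg norm key
  rw [norm_mul, norm_mul, norm_pow, Complex.norm_ofNat, norm_neg] at h4
  have h5 : ‖1 - 6 * erfcMoment 1 s + 4 * erfcMoment 3 s‖ ≤ 1 + 6 * C1 + 4 * C3 := by
    refine (norm_add_le _ _).trans (add_le_add ((norm_sub_le _ _).trans (add_le_add ?_ ?_)) ?_)
    · simp
    · rw [norm_mul, Complex.norm_ofNat]; gcongr; exact h1 s hs
    · rw [norm_mul, Complex.norm_ofNat]; gcongr; exact h3 s hs
  have h6 : 0 ≤ ‖2 * s * erfcMoment 0 s - 1‖ * ‖s‖ ^ 2 := by positivity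
  nlinarith

/-- Differentiation under the integral gives `M₀' = -2M₁`, and the first recurrence removes `M₁`.
The resulting equation says that `-e^(-s²) M₀(s)` is a primitive of `e^(-s²)`. -/
theorem hasDerivAt_erfcMoment_zero (s : ℂ) :
    HasDerivAt (erfcMoment 0) (2 * s * erfcMoment 0 s - 1) s := by
  have hd : ∀ (u : ℝ) (x : ℂ), HasDerivAt
      (fun x : ℂ => (u : ℂ) ^ 0 * exp (-(u : ℂ) ^ 2 - 2 * x * u))
      (-2 * ((u : ℂ) ^ 1 * exp (-(u : ℂ) ^ 2 - 2 * x * u))) x := by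
    intro u x
    have h1 : HasDerivAt (fun x : ℂ => -(u : ℂ) ^ 2 - 2 * x * u) (-(2 * (u : ℂ))) x := by
      simpa using (((hasDerivAt_id x).const_mul 2).mul_const (u : ℂ)).const_sub (-(u : ℂ) ^ 2)
    refine (h1.cexp.const_mul ((u : ℂ) ^ 0)).congr_deriv ?_
    ring
  have h := hasDerivAt_integral_of_dominated_loc_of_deriv_le (𝕜 := ℂ)
    (μ := volume.restrict (Ioi (0 : ℝ)))
    (F := fun (x : ℂ) (u : ℝ) => (u : ℂ) ^ 0 * exp (-(u : ℂ) ^ 2 - 2 * x * u))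
    (F' := fun (x : ℂ) (u : ℝ) => -2 * ((u : ℂ) ^ 1 * exp (-(u : ℂ) ^ 2 - 2 * x * u)))
    (x₀ := s) (s := Metric.ball s 1)
    (bound := fun u => 2 * (1 * Real.exp (-u ^ 2 + (3 - 2 * s.re) * u)))
    (Metric.ball_mem_nhds s one_pos)
    (Eventually.of_forall fun x => (integrableOn_erfcMoment 0 x).aestronglyMeasurable)
    (integrableOn_erfcMoment 0 s)
    ((integrableOn_erfcMoment 1 s).const_mul (-2)).aestronglyMeasurable
    ?_ (((integrableOn_exp_quadratic _).const_mul 1).const_mul 2)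
    (Eventually.of_forall fun u x _ => hd u x)
  · refine h.2.congr_deriv ?_
    rw [integral_const_mul]
    have := erfcMoment_rec_zero s
    simp only [erfcMoment] at this ⊢
    linear_combination -this
  · refine (ae_restrict_iff' measurableSet_Ioi).2 (Eventually.of_forall fun u hu x hx => ?_)
    have hu' : 0 < u := hu
    rw [norm_mul, norm_neg, Complex.norm_ofNat]
    have h1 := norm_pow_mul_exp_le 1 x hu'.le
    have h2 : |(x - s).re| < 1 := (abs_re_le_norm _).trans_lt (by
      simpa [dist_eq_norm] using hx)
    rw [sub_re, abs_lt] at h2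
    refine (mul_le_mul_of_nonneg_left h1 zero_le_two).trans ?_
    simp only [Nat.factorial_one, Nat.cast_one, one_mul]
    exact mul_le_mul_of_nonneg_left (Real.exp_le_exp.2 (by nlinarith)) zero_le_two

theorem erfcMoment_zero_zero : erfcMoment 0 0 = (Real.sqrt Real.pi / 2 : ℝ) := by
  have h := integral_gaussian_Ioi 1
  simp only [div_one] at h
  rw [← h, erfcMoment, ← integral_complex_ofReal]
  refine integral_congr_ae (Eventually.of_forall fun u => ?_)
  push_cast
  simp

/-- Both sides have the same derivative along the segment from `0` to `s` and agree at `0`, by the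
Gaussian integral. This form displays the factor `e^(-s²)` that is later cancelled against
`e^(-nφ)`. -/
theorem erfc_eq (s : ℂ) :
    erfc s = 2 / (Real.sqrt Real.pi : ℂ) * (exp (-s ^ 2) * erfcMoment 0 s) := by
  have hd : ∀ t : ℝ, HasDerivAt (fun t : ℝ => -(exp (-((t : ℂ) * s) ^ 2) * erfcMoment 0 (t * s)))
      (s * exp (-((t : ℂ) * s) ^ 2)) t := by
    intro t
    have hid : HasDerivAt (fun t : ℝ => (t : ℂ) * s) (1 * s) t :=
      (ofRealCLM.hasDerivAt (x := t)).mul_const s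
    have h1 := (hid.pow 2).neg.cexp
    have h2 := HasDerivAt.comp (h₂ := erfcMoment 0) t (hasDerivAt_erfcMoment_zero (t * s)) hid
    refine (h1.mul h2).neg.congr_deriv ?_
    simp only [Pi.pow_apply, Pi.neg_apply, Function.comp_apply]
    push_cast
    ring
  have hc : Continuous fun t : ℝ => s * exp (-((t : ℂ) * s) ^ 2) := by fun_prop
  have h := intervalIntegral.integral_eq_sub_of_hasDerivAt (a := 0) (b := 1)
    (fun t _ => hd t) (hc.intervalIntegrable _ _)
  have hp : (Real.sqrt Real.pi : ℂ) ≠ 0 := by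
    exact_mod_cast (Real.sqrt_pos.2 Real.pi_pos).ne'
  rw [erfc, h]
  simp only [ofReal_one, one_mul, ofReal_zero, zero_mul, erfcMoment_zero_zero]
  push_cast
  norm_num
  field_simp
  ring

theorem differentiable_erfc : Differentiable ℂ erfc := by
  have h : Differentiable ℂ (erfcMoment 0) := fun s =>
    (hasDerivAt_erfcMoment_zero s).differentiableAt
  have : erfc = fun s => 2 / (Real.sqrt Real.pi : ℂ) * (exp (-s ^ 2) * erfcMoment 0 s) :=
    funext erfc_eq
  rw [this]
  fun_prop

theorem erfc_neg (s : ℂ) : erfc (-s) = 2 - erfc s := by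
  have h : ∀ t : ℝ, -s * exp (-((t : ℂ) * -s) ^ 2) = -(s * exp (-((t : ℂ) * s) ^ 2)) := by
    intro t
    have : ((t : ℂ) * -s) ^ 2 = ((t : ℂ) * s) ^ 2 := by ring
    rw [this]; ring
  simp only [erfc, h, intervalIntegral.integral_neg]
  ring

/-- The asymptotic expansion of `erfc` in the right half plane. -/
theorem exists_norm_erfc_sub_le :
    ∃ C : ℝ, 0 ≤ C ∧ ∀ s : ℂ, 0 ≤ s.re → s ≠ 0 →
      ‖exp (s ^ 2) * (1 / 2 * erfc s) - 1 / (2 * (Real.sqrt Real.pi : ℂ) * s)‖ ≤ C / ‖s‖ ^ 3 := by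
  obtain ⟨C, hC, h⟩ := exists_norm_erfcMoment_sub_le
  refine ⟨C, hC, fun s hs hs0 => ?_⟩
  have hp : 0 < Real.sqrt Real.pi := Real.sqrt_pos.2 Real.pi_pos
  have hpC : (Real.sqrt Real.pi : ℂ) ≠ 0 := by exact_mod_cast hp.ne'
  have e : exp (s ^ 2) * (1 / 2 * erfc s) - 1 / (2 * (Real.sqrt Real.pi : ℂ) * s) =
      (2 * s * erfcMoment 0 s - 1) / (2 * (Real.sqrt Real.pi : ℂ) * s) := by
    rw [erfc_eq, exp_neg]
    field_simp [exp_ne_zero]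
  rw [e, norm_div, norm_mul, norm_mul, Complex.norm_ofNat, norm_real, Real.norm_of_nonneg hp.le]
  have hn : 0 < ‖s‖ := norm_pos_iff.2 hs0
  have h1 : 1 ≤ Real.sqrt Real.pi := Real.one_le_sqrt.2 (by linarith [Real.pi_gt_three])
  rw [div_le_div_iff₀ (by positivity) (by positivity)]
  have h2 := h s hs hs0
  rw [le_div_iff₀ (by positivity)] at h2
  calc ‖2 * s * erfcMoment 0 s - 1‖ * ‖s‖ ^ 3 = (‖2 * s * erfcMoment 0 s - 1‖ * ‖s‖ ^ 2) * ‖s‖ := by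
        ring
    _ ≤ C * ‖s‖ := by gcongr
    _ ≤ C * (2 * Real.sqrt Real.pi * ‖s‖) := by
        gcongr
        nlinarith


/-! ### Taylor polynomials and their remainders -/

/-- The Taylor coefficients of `f` at `0`. -/
noncomputable def coeff (k : ℕ) : ℂ := iteratedDeriv k f 0 / (k.factorial : ℂ)

theorem coeff_odd (k : ℕ) : coeff (2 * k + 1) = 0 := by
  have h := iteratedDeriv_comp_neg (2 * k + 1) f 0
  have h1 : (fun x => f (-x)) = f := funext f_neg
  rw [h1, neg_zero, Odd.neg_one_pow ⟨k, rfl⟩, neg_one_smul] at h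
  have h2 : iteratedDeriv (2 * k + 1) f 0 = 0 := by
    have : (2 : ℂ) * iteratedDeriv (2 * k + 1) f 0 = 0 := by linear_combination h
    simpa using this
  rw [coeff, h2, zero_div]

theorem T_eq_sum (m : ℕ) (z : ℂ) : T m z = ∑ k ∈ Finset.range (m + 1), coeff k * z ^ k := rfl

theorem T_sub_one_eq {n : ℕ} (hn : 1 ≤ n) (z : ℂ) :
    T (2 * n - 1) z = ∑ k ∈ Finset.range n, coeff (2 * k) * z ^ (2 * k) := by
  have h : ∀ n : ℕ, ∑ k ∈ Finset.range (2 * n), coeff k * z ^ k =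
      ∑ k ∈ Finset.range n, coeff (2 * k) * z ^ (2 * k) := by
    intro n
    induction n with
    | zero => simp
    | succ n ih =>
      rw [Nat.mul_succ, Finset.sum_range_succ, Finset.sum_range_succ, ih, Finset.sum_range_succ,
        coeff_odd]
      ring
  rw [T_eq_sum, ← h n]
  congr 2
  omega

theorem T_sub_two_eq {n : ℕ} (hn : 1 ≤ n) (z : ℂ) : T (2 * n - 2) z = T (2 * n - 1) z := by
  obtain ⟨m, rfl⟩ : ∃ m, n = m + 1 := ⟨n - 1, by omega⟩
  have h1 : 2 * (m + 1) - 2 = 2 * m := by omega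
  have h2 : 2 * (m + 1) - 1 = 2 * m + 1 := by omega
  rw [h1, h2, T_eq_sum, T_eq_sum, Finset.sum_range_succ _ (2 * m + 1), coeff_odd]
  ring

theorem T_sub_one_neg {n : ℕ} (hn : 1 ≤ n) (z : ℂ) : T (2 * n - 1) (-z) = T (2 * n - 1) z := by
  rw [T_sub_one_eq hn, T_sub_one_eq hn]
  refine Finset.sum_congr rfl fun k _ => ?_
  rw [Even.neg_pow ⟨k, by ring⟩]

theorem differentiable_T (m : ℕ) : Differentiable ℂ (T m) := by
  unfold T
  fun_prop

theorem hasSum_coeff (z : ℂ) : HasSum (fun k => coeff k * z ^ k) (f z) := by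
  have h := hasSum_taylorSeries_of_entire differentiable_f 0 z
  have e : (fun k : ℕ => coeff k * z ^ k) =
      fun k : ℕ => ((k.factorial : ℂ))⁻¹ • (z - 0) ^ k • iteratedDeriv k f 0 := by
    funext k
    simp only [coeff, sub_zero, smul_eq_mul]
    ring
  rw [e]
  exact h

/-- The analytic factor of the Taylor remainder. -/
noncomputable def remainder (m : ℕ) (z : ℂ) : ℂ := ∑' k, coeff (k + m) * z ^ k

theorem differentiable_remainder (m : ℕ) : Differentiable ℂ (remainder m) := by
  intro z
  set R : ℝ := ‖z‖ + 1
  have hR : 0 < R := by positivity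
  have hs : Summable fun k => ‖coeff (k + m)‖ * R ^ k := by
    have h1 := ((summable_nat_add_iff m).2 (hasSum_coeff (R : ℂ)).summable).norm
    refine (h1.mul_left (R ^ m)⁻¹).congr fun k => ?_
    rw [norm_mul, norm_pow, norm_real, Real.norm_of_nonneg hR.le, pow_add]
    field_simp
  have hd : DifferentiableOn ℂ (remainder m) (Metric.ball 0 R) := by
    refine differentiableOn_tsum_of_summable_norm hs (fun k => by fun_prop) Metric.isOpen_ball
      fun k w hw => ?_
    rw [norm_mul, norm_pow]
    have : ‖w‖ ≤ R := (by simpa using hw : ‖w‖ < R).le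
    gcongr
  exact hd.differentiableAt (Metric.isOpen_ball.mem_nhds (by simp [R]))

theorem f_eq_T_add {m : ℕ} (hm : 1 ≤ m) (z : ℂ) : f z = T (m - 1) z + z ^ m * remainder m z := by
  have hs := (hasSum_coeff z).summable
  rw [← (hasSum_coeff z).tsum_eq, ← hs.sum_add_tsum_nat_add m, T_eq_sum, Nat.sub_add_cancel hm,
    remainder, ← tsum_mul_left]
  congr 1
  refine tsum_congr fun k => ?_
  rw [pow_add]; ring

theorem remainder_neg {n : ℕ} (hn : 1 ≤ n) (z : ℂ) :
    remainder (2 * n) (-z) = remainder (2 * n) z := by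
  rcases eq_or_ne z 0 with rfl | hz
  · simp
  have h1 := f_eq_T_add (m := 2 * n) (by omega) z
  have h2 := f_eq_T_add (m := 2 * n) (by omega) (-z)
  rw [f_neg, T_sub_one_neg hn, Even.neg_pow ⟨n, by ring⟩, h1] at h2
  have h3 : z ^ (2 * n) * remainder (2 * n) z = z ^ (2 * n) * remainder (2 * n) (-z) := by
    linear_combination h2
  exact (mul_left_cancel₀ (pow_ne_zero _ hz) h3).symm

/-! ### Integrals over vertical lines -/

/-- `∫ h(x + i y) dy`. -/
noncomputable def lineIntegral (h : ℂ → ℂ) (x : ℝ) : ℂ := ∫ y : ℝ, h (x + y * I)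

theorem integrable_of_decay {h : ℝ → ℂ} (hc : Continuous h) {C Y : ℝ}
    (hb : ∀ y, Y ≤ |y| → ‖h y‖ ≤ C / y ^ 2) : Integrable h := by
  set Y' := max Y 1
  obtain ⟨M, hM⟩ := (isCompact_Icc (a := -Y') (b := Y')).exists_bound_of_continuousOn hc.continuousOn
  have hY' : 1 ≤ Y' := le_max_right _ _
  have hC : ∀ y, Y' ≤ |y| → 0 ≤ C := by
    intro y hy
    have h1 := (norm_nonneg _).trans (hb y ((le_max_left _ _).trans hy))
    by_contra hC
    have : C / y ^ 2 < 0 := div_neg_of_neg_of_pos (not_le.1 hC) (by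
      have : y ≠ 0 := by intro h0; rw [h0] at hy; simp at hy; linarith
      positivity)
    linarith
  have hC0 : 0 ≤ C := hC Y' (le_abs_self _)
  have hM0 : 0 ≤ M := (norm_nonneg _).trans (hM 0 ⟨by linarith, by linarith⟩)
  refine Integrable.mono' ((integrable_inv_one_add_sq).const_mul (M * (1 + Y' ^ 2) + 2 * C))
    hc.aestronglyMeasurable (Eventually.of_forall fun y => ?_)
  rw [← div_eq_mul_inv, le_div_iff₀ (by positivity)]
  rcases le_total |y| Y' with hy | hy
  · have h1 := hM y (abs_le.1 hy)
    have h2 : y ^ 2 ≤ Y' ^ 2 := sq_le_sq' (by linarith [(abs_le.1 hy).1]) (abs_le.1 hy).2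
    have : ‖h y‖ * (1 + y ^ 2) ≤ M * (1 + Y' ^ 2) := by gcongr
    linarith
  · have h1 := hb y ((le_max_left _ _).trans hy)
    have h2 : 1 ≤ y ^ 2 := by
      rw [← sq_abs]; nlinarith
    rw [le_div_iff₀ (by linarith)] at h1
    have h3 : ‖h y‖ * (1 + y ^ 2) ≤ 2 * (‖h y‖ * y ^ 2) := by nlinarith [norm_nonneg (h y)]
    have : 0 ≤ M * (1 + Y' ^ 2) := by positivity
    linarith

theorem continuous_comp_line {h : ℂ → ℂ} {s : Set ℂ} (hs : ContinuousOn h s) {x : ℝ}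
    (hx : ∀ y : ℝ, (x + y * I : ℂ) ∈ s) : Continuous fun y : ℝ => h (x + y * I) :=
  hs.comp_continuous (by fun_prop) hx

theorem add_mul_I_re (x y : ℝ) : (x + y * I : ℂ).re = x := by simp

theorem add_mul_I_im (x y : ℝ) : (x + y * I : ℂ).im = y := by simp

/-- A holomorphic function with quadratic decay has the same integral over all vertical lines of a
strip. -/
theorem lineIntegral_eq {h : ℂ → ℂ} {a b : ℝ} (hab : a ≤ b)
    (hd : DifferentiableOn ℂ h {t : ℂ | a ≤ t.re ∧ t.re ≤ b}) {C Y : ℝ}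
    (hb : ∀ t : ℂ, a ≤ t.re → t.re ≤ b → Y ≤ |t.im| → ‖h t‖ ≤ C / t.im ^ 2) :
    lineIntegral h a = lineIntegral h b := by
  have hint : ∀ x, a ≤ x → x ≤ b → Integrable fun y : ℝ => h (x + y * I) := by
    intro x hxa hxb
    refine integrable_of_decay (C := C) (Y := Y) (continuous_comp_line hd.continuousOn fun y => ?_)
      fun y hy => ?_
    · simp only [mem_ofPred_eq, add_mul_I_re]; exact ⟨hxa, hxb⟩
    · have := hb (x + y * I) (by rwa [add_mul_I_re]) (by rwa [add_mul_I_re]) (by rwa [add_mul_I_im])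
      rwa [add_mul_I_im] at this
  have hlim : ∀ x, a ≤ x → x ≤ b → Tendsto (fun R : ℝ => ∫ y in (-R)..R, h (x + y * I)) atTop
      (𝓝 (lineIntegral h x)) := fun x hxa hxb =>
    intervalIntegral_tendsto_integral (hint x hxa hxb) tendsto_neg_atTop_atBot tendsto_id
  have hrect : ∀ R : ℝ, (∫ y in (-R)..R, h (b + y * I)) - (∫ y in (-R)..R, h (a + y * I)) =
      I * ((∫ x in a..b, h (x + (-R : ℝ) * I)) - ∫ x in a..b, h (x + R * I)) := by
    intro R
    have := integral_boundary_rect_eq_zero_of_differentiableOn h (a + (-R : ℝ) * I) (b + R * I) ?_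
    · simp only [add_mul_I_re, add_mul_I_im, smul_eq_mul] at this
      linear_combination (-I) * this + ((∫ y in (-R)..R, h (b + y * I)) -
        (∫ y in (-R)..R, h (a + y * I))) * I_sq
    · refine hd.mono fun t ht => ?_
      simp only [add_mul_I_re, add_mul_I_im, mem_reProdIm, uIcc_of_le hab] at ht
      exact ht.1
  have hhor : ∀ R : ℝ, max Y 1 ≤ |R| → ‖∫ x in a..b, h (x + R * I)‖ ≤ C / R ^ 2 * |b - a| := by
    intro R hR
    refine intervalIntegral.norm_integral_le_of_norm_le_const fun x hx => ?_
    rw [uIoc_of_le hab] at hx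
    have := hb (x + R * I) (by rw [add_mul_I_re]; exact hx.1.le) (by rw [add_mul_I_re]; exact hx.2)
      (by rw [add_mul_I_im]; exact (le_max_left _ _).trans hR)
    rwa [add_mul_I_im] at this
  have hz : Tendsto (fun R : ℝ => C / R ^ 2 * |b - a|) atTop (𝓝 0) := by
    have : Tendsto (fun R : ℝ => C / R ^ 2) atTop (𝓝 0) :=
      tendsto_const_nhds.div_atTop (tendsto_pow_atTop two_ne_zero)
    simpa using this.mul_const |b - a|
  have h1 : Tendsto (fun R : ℝ => ∫ x in a..b, h (x + R * I)) atTop (𝓝 0) := by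
    refine squeeze_zero_norm' ?_ hz
    filter_upwards [eventually_ge_atTop (max Y 1)] with R hR
    exact hhor R (hR.trans (le_abs_self _))
  have h2 : Tendsto (fun R : ℝ => ∫ x in a..b, h (x + (-R : ℝ) * I)) atTop (𝓝 0) := by
    refine squeeze_zero_norm' ?_ hz
    filter_upwards [eventually_ge_atTop (max Y 1)] with R hR
    have := hhor (-R) (by rw [abs_neg]; exact hR.trans (le_abs_self _))
    rwa [neg_sq] at this
  have h3 := ((hlim b hab le_rfl).sub (hlim a le_rfl hab)).congr hrect
  have h4 := (h2.sub h1).const_mul I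
  simp only [sub_zero, mul_zero] at h4
  exact (sub_eq_zero.1 (tendsto_nhds_unique h3 h4)).symm

theorem lineIntegral_neg_of_odd {h : ℂ → ℂ} {x : ℝ} (hodd : ∀ t : ℂ, t.re = x → h (-t) = -h t) :
    lineIntegral h (-x) = -lineIntegral h x := by
  rw [lineIntegral, lineIntegral, ← integral_neg_eq_self, ← integral_neg]
  refine integral_congr_ae (Eventually.of_forall fun y => ?_)
  simp only
  rw [← hodd _ (add_mul_I_re x y)]
  congr 1
  push_cast
  ring

/-- The integrals over `Re t = x` and `Re t = -x` agree by Cauchy's theorem and are opposite by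
oddness. -/
theorem lineIntegral_odd_eq_zero {h : ℂ → ℂ} {x : ℝ} (hodd : ∀ t : ℂ, t.re = x → h (-t) = -h t)
    (hx : 0 ≤ x) (hd : DifferentiableOn ℂ h {t : ℂ | -x ≤ t.re ∧ t.re ≤ x}) {C Y : ℝ}
    (hb : ∀ t : ℂ, -x ≤ t.re → t.re ≤ x → Y ≤ |t.im| → ‖h t‖ ≤ C / t.im ^ 2) :
    lineIntegral h x = 0 := by
  have h1 := lineIntegral_eq (by linarith) hd hb
  rw [lineIntegral_neg_of_odd hodd] at h1
  have : (2 : ℂ) * lineIntegral h x = 0 := by linear_combination -h1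
  simpa using this


/-! ### Residue kernels on vertical lines -/

/-- The subtracted `log y` cancels in combinations of logarithms whose coefficients sum to zero,
such as the primitive of `kernel`. -/
theorem tendsto_log_add_mul_I (c : ℂ) :
    Tendsto (fun y : ℝ => log (c + y * I) - Real.log y) atTop (𝓝 (Real.pi / 2 * I)) := by
  have h1 : Tendsto (fun y : ℝ => log (I + c * ((y⁻¹ : ℝ) : ℂ))) atTop (𝓝 (log I)) := by
    have h2 : Tendsto (fun y : ℝ => I + c * ((y⁻¹ : ℝ) : ℂ)) atTop (𝓝 (I + c * ((0 : ℝ) : ℂ))) :=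
      tendsto_const_nhds.add (tendsto_const_nhds.mul
        ((continuous_ofReal.tendsto 0).comp tendsto_inv_atTop_zero))
    rw [ofReal_zero, mul_zero, add_zero] at h2
    exact (continuousAt_clog (by simp [slitPlane])).tendsto.comp h2
  rw [log_I] at h1
  refine h1.congr' ?_
  filter_upwards [eventually_gt_atTop (‖c‖ + 1)] with y hy
  have hy0 : 0 < y := by linarith [norm_nonneg c]
  have hyC : (y : ℂ) ≠ 0 := by exact_mod_cast hy0.ne'
  have hne : I + c * ((y⁻¹ : ℝ) : ℂ) ≠ 0 := by
    intro h
    have h3 : c * ((y⁻¹ : ℝ) : ℂ) = -I := by linear_combination h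
    have h4 := congrArg norm h3
    rw [norm_mul, norm_neg, norm_I, norm_real, Real.norm_of_nonneg (by positivity)] at h4
    rw [← div_eq_mul_inv, div_eq_one_iff_eq hy0.ne'] at h4
    linarith
  have e : c + y * I = (y : ℂ) * (I + c * ((y⁻¹ : ℝ) : ℂ)) := by
    push_cast; field_simp; ring
  rw [e, log_ofReal_mul hy0 hne]
  ring

theorem tendsto_log_sub_mul_I (c : ℂ) :
    Tendsto (fun y : ℝ => log (c - y * I) - Real.log y) atTop (𝓝 (-(Real.pi / 2 * I))) := by
  have h1 : Tendsto (fun y : ℝ => log (-I + c * ((y⁻¹ : ℝ) : ℂ))) atTop (𝓝 (log (-I))) := by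
    have h2 : Tendsto (fun y : ℝ => -I + c * ((y⁻¹ : ℝ) : ℂ)) atTop (𝓝 (-I + c * ((0 : ℝ) : ℂ))) :=
      tendsto_const_nhds.add (tendsto_const_nhds.mul
        ((continuous_ofReal.tendsto 0).comp tendsto_inv_atTop_zero))
    rw [ofReal_zero, mul_zero, add_zero] at h2
    exact (continuousAt_clog (by simp [slitPlane])).tendsto.comp h2
  rw [log_neg_I] at h1
  rw [show -(Real.pi / 2 * I : ℂ) = -(Real.pi / 2) * I by ring]
  refine h1.congr' ?_
  filter_upwards [eventually_gt_atTop (‖c‖ + 1)] with y hy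
  have hy0 : 0 < y := by linarith [norm_nonneg c]
  have hyC : (y : ℂ) ≠ 0 := by exact_mod_cast hy0.ne'
  have hne : -I + c * ((y⁻¹ : ℝ) : ℂ) ≠ 0 := by
    intro h
    have h3 : c * ((y⁻¹ : ℝ) : ℂ) = I := by linear_combination h
    have h4 := congrArg norm h3
    rw [norm_mul, norm_I, norm_real, Real.norm_of_nonneg (by positivity)] at h4
    rw [← div_eq_mul_inv, div_eq_one_iff_eq hy0.ne'] at h4
    linarith
  have e : c - y * I = (y : ℂ) * (-I + c * ((y⁻¹ : ℝ) : ℂ)) := by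
    push_cast; field_simp; ring
  rw [e, log_ofReal_mul hy0 hne]
  ring

/-- The kernel `1/(t-z) + 1/(t+z) - 2/t`. -/
noncomputable def kernel (z t : ℂ) : ℂ := 2 * z ^ 2 / (t * (t ^ 2 - z ^ 2))

theorem sq_sub_sq_ne_zero {z t : ℂ} (h1 : t.re ≠ z.re) (h2 : t.re ≠ -z.re) : t ^ 2 - z ^ 2 ≠ 0 := by
  have : t ^ 2 - z ^ 2 = (t - z) * (t + z) := by ring
  rw [this]
  refine mul_ne_zero (fun h => h1 ?_) (fun h => h2 ?_)
  · rw [sub_eq_zero.1 h]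
  · rw [eq_neg_of_add_eq_zero_left h, neg_re]

theorem norm_le_of_im_le {z t : ℂ} (h : 2 * ‖z‖ ≤ |t.im|) :
    3 / 4 * ‖t‖ ^ 2 ≤ ‖t ^ 2 - z ^ 2‖ := by
  have h1 : 2 * ‖z‖ ≤ ‖t‖ := h.trans (abs_im_le_norm t)
  have h2 : ‖t‖ ^ 2 - ‖z‖ ^ 2 ≤ ‖t ^ 2 - z ^ 2‖ := by
    have := norm_sub_norm_le (t ^ 2) (z ^ 2)
    rwa [norm_pow, norm_pow] at this
  nlinarith [norm_nonneg z]

theorem im_sq_le (t : ℂ) : t.im ^ 2 ≤ ‖t‖ ^ 2 := by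
  rw [← sq_abs t.im]
  have := abs_im_le_norm t
  gcongr

theorem integrable_kernel {z : ℂ} {x : ℝ} (hx : 0 < x) (h1 : x ≠ z.re) (h2 : x ≠ -z.re) :
    Integrable fun y : ℝ => kernel z (x + y * I) := by
  refine integrable_of_decay (C := 8 * ‖z‖ ^ 2) (Y := 2 * ‖z‖ + 1) ?_ fun y hy => ?_
  · unfold kernel
    refine Continuous.div (by fun_prop) (by fun_prop) fun y => mul_ne_zero ?_ ?_
    · intro h; have := congrArg re h; rw [add_mul_I_re] at this; simp at this; linarith
    · exact sq_sub_sq_ne_zero (by rwa [add_mul_I_re]) (by rwa [add_mul_I_re])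
  · set t : ℂ := x + y * I
    have him : t.im = y := add_mul_I_im x y
    rw [← him] at hy ⊢
    have h3 := norm_le_of_im_le (z := z) (t := t) (by linarith)
    have h4 : 1 ≤ |t.im| := by linarith [norm_nonneg z]
    have h5 : 1 ≤ ‖t‖ := h4.trans (abs_im_le_norm t)
    have h6 := im_sq_le t
    have h7 : 1 ≤ t.im ^ 2 := by rw [← sq_abs]; nlinarith
    rw [kernel, norm_div, norm_mul, norm_mul, norm_pow, Complex.norm_ofNat]
    have h8 : 3 / 4 * t.im ^ 2 ≤ ‖t‖ * ‖t ^ 2 - z ^ 2‖ := by nlinarith [norm_nonneg (t ^ 2 - z ^ 2)]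
    rw [div_le_div_iff₀ (by linarith) (by linarith)]
    nlinarith [sq_nonneg ‖z‖]

theorem hasDerivAt_log_line {a : ℂ} {ε : ℂ} {y : ℝ} (h : 0 < (a + ε * y).re) :
    HasDerivAt (fun y : ℝ => log (a + ε * y)) (ε / (a + ε * y)) y := by
  have h1 : HasDerivAt (fun y : ℝ => a + ε * y) ε y := by
    simpa using ((ofRealCLM.hasDerivAt (x := y)).const_mul ε).const_add a
  exact h1.clog_real (Or.inl h)

/-- The term `-2/t` makes the kernel decay like `t^(-3)`, so the integral converges absolutely, and
the explicit primitive `log(t-z) + log(t+z) - 2 log t` tends to `0` at both ends. -/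
theorem lineIntegral_kernel_of_lt {z : ℂ} {x : ℝ} (hx : |z.re| < x) :
    lineIntegral (kernel z) x = 0 := by
  obtain ⟨hz1, hz2⟩ := abs_lt.1 hx
  have hx0 : 0 < x := (abs_nonneg _).trans_lt hx
  set P : ℝ → ℂ := fun y => log ((x - z) + I * y) + log ((x + z) + I * y) - 2 * log (x + I * y)
  have hP : ∀ y : ℝ, HasDerivAt P (I * kernel z (x + y * I)) y := by
    intro y
    have e1 : 0 < ((x - z : ℂ) + I * y).re := by simp; linarith
    have e2 : 0 < ((x + z : ℂ) + I * y).re := by simp; linarith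
    have e3 : 0 < ((x : ℂ) + I * y).re := by simp; linarith
    refine (((hasDerivAt_log_line e1).add (hasDerivAt_log_line e2)).sub
      ((hasDerivAt_log_line e3).const_mul 2)).congr_deriv ?_
    have n1 : (x - z : ℂ) + I * y ≠ 0 := fun h => by rw [h] at e1; simp at e1
    have n2 : (x + z : ℂ) + I * y ≠ 0 := fun h => by rw [h] at e2; simp at e2
    have n3 : (x : ℂ) + I * y ≠ 0 := fun h => by rw [h] at e3; simp at e3
    have e4 : (x + y * I : ℂ) ^ 2 - z ^ 2 = ((x - z : ℂ) + I * y) * ((x + z : ℂ) + I * y) := by ring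
    have e5 : (x + y * I : ℂ) = x + I * y := by ring
    rw [kernel, e4, e5]
    field_simp
    ring
  have htop : Tendsto P atTop (𝓝 0) := by
    have := ((tendsto_log_add_mul_I (x - z)).add (tendsto_log_add_mul_I (x + z))).sub
      ((tendsto_log_add_mul_I x).const_mul 2)
    rw [show (Real.pi / 2 * I + Real.pi / 2 * I - 2 * (Real.pi / 2 * I) : ℂ) = 0 by ring] at this
    refine this.congr fun y => ?_
    simp only [P, mul_comm I]
    ring
  have hbot : Tendsto P atBot (𝓝 0) := by
    have := ((tendsto_log_sub_mul_I (x - z)).add (tendsto_log_sub_mul_I (x + z))).sub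
      ((tendsto_log_sub_mul_I x).const_mul 2)
    rw [show (-(Real.pi / 2 * I) + -(Real.pi / 2 * I) - 2 * -(Real.pi / 2 * I) : ℂ) = 0 by ring]
      at this
    refine (this.comp tendsto_neg_atBot_atTop).congr fun y => ?_
    simp only [P, mul_comm I, Function.comp_apply, ofReal_neg, neg_mul, sub_neg_eq_add]
    ring
  have hint := (integrable_kernel (z := z) hx0 (by linarith) (by linarith)).const_mul I
  have h := integral_of_hasDerivAt_of_tendsto hP hint hbot htop
  rw [integral_const_mul, sub_zero] at h
  exact (mul_eq_zero.1 h).resolve_left I_ne_zero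

theorem lineIntegral_kernel_of_gt {z : ℂ} {x : ℝ} (hx0 : 0 < x) (hx : x < z.re) :
    lineIntegral (kernel z) x = -(2 * Real.pi) := by
  -- Now `t - z` lies in the left half plane; the primitive uses `log(z - t)`, which stays in the
  -- slit plane. Its argument turns the other way, and this produces the residue `-2π`.
  set P : ℝ → ℂ := fun y => log ((z - x) + (-I) * y) + log ((x + z) + I * y) - 2 * log (x + I * y)
  have hP : ∀ y : ℝ, HasDerivAt P (I * kernel z (x + y * I)) y := by
    intro y
    have e1 : 0 < ((z - x : ℂ) + (-I) * y).re := by simp; linarith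
    have e2 : 0 < ((x + z : ℂ) + I * y).re := by simp; linarith
    have e3 : 0 < ((x : ℂ) + I * y).re := by simp; linarith
    refine (((hasDerivAt_log_line e1).add (hasDerivAt_log_line e2)).sub
      ((hasDerivAt_log_line e3).const_mul 2)).congr_deriv ?_
    have n1 : (z - x : ℂ) + (-I) * y ≠ 0 := fun h => by rw [h] at e1; simp at e1
    have n2 : (x + z : ℂ) + I * y ≠ 0 := fun h => by rw [h] at e2; simp at e2
    have n3 : (x : ℂ) + I * y ≠ 0 := fun h => by rw [h] at e3; simp at e3
    have e4 : (z - x : ℂ) + (-I) * y = z - (x + I * y) := by ring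
    have e5 : (x + z : ℂ) + I * y = z + (x + I * y) := by ring
    have e6 : (x + y * I : ℂ) = x + I * y := by ring
    rw [e4] at n1
    rw [e5] at n2
    rw [kernel, e4, e5, e6]
    generalize (x : ℂ) + I * y = D at *
    have e7 : D ^ 2 - z ^ 2 = -((z - D) * (z + D)) := by ring
    rw [e7]
    field_simp
    ring
  have htop : Tendsto P atTop (𝓝 (-(Real.pi * I))) := by
    have := ((tendsto_log_sub_mul_I (z - x)).add (tendsto_log_add_mul_I (x + z))).sub
      ((tendsto_log_add_mul_I x).const_mul 2)
    rw [show (-(Real.pi / 2 * I) + Real.pi / 2 * I - 2 * (Real.pi / 2 * I) : ℂ) =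
      -(Real.pi * I) by ring] at this
    refine this.congr fun y => ?_
    simp only [P, mul_comm I, neg_mul, ← sub_eq_add_neg]
    ring
  have hbot : Tendsto P atBot (𝓝 (Real.pi * I)) := by
    have := ((tendsto_log_add_mul_I (z - x)).add (tendsto_log_sub_mul_I (x + z))).sub
      ((tendsto_log_sub_mul_I x).const_mul 2)
    rw [show ((Real.pi / 2 * I) + -(Real.pi / 2 * I) - 2 * -(Real.pi / 2 * I) : ℂ) =
      Real.pi * I by ring] at this
    refine (this.comp tendsto_neg_atBot_atTop).congr fun y => ?_
    simp only [P, mul_comm I, Function.comp_apply, ofReal_neg, neg_mul, sub_neg_eq_add]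
    ring
  have hint := (integrable_kernel (z := z) hx0 (by linarith) (by linarith)).const_mul I
  have h := integral_of_hasDerivAt_of_tendsto hP hint hbot htop
  rw [integral_const_mul] at h
  refine mul_left_cancel₀ I_ne_zero (h.trans ?_)
  ring

theorem line_ne_zero {x : ℝ} (hx : 0 < x) (y : ℝ) : (x + y * I : ℂ) ≠ 0 := by
  intro h; have := congrArg re h; rw [add_mul_I_re] at this; simp at this; linarith

theorem line_norm_ge {x : ℝ} (y : ℝ) : |y| ≤ ‖(x + y * I : ℂ)‖ := by
  have := abs_im_le_norm (x + y * I : ℂ)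
  rwa [add_mul_I_im] at this

theorem integrable_inv_pow {x : ℝ} (hx : 0 < x) (j : ℕ) :
    Integrable fun y : ℝ => 1 / (x + y * I : ℂ) ^ (j + 2) := by
  refine integrable_of_decay (C := 1) (Y := 1)
    (Continuous.div (by fun_prop) (by fun_prop) fun y => pow_ne_zero _ (line_ne_zero hx y))
    fun y hy => ?_
  have h1 := line_norm_ge (x := x) y
  rw [norm_div, norm_one, norm_pow]
  have hy2 : 0 < y ^ 2 := by
    have : y ≠ 0 := by intro h0; rw [h0] at hy; simp at hy; linarith
    positivity
  refine one_div_le_one_div_of_le hy2 ?_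
  calc y ^ 2 = |y| ^ 2 := (sq_abs y).symm
    _ ≤ ‖(x + y * I : ℂ)‖ ^ 2 := by gcongr
    _ ≤ ‖(x + y * I : ℂ)‖ ^ (j + 2) := pow_le_pow_right₀ (hy.trans h1) (by omega)

theorem lineIntegral_inv_pow {x : ℝ} (hx : 0 < x) (j : ℕ) :
    lineIntegral (fun t => 1 / t ^ (j + 2)) x = 0 := by
  have hP : ∀ y : ℝ, HasDerivAt (fun y : ℝ => 1 / (x + y * I : ℂ) ^ (j + 1))
      (-((j + 1) * I) * (1 / (x + y * I : ℂ) ^ (j + 2))) y := by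
    intro y
    have hid : HasDerivAt (fun y : ℝ => (x + y * I : ℂ)) I y := by
      simpa using ((ofRealCLM.hasDerivAt (x := y)).mul_const I).const_add (x : ℂ)
    have hne := line_ne_zero hx y
    have h1 := (hid.pow (j + 1)).inv (pow_ne_zero _ hne)
    have h2 : (fun y : ℝ => 1 / (x + y * I : ℂ) ^ (j + 1)) =
      ((fun y : ℝ => (x + y * I : ℂ)) ^ (j + 1))⁻¹ := by
      funext y; simp
    rw [h2]
    refine h1.congr_deriv ?_
    simp only [Pi.pow_apply, Nat.add_sub_cancel]
    push_cast
    field_simp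
    ring
  have hlim : ∀ l : Filter ℝ, Tendsto (fun y : ℝ => |y|) l atTop →
      Tendsto (fun y : ℝ => 1 / (x + y * I : ℂ) ^ (j + 1)) l (𝓝 0) := by
    intro l hl
    have h1 : Tendsto (fun y : ℝ => ‖(x + y * I : ℂ)‖) l atTop :=
      tendsto_atTop_mono (fun y => line_norm_ge y) hl
    have h2 := (tendsto_pow_atTop (Nat.succ_ne_zero j)).comp h1
    refine tendsto_zero_iff_norm_tendsto_zero.2 (h2.inv_tendsto_atTop.congr fun y => ?_)
    simp
  have h := integral_of_hasDerivAt_of_tendsto hP ((integrable_inv_pow hx j).const_mul _)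
    (hlim _ tendsto_abs_atBot_atTop) (hlim _ tendsto_abs_atTop_atTop)
  rw [integral_const_mul, sub_zero] at h
  refine (mul_eq_zero.1 h).resolve_left ?_
  refine neg_ne_zero.2 (mul_ne_zero ?_ I_ne_zero)
  exact_mod_cast Nat.succ_ne_zero j

/-- The Cauchy kernel `2t/(t² - z²) = 1/(t-z) + 1/(t+z)` for even functions. -/
noncomputable def cauchyKernel (z t : ℂ) : ℂ := 2 * t / (t ^ 2 - z ^ 2)

/-- Induction through `t^(-2) · 2t/(t²-z²) = z^(-2) (2t/(t²-z²) - 2/t)`: each step lowers the power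
by two at the cost of a pure power of `t`, which integrates to zero. -/
theorem integrable_and_lineIntegral_inv_pow_mul_cauchyKernel {z : ℂ} {x : ℝ} (hx0 : 0 < x)
    (hz : |z.re| < x ∨ x < z.re) (m : ℕ) :
    Integrable (fun y : ℝ => 1 / (x + y * I : ℂ) ^ (2 * (m + 1)) * cauchyKernel z (x + y * I)) ∧
    lineIntegral (fun t => 1 / t ^ (2 * (m + 1)) * cauchyKernel z t) x =
      if |z.re| < x then 0 else -(2 * Real.pi) / z ^ (2 * (m + 1)) := by
  have hx1 : x ≠ z.re := by
    rcases hz with h | h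
    · exact (lt_of_abs_lt h).ne'
    · exact h.ne
  have hx2 : x ≠ -z.re := by
    rcases hz with h | h
    · linarith [(abs_lt.1 h).1]
    · linarith
  have hden : ∀ y : ℝ, (x + y * I : ℂ) ^ 2 - z ^ 2 ≠ 0 := fun y =>
    sq_sub_sq_ne_zero (by rwa [add_mul_I_re]) (by rwa [add_mul_I_re])
  -- The induction divides by `z²`; at `z = 0` the integrand is itself a pure power.
  rcases eq_or_ne z 0 with rfl | hz0
  · have e : ∀ y : ℝ, 1 / (x + y * I : ℂ) ^ (2 * (m + 1)) * cauchyKernel 0 (x + y * I) =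
        2 * (1 / (x + y * I : ℂ) ^ (2 * m + 1 + 2)) := by
      intro y
      have := line_ne_zero hx0 y
      rw [cauchyKernel]
      field_simp
      ring
    have h0 : |(0 : ℂ).re| < x := by simpa using hx0
    rw [if_pos h0]
    simp only [lineIntegral, e]
    refine ⟨(integrable_inv_pow hx0 _).const_mul _, ?_⟩
    rw [integral_const_mul]
    have := lineIntegral_inv_pow hx0 (2 * m + 1)
    rw [lineIntegral] at this
    rw [this, mul_zero]
  induction m with
  | zero =>
    have e : ∀ y : ℝ, 1 / (x + y * I : ℂ) ^ (2 * (0 + 1)) * cauchyKernel z (x + y * I) =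
        1 / z ^ 2 * kernel z (x + y * I) := by
      intro y
      have h1 := line_ne_zero hx0 y
      have h2 := hden y
      rw [cauchyKernel, kernel]
      field_simp
    simp only [lineIntegral, e]
    refine ⟨(integrable_kernel hx0 hx1 hx2).const_mul _, ?_⟩
    rw [integral_const_mul]
    split_ifs with h
    · have := lineIntegral_kernel_of_lt h
      rw [lineIntegral] at this
      rw [this, mul_zero]
    · have := lineIntegral_kernel_of_gt hx0 (hz.resolve_left h)
      rw [lineIntegral] at this
      rw [this]; ring
  | succ m ih =>
    have e : ∀ y : ℝ, 1 / (x + y * I : ℂ) ^ (2 * (m + 1 + 1)) * cauchyKernel z (x + y * I) =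
        1 / z ^ 2 * (1 / (x + y * I : ℂ) ^ (2 * (m + 1)) * cauchyKernel z (x + y * I)) -
        2 / z ^ 2 * (1 / (x + y * I : ℂ) ^ (2 * m + 1 + 2)) := by
      intro y
      have h1 := line_ne_zero hx0 y
      have h2 := hden y
      rw [cauchyKernel, show 2 * (m + 1 + 1) = 2 * (m + 1) + 2 by ring,
        show 2 * m + 1 + 2 = 2 * (m + 1) + 1 by ring, pow_succ _ (2 * (m + 1)),
        pow_add _ (2 * (m + 1)) 2]
      field_simp
      ring
    simp only [lineIntegral, e]
    refine ⟨(ih.1.const_mul _).sub ((integrable_inv_pow hx0 _).const_mul _), ?_⟩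
    have h1 := ih.2
    have h2 := lineIntegral_inv_pow hx0 (2 * m + 1)
    rw [lineIntegral] at h1 h2
    rw [integral_sub (ih.1.const_mul _) ((integrable_inv_pow hx0 _).const_mul _),
      integral_const_mul, integral_const_mul, h1, h2]
    split_ifs with h
    · simp
    · rw [mul_zero, sub_zero, show 2 * (m + 1 + 1) = 2 * (m + 1) + 2 by ring, pow_add]
      field_simp


/-! ### The contour integral for the Taylor remainder -/

theorem norm_cauchyKernel_le {z t : ℂ} (h : 2 * ‖z‖ ≤ |t.im|) (h1 : 1 ≤ |t.im|) :
    ‖cauchyKernel z t‖ ≤ 3 := by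
  have h3 := norm_le_of_im_le h
  have h5 : 1 ≤ ‖t‖ := h1.trans (abs_im_le_norm t)
  rw [cauchyKernel, norm_div, norm_mul, Complex.norm_ofNat, div_le_iff₀ (by nlinarith)]
  nlinarith

theorem cauchyKernel_neg (z t : ℂ) : cauchyKernel z (-t) = -cauchyKernel z t := by
  rw [cauchyKernel, cauchyKernel, neg_sq]; ring

theorem differentiableOn_cauchyKernel {z : ℂ} {s : Set ℂ} (hs : ∀ t ∈ s, t ^ 2 - z ^ 2 ≠ 0) :
    DifferentiableOn ℂ (cauchyKernel z) s := by
  intro t ht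
  unfold cauchyKernel
  exact ((by fun_prop : DifferentiableAt ℂ (fun t : ℂ => 2 * t) t).div
    (by fun_prop : DifferentiableAt ℂ (fun t : ℂ => t ^ 2 - z ^ 2) t)
    (hs t ht)).differentiableWithinAt

theorem integrable_mul_cauchyKernel {H : ℂ → ℂ} (hH : Differentiable ℂ H) {x C Y : ℝ}
    (hb : ∀ t : ℂ, |t.re| ≤ x → Y ≤ |t.im| → ‖H t‖ ≤ C / t.im ^ 2) (hx0 : 0 < x) {z : ℂ}
    (h1 : x ≠ z.re) (h2 : x ≠ -z.re) :
    Integrable fun y : ℝ => H (x + y * I) * cauchyKernel z (x + y * I) := by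
  refine integrable_of_decay (C := C * 3) (Y := max Y (2 * ‖z‖ + 1)) ?_ fun y hy => ?_
  · refine Continuous.mul (hH.continuous.comp (by fun_prop)) ?_
    unfold cauchyKernel
    exact Continuous.div (by fun_prop) (by fun_prop) fun y =>
      sq_sub_sq_ne_zero (by rwa [add_mul_I_re]) (by rwa [add_mul_I_re])
  · have e1 := add_mul_I_re x y
    have e2 := add_mul_I_im x y
    have h3 := hb (x + y * I) (by rw [e1, abs_of_pos hx0]) (by
      rw [e2]; exact (le_max_left _ _).trans hy)
    have h4 : 2 * ‖z‖ + 1 ≤ |y| := (le_max_right _ _).trans hy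
    have h5 := norm_cauchyKernel_le (z := z) (t := x + y * I) (by rw [e2]; linarith)
      (by rw [e2]; linarith [norm_nonneg z])
    rw [e2] at h3
    rw [norm_mul, mul_div_right_comm]
    exact mul_le_mul h3 h5 (norm_nonneg _) ((norm_nonneg _).trans h3)

theorem lineIntegral_even_of_gt {H : ℂ → ℂ} (hH : Differentiable ℂ H) (heven : ∀ t, H (-t) = H t)
    {x C Y : ℝ} (hb : ∀ t : ℂ, |t.re| ≤ x → Y ≤ |t.im| → ‖H t‖ ≤ C / t.im ^ 2) (hx0 : 0 < x) {z : ℂ}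
    (hz : x < z.re) : lineIntegral (fun t => H t * cauchyKernel z t) x = 0 := by
  refine lineIntegral_odd_eq_zero (C := C * 3) (Y := max Y (2 * ‖z‖ + 1)) (fun t _ => ?_) hx0.le ?_ ?_
  · rw [heven, cauchyKernel_neg, mul_neg]
  · refine hH.differentiableOn.mul (differentiableOn_cauchyKernel fun t ht => ?_)
    simp only [mem_ofPred_eq] at ht
    exact sq_sub_sq_ne_zero (by linarith) (by linarith)
  · intro t ht1 ht2 hy
    have h3 := hb t (abs_le.2 ⟨ht1, ht2⟩) ((le_max_left _ _).trans hy)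
    have h4 : 2 * ‖z‖ + 1 ≤ |t.im| := (le_max_right _ _).trans hy
    have h5 := norm_cauchyKernel_le (z := z) (t := t) (by linarith) (by linarith [norm_nonneg z])
    rw [norm_mul, mul_div_right_comm]
    exact mul_le_mul h3 h5 (norm_nonneg _) ((norm_nonneg _).trans h3)

theorem deriv_zero_of_even {D : ℂ → ℂ} (h : ∀ t, D (-t) = D t) : deriv D 0 = 0 := by
  have h1 := deriv_comp_neg D 0
  have h2 : (fun t => D (-t)) = D := funext h
  rw [h2, neg_zero] at h1
  have : (2 : ℂ) * deriv D 0 = 0 := by linear_combination h1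
  simpa using this

/-- Cauchy's formula by subtraction: a comparison function with the same values at `±z` is removed,
the remaining quotient is odd and holomorphic in the strip, and the comparison integral is known
from the kernels. -/
theorem lineIntegral_even_of_lt {H : ℂ → ℂ} (hH : Differentiable ℂ H) (heven : ∀ t, H (-t) = H t)
    {x C Y : ℝ} (hb : ∀ t : ℂ, |t.re| ≤ x → Y ≤ |t.im| → ‖H t‖ ≤ C / t.im ^ 2) {z : ℂ}
    (hz : |z.re| < x) : lineIntegral (fun t => H t * cauchyKernel z t) x = 2 * Real.pi * H z := by
  have hx0 : 0 < x := (abs_nonneg _).trans_lt hz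
  obtain ⟨hz1, hz2⟩ := abs_lt.1 hz
  -- The comparison function `A/(t² - q²)` has its poles outside the strip and keeps the quadratic
  -- decay, which subtracting the constant `H z` would destroy. Against the Cauchy kernel it becomes
  -- `H z` times the difference of the kernels at `z` and `q`, with integrals `0` and `-2π`.
  set q : ℂ := ((x + 1 : ℝ) : ℂ) with hq
  have hqre : q.re = x + 1 := ofReal_re _
  have hqn : ‖q‖ = x + 1 := by rw [hq, norm_real, Real.norm_of_nonneg (by linarith)]
  have hqne : ∀ t : ℂ, |t.re| < x + 1 → t ^ 2 - q ^ 2 ≠ 0 := fun t ht =>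
    sq_sub_sq_ne_zero (by rw [hqre]; linarith [(abs_lt.1 ht).2])
      (by rw [hqre]; linarith [(abs_lt.1 ht).1])
  set A : ℂ := H z * (z ^ 2 - q ^ 2) with hA
  set D : ℂ → ℂ := fun t => H t - A / (t ^ 2 - q ^ 2) with hD
  set S : Set ℂ := {t : ℂ | |t.re| < x + 1} with hS
  have hSo : IsOpen S := isOpen_lt (by fun_prop) continuous_const
  have hzS : z ∈ S := by simp only [hS, mem_ofPred_eq]; linarith
  have hnzS : -z ∈ S := by simp only [hS, mem_ofPred_eq, neg_re, abs_neg]; linarith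
  have hDd : DifferentiableOn ℂ D S := by
    intro t ht
    exact ((hH t).sub ((differentiableAt_const A).div (by fun_prop)
      (hqne t ht))).differentiableWithinAt
  have hDeven : ∀ t, D (-t) = D t := by
    intro t; simp only [hD, heven, neg_sq]
  have hDz : D z = 0 := by
    simp only [hD, hA, mul_div_cancel_right₀ _ (hqne z hzS), sub_self]
  set D1 := dslope D z
  have hD1d : DifferentiableOn ℂ D1 S := (differentiableOn_dslope (hSo.mem_nhds hzS)).2 hDd
  -- If `z = 0` the two zeros of `D` coincide, and the double zero comes from `D'(0) = 0`, by
  -- evenness.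
  have hD1z : D1 (-z) = 0 := by
    rcases eq_or_ne z 0 with h0 | h0
    · simp only [D1, h0, neg_zero, dslope_same]
      exact deriv_zero_of_even hDeven
    · have : -z ≠ z := fun h => h0 (self_eq_neg.1 h.symm)
      simp only [D1]
      rw [dslope_of_ne _ this, slope_def_field, hDeven, sub_self, zero_div]
  set D2 := dslope D1 (-z)
  have hD2d : DifferentiableOn ℂ D2 S := (differentiableOn_dslope (hSo.mem_nhds hnzS)).2 hD1d
  have hD2 : ∀ t, t ^ 2 - z ^ 2 ≠ 0 → D2 t = D t / (t ^ 2 - z ^ 2) := by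
    intro t ht
    have e : t ^ 2 - z ^ 2 = (t - z) * (t + z) := by ring
    have h1 : t ≠ z := by rintro rfl; simp at ht
    have h2 : t ≠ -z := by rintro rfl; simp at ht
    have h3 : t - z ≠ 0 := sub_ne_zero.2 h1
    have h4 : t + z ≠ 0 := fun h => h2 (eq_neg_of_add_eq_zero_left h)
    simp only [D2]
    rw [dslope_of_ne _ h2, slope_def_field, hD1z, sub_zero]
    simp only [D1]
    rw [dslope_of_ne _ h1, slope_def_field, hDz, sub_zero, e, sub_neg_eq_add]
    field_simp
  have hxz : ∀ t : ℂ, t.re = x → t ^ 2 - z ^ 2 ≠ 0 := fun t ht =>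
    sq_sub_sq_ne_zero (by linarith) (by linarith)
  have hzero : lineIntegral (fun t => 2 * t * D2 t) x = 0 := by
    refine lineIntegral_odd_eq_zero (C := (C + 2 * ‖A‖) * 3)
      (Y := max Y (2 * ‖z‖ + 2 * ‖q‖ + 1)) (fun t ht => ?_) hx0.le ?_ ?_
    · rw [hD2 t (hxz t ht), hD2 (-t) (by rw [neg_sq]; exact hxz t ht), hDeven, neg_sq]
      ring
    · refine (by fun_prop : Differentiable ℂ fun t : ℂ => 2 * t).differentiableOn.mul
        (hD2d.mono fun t ht => ?_)
      simp only [mem_ofPred_eq] at ht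
      simp only [hS, mem_ofPred_eq]
      exact (abs_le.2 ht).trans_lt (by linarith)
    · intro t ht1 ht2 hy
      have h3 := hb t (abs_le.2 ⟨ht1, ht2⟩) ((le_max_left _ _).trans hy)
      have h4 : 2 * ‖z‖ + 2 * ‖q‖ + 1 ≤ |t.im| := (le_max_right _ _).trans hy
      have hzn := norm_nonneg z
      have hqn' := norm_nonneg q
      have h5 := norm_cauchyKernel_le (z := z) (t := t) (by linarith) (by linarith)
      have h6 := norm_le_of_im_le (z := q) (t := t) (by linarith)
      have h7 := norm_le_of_im_le (z := z) (t := t) (by linarith)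
      have h8 := im_sq_le t
      have h9 : 1 ≤ t.im ^ 2 := by rw [← sq_abs]; nlinarith
      have hne : t ^ 2 - z ^ 2 ≠ 0 := by
        intro h; rw [h, norm_zero] at h7; linarith
      have e : 2 * t * D2 t = D t * cauchyKernel z t := by
        rw [hD2 t hne, cauchyKernel]; ring
      have h10 : ‖D t‖ ≤ (C + 2 * ‖A‖) / t.im ^ 2 := by
        refine (norm_sub_le _ _).trans ?_
        rw [add_div]
        refine add_le_add h3 ?_
        rw [norm_div, div_le_div_iff₀ (by linarith) (by linarith)]
        nlinarith [norm_nonneg A]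
      rw [e, norm_mul, mul_div_right_comm]
      exact mul_le_mul h10 h5 (norm_nonneg _) ((norm_nonneg _).trans h10)
  have hi1 : Integrable fun y : ℝ => kernel z (x + y * I) :=
    integrable_kernel hx0 (by linarith) (by linarith)
  have hi2 : Integrable fun y : ℝ => kernel q (x + y * I) :=
    integrable_kernel hx0 (by rw [hqre]; linarith) (by rw [hqre]; linarith)
  have hi3 := integrable_mul_cauchyKernel hH hb hx0 (z := z) (by linarith) (by linarith)
  have e : ∀ y : ℝ, 2 * (x + y * I : ℂ) * D2 (x + y * I) =
      H (x + y * I) * cauchyKernel z (x + y * I) -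
        H z * (kernel z (x + y * I) - kernel q (x + y * I)) := by
    intro y
    have hre := add_mul_I_re x y
    have h1 := hxz (x + y * I) hre
    have h2 := hqne (x + y * I) (by rw [hre, abs_of_pos hx0]; linarith)
    have h3 := line_ne_zero hx0 y
    rw [hD2 _ h1, hD, cauchyKernel, kernel, kernel]
    simp only [hA]
    generalize (x + y * I : ℂ) = t at *
    field_simp
    ring
  simp only [lineIntegral, e] at hzero
  have hi12 : Integrable fun y : ℝ => kernel z (x + y * I) - kernel q (x + y * I) := hi1.sub hi2
  rw [integral_sub hi3 (hi12.const_mul _), integral_const_mul, integral_sub hi1 hi2] at hzero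
  have k1 := lineIntegral_kernel_of_lt hz
  have k2 := lineIntegral_kernel_of_gt (z := q) hx0 (by rw [hqre]; linarith)
  rw [lineIntegral] at k1 k2
  rw [k1, k2] at hzero
  rw [lineIntegral]
  linear_combination hzero

/-- The even entire function `(f(λt) - T_{2n-1}(λt)) / t^(2n)`. -/
noncomputable def scaledRemainder (n : ℕ) (lam : ℝ) (t : ℂ) : ℂ :=
  lam ^ (2 * n) * remainder (2 * n) (lam * t)

theorem differentiable_scaledRemainder (n : ℕ) (lam : ℝ) :
    Differentiable ℂ (scaledRemainder n lam) := by
  have := differentiable_remainder (2 * n)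
  unfold scaledRemainder
  fun_prop

theorem scaledRemainder_neg {n : ℕ} (hn : 1 ≤ n) (lam : ℝ) (t : ℂ) :
    scaledRemainder n lam (-t) = scaledRemainder n lam t := by
  rw [scaledRemainder, scaledRemainder, mul_neg, remainder_neg hn]

theorem f_eq_T_add_scaledRemainder {n : ℕ} (hn : 1 ≤ n) (lam : ℝ) (t : ℂ) :
    f (lam * t) = T (2 * n - 1) (lam * t) + t ^ (2 * n) * scaledRemainder n lam t := by
  rw [f_eq_T_add (m := 2 * n) (by omega), scaledRemainder, mul_pow]
  ring

/-- Divide `f - T` by `t^(2n)`: on a strip `f` is `O(|t|²)` and the polynomial is `O(|t|^(2n-2))`.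
The first is dominated by the second because `n ≥ 2`. -/
theorem norm_scaledRemainder_le {n : ℕ} (hn : 2 ≤ n) (lam x : ℝ) :
    ∃ C : ℝ, ∀ t : ℂ, |t.re| ≤ x → 1 ≤ |t.im| → ‖scaledRemainder n lam t‖ ≤ C / t.im ^ 2 := by
  obtain ⟨C, hC, h⟩ := norm_f_le_strip (|lam| * x)
  set S := ∑ k ∈ Finset.range n, ‖coeff (2 * k)‖ * |lam| ^ (2 * k)
  refine ⟨C * (1 + lam ^ 2) + S, fun t ht1 ht2 => ?_⟩
  have ht0 : 1 ≤ ‖t‖ := ht2.trans (abs_im_le_norm t)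
  have htne : t ≠ 0 := by intro h0; rw [h0] at ht0; simp at ht0; linarith
  have him : 0 < t.im ^ 2 := by rw [← sq_abs]; positivity
  have h1 : ‖f (lam * t)‖ ≤ C * (1 + lam ^ 2) * ‖t‖ ^ 2 := by
    have := h (lam * t) (by
      rw [re_ofReal_mul, abs_mul]; gcongr)
    refine this.trans ?_
    rw [norm_mul, norm_real, Real.norm_eq_abs, mul_pow, sq_abs, mul_assoc]
    gcongr
    nlinarith
  have h2 : ‖T (2 * n - 1) (lam * t)‖ ≤ S * ‖t‖ ^ (2 * n - 2) := by
    rw [T_sub_one_eq (by omega), Finset.sum_mul]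
    refine (norm_sum_le _ _).trans (Finset.sum_le_sum fun k hk => ?_)
    rw [norm_mul, norm_pow, norm_mul, norm_real, Real.norm_eq_abs, mul_pow, ← mul_assoc]
    have := Finset.mem_range.1 hk
    have : ‖t‖ ^ (2 * k) ≤ ‖t‖ ^ (2 * n - 2) := pow_le_pow_right₀ ht0 (by omega)
    gcongr
  have h3 := f_eq_T_add_scaledRemainder (n := n) (by omega) lam t
  have h4 : t ^ (2 * n) * scaledRemainder n lam t = f (lam * t) - T (2 * n - 1) (lam * t) := by
    rw [h3]; ring
  have h5 := congrArg norm h4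
  rw [norm_mul, norm_pow] at h5
  have h6 : ‖f (lam * t) - T (2 * n - 1) (lam * t)‖ ≤
      (C * (1 + lam ^ 2) + S) * ‖t‖ ^ (2 * n - 2) := by
    refine (norm_sub_le _ _).trans ?_
    rw [add_mul]
    refine add_le_add (h1.trans ?_) h2
    have : ‖t‖ ^ 2 ≤ ‖t‖ ^ (2 * n - 2) := pow_le_pow_right₀ ht0 (by omega)
    gcongr
  have hS : 0 ≤ S := Finset.sum_nonneg fun k _ => by positivity
  rw [← h5] at h6
  have h7 : ‖t‖ ^ (2 * n) = ‖t‖ ^ (2 * n - 2) * ‖t‖ ^ 2 := by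
    rw [← pow_add]; congr 1; omega
  rw [h7, mul_assoc, mul_comm (C * (1 + lam ^ 2) + S)] at h6
  have h8 := le_of_mul_le_mul_left h6 (by positivity)
  rw [le_div_iff₀ him]
  calc ‖scaledRemainder n lam t‖ * t.im ^ 2 ≤ ‖scaledRemainder n lam t‖ * ‖t‖ ^ 2 := by
        exact mul_le_mul_of_nonneg_left (im_sq_le t) (norm_nonneg _)
    _ ≤ _ := by rw [mul_comm]; exact h8

theorem f_div_pow_eq {n : ℕ} (hn : 1 ≤ n) (lam : ℝ) {t : ℂ} (ht : t ≠ 0) :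
    f (lam * t) / t ^ (2 * n) = (∑ k ∈ Finset.range n, coeff (2 * k) * lam ^ (2 * k) *
      (1 / t ^ (2 * (n - 1 - k + 1)))) + scaledRemainder n lam t := by
  rw [f_eq_T_add_scaledRemainder hn, add_div, mul_div_cancel_left₀ _ (pow_ne_zero _ ht),
    T_sub_one_eq hn, Finset.sum_div]
  congr 1
  refine Finset.sum_congr rfl fun k hk => ?_
  have := Finset.mem_range.1 hk
  rw [show 2 * n = 2 * k + 2 * (n - 1 - k + 1) by omega, pow_add, mul_pow]
  field_simp

/-- The principal part and the entire part of `f(λt)/t^(2n)` are integrated separately. A line to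
the right of `z` sees only the entire part, a line to its left only the principal part. -/
theorem lineIntegral_f_div_pow {n : ℕ} (hn : 2 ≤ n) (lam : ℝ) {x : ℝ} (hx0 : 0 < x) {z : ℂ}
    (hz : |z.re| < x ∨ x < z.re) :
    Integrable (fun y : ℝ => f (lam * (x + y * I)) / (x + y * I : ℂ) ^ (2 * n) *
      cauchyKernel z (x + y * I)) ∧
    lineIntegral (fun t => f (lam * t) / t ^ (2 * n) * cauchyKernel z t) x =
      if |z.re| < x then 2 * Real.pi * scaledRemainder n lam z
      else -(2 * Real.pi) * (T (2 * n - 1) (lam * z) / z ^ (2 * n)) := by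
  obtain ⟨C, hC⟩ := norm_scaledRemainder_le hn lam x
  have hx1 : x ≠ z.re := by
    rcases hz with h | h
    · exact (lt_of_abs_lt h).ne'
    · exact h.ne
  have hx2 : x ≠ -z.re := by
    rcases hz with h | h
    · linarith [(abs_lt.1 h).1]
    · linarith
  have hH := differentiable_scaledRemainder n lam
  have hi := integrable_mul_cauchyKernel hH hC hx0 hx1 hx2
  have hk := fun k : ℕ => integrable_and_lineIntegral_inv_pow_mul_cauchyKernel hx0 hz (n - 1 - k)
  have e : ∀ y : ℝ, f (lam * (x + y * I)) / (x + y * I : ℂ) ^ (2 * n) * cauchyKernel z (x + y * I) =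
      (∑ k ∈ Finset.range n, coeff (2 * k) * lam ^ (2 * k) *
        (1 / (x + y * I : ℂ) ^ (2 * (n - 1 - k + 1)) * cauchyKernel z (x + y * I))) +
      scaledRemainder n lam (x + y * I) * cauchyKernel z (x + y * I) := by
    intro y
    rw [f_div_pow_eq (by omega) lam (line_ne_zero hx0 y), add_mul, Finset.sum_mul]
    congr 1
    exact Finset.sum_congr rfl fun k _ => by ring
  have hsum : Integrable fun y : ℝ => ∑ k ∈ Finset.range n, coeff (2 * k) * lam ^ (2 * k) *
      (1 / (x + y * I : ℂ) ^ (2 * (n - 1 - k + 1)) * cauchyKernel z (x + y * I)) :=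
    integrable_finsetSum _ fun k _ => (hk k).1.const_mul _
  simp only [lineIntegral, e]
  refine ⟨hsum.add hi, ?_⟩
  rw [integral_add hsum hi, integral_finsetSum _ fun k _ => (hk k).1.const_mul _]
  simp only [integral_const_mul]
  have hk2 : ∀ k, ∫ y : ℝ, 1 / (x + y * I : ℂ) ^ (2 * (n - 1 - k + 1)) *
      cauchyKernel z (x + y * I) =
      if |z.re| < x then 0 else -(2 * Real.pi) / z ^ (2 * (n - 1 - k + 1)) := fun k => (hk k).2
  simp only [hk2]
  split_ifs with h
  · have := lineIntegral_even_of_lt hH (scaledRemainder_neg (by omega) lam) hC h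
    rw [lineIntegral] at this
    rw [this]
    simp
  · have hz' := hz.resolve_left h
    have := lineIntegral_even_of_gt hH (scaledRemainder_neg (by omega) lam) hC hx0 hz'
    rw [lineIntegral] at this
    rw [this, add_zero, T_sub_one_eq (by omega), Finset.sum_div, Finset.mul_sum]
    have hz0 : z ≠ 0 := by
      rintro rfl; simp at hz'; linarith
    refine Finset.sum_congr rfl fun k hk => ?_
    have := Finset.mem_range.1 hk
    rw [show 2 * n = 2 * k + 2 * (n - 1 - k + 1) by omega, pow_add, mul_pow]
    field_simp


/-! ### The logarithm of `f(λz)/f(λ)` -/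

/-- The branch of `log (f(λz)/f(λ))` that vanishes at `1`. -/
noncomputable def logRatio (lam : ℝ) (z : ℂ) : ℂ :=
  ∫ t in (0 : ℝ)..1, (lam : ℂ) * (z - 1) * logDeriv f ((lam : ℂ) * (1 + (t : ℂ) * (z - 1)))

theorem phase_eq (n : ℕ) (lam : ℝ) (z : ℂ) :
    phase n lam z = 2 * log z - 1 / (n : ℂ) * logRatio lam z := rfl

theorem logRatio_one (lam : ℝ) : logRatio lam 1 = 0 := by
  simp [logRatio]

theorem exp_logRatio {lam : ℝ} (hlam : 1 / 2 < lam) {z : ℂ} (hz : 1 / 2 < lam * z.re) :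
    exp (logRatio lam z) = f (lam * z) / f lam := by
  have h := exp_phase (n := 1) one_ne_zero hlam hz
  have hz0 : z ≠ 0 := by
    rintro rfl; simp at hz; linarith
  have hf1 : f (lam * z) ≠ 0 := f_ne_zero (by rwa [re_ofReal_mul])
  have hf2 : f lam ≠ 0 := f_ne_zero (by rwa [ofReal_re])
  rw [phase_eq, expPhase] at h
  simp only [Nat.cast_one, div_one, one_mul, mul_one] at h
  rw [exp_sub, two_mul, exp_add, exp_log hz0, div_eq_iff (exp_ne_zero _)] at h
  generalize f (lam * z) = a at *
  field_simp at h
  rw [eq_div_iff hf2]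
  linear_combination -h

/-- For `λ > 2` the disc of radius `3λ/4` about `λ` lies in `Re u > 1/2`, so `f'/f` has a primitive
there and the segment integral is a difference of its values. -/
theorem hasDerivAt_logRatio {lam : ℝ} (hlam : 2 < lam) {z : ℂ}
    (hz : z ∈ Metric.ball (1 : ℂ) (3 / 4)) :
    HasDerivAt (logRatio lam) (lam * logDeriv f (lam * z)) z := by
  have hlam0 : 0 < lam := by linarith
  set b := Metric.ball (lam : ℂ) (3 / 4 * lam)
  have hbre : ∀ u ∈ b, 1 / 2 < u.re := by
    intro u hu
    have h1 : ‖u - lam‖ < 3 / 4 * lam := by simpa [b, dist_eq_norm] using hu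
    have h2 := (abs_re_le_norm (u - lam)).trans_lt h1
    rw [sub_re, ofReal_re, abs_lt] at h2
    linarith
  obtain ⟨P, hP⟩ := (differentiableOn_logDeriv_f.mono fun u hu => hbre u hu :
    DifferentiableOn ℂ (logDeriv f) b).isExactOn_ball
  have hmaps : ∀ u ∈ Metric.ball (1 : ℂ) (3 / 4), (lam : ℂ) * u ∈ b := by
    intro u hu
    have h1 : ‖u - 1‖ < 3 / 4 := by simpa [dist_eq_norm] using hu
    have : (lam : ℂ) * u - lam = lam * (u - 1) := by ring
    simp only [b, Metric.mem_ball, dist_eq_norm, this, norm_mul, norm_real,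
      Real.norm_of_nonneg hlam0.le]
    nlinarith
  have heq : ∀ u ∈ Metric.ball (1 : ℂ) (3 / 4), logRatio lam u = P (lam * u) - P lam := by
    intro u hu
    have hseg : ∀ t ∈ Icc (0 : ℝ) 1, 1 + (t : ℂ) * (u - 1) ∈ Metric.ball (1 : ℂ) (3 / 4) := by
      intro t ht
      have h1 : ‖u - 1‖ < 3 / 4 := by simpa [dist_eq_norm] using hu
      simp only [Metric.mem_ball, dist_eq_norm, add_sub_cancel_left, norm_mul, norm_real,
        Real.norm_of_nonneg ht.1]
      nlinarith [ht.2, norm_nonneg (u - 1)]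
    have hd : ∀ t ∈ uIcc (0 : ℝ) 1, HasDerivAt (fun t : ℝ => P (lam * (1 + (t : ℂ) * (u - 1))))
        ((lam : ℂ) * (u - 1) * logDeriv f ((lam : ℂ) * (1 + (t : ℂ) * (u - 1)))) t := by
      intro t ht
      rw [uIcc_of_le zero_le_one] at ht
      have h1 : HasDerivAt (fun t : ℝ => (lam : ℂ) * (1 + (t : ℂ) * (u - 1)))
          (lam * (1 * (u - 1))) t :=
        (((ofRealCLM.hasDerivAt (x := t)).mul_const (u - 1)).const_add 1).const_mul (lam : ℂ)
      refine (HasDerivAt.comp (h₂ := P) t (hP _ (hmaps _ (hseg t ht))) h1).congr_deriv ?_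
      ring
    have hc : ContinuousOn (fun t : ℝ => (lam : ℂ) * (u - 1) *
        logDeriv f ((lam : ℂ) * (1 + (t : ℂ) * (u - 1)))) (uIcc 0 1) := by
      rw [uIcc_of_le zero_le_one]
      refine continuousOn_const.mul (differentiableOn_logDeriv_f.continuousOn.comp
        (by fun_prop) fun t ht => hbre _ (hmaps _ (hseg t ht)))
    rw [logRatio, intervalIntegral.integral_eq_sub_of_hasDerivAt hd hc.intervalIntegrable]
    simp
  have h1 : HasDerivAt (fun u : ℂ => (lam : ℂ) * u) lam z := by
    simpa using (hasDerivAt_id z).const_mul (lam : ℂ)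
  have h2 := (HasDerivAt.comp (h₂ := P) z (hP _ (hmaps z hz)) h1).sub_const (P lam)
  refine (h2.congr_of_eventuallyEq ?_).congr_deriv (by ring)
  filter_upwards [Metric.isOpen_ball.mem_nhds hz] with u hu
  rw [heq u hu]
  rfl

theorem ball_re {z : ℂ} (hz : z ∈ Metric.ball (1 : ℂ) (3 / 4)) : 1 / 4 < z.re ∧ z.re < 7 / 4 := by
  have h1 : ‖z - 1‖ < 3 / 4 := by simpa [dist_eq_norm] using hz
  have h2 := (abs_re_le_norm (z - 1)).trans_lt h1
  rw [sub_re, one_re, abs_lt] at h2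
  constructor <;> linarith

theorem logRatio_re {lam : ℝ} (hlam : 1 / 2 < lam) {z : ℂ} (hz : 1 / 2 < lam * z.re) :
    (logRatio lam z).re = Real.log (‖f (lam * z)‖ / ‖f lam‖) := by
  rw [← norm_div, ← exp_logRatio hlam hz, norm_exp, Real.log_exp]

/-- The logarithm of `f(λz)/f(λ)` minus its linear part. -/
noncomputable def logDefect (lam : ℝ) (z : ℂ) : ℂ :=
  logRatio lam z - lam * logDeriv f lam * (z - 1)

theorem logDefect_one (lam : ℝ) : logDefect lam 1 = 0 := by
  simp [logDefect, logRatio_one]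

theorem hasDerivAt_logDefect {lam : ℝ} (hlam : 2 < lam) {z : ℂ}
    (hz : z ∈ Metric.ball (1 : ℂ) (3 / 4)) :
    HasDerivAt (logDefect lam) (lam * (logDeriv f (lam * z) - logDeriv f lam)) z := by
  refine ((hasDerivAt_logRatio hlam hz).sub
    (((hasDerivAt_id z).sub_const 1).const_mul (lam * logDeriv f lam))).congr_deriv ?_
  ring

theorem differentiableOn_logDefect {lam : ℝ} (hlam : 2 < lam) :
    DifferentiableOn ℂ (logDefect lam) (Metric.ball (1 : ℂ) (3 / 4)) := fun _ hz =>
  (hasDerivAt_logDefect hlam hz).differentiableAt.differentiableWithinAt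

/-- By Stirling the derivative of the defect is `λ(½ log u + O(1/λ))`, in which the large term `log
λ` has cancelled. The mean value inequality from `u = 1` concludes. -/
theorem exists_norm_logDefect_real_le :
    ∃ C : ℝ, 0 ≤ C ∧ ∀ lam : ℝ, 12 ≤ lam → ∀ x : ℝ, 1 / 4 < x → x < 7 / 4 →
      ‖logDefect lam x‖ ≤ C * lam := by
  obtain ⟨C, hC, h⟩ := norm_logDeriv_f_sub_log_le
  refine ⟨2 + C, by positivity, fun lam hlam x hx1 hx2 => ?_⟩
  have hlam0 : 0 < lam := by linarith
  have hmem : ∀ u ∈ Ioo (1 / 4 : ℝ) (7 / 4), (u : ℂ) ∈ Metric.ball (1 : ℂ) (3 / 4) := by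
    intro u hu
    have : (u : ℂ) - 1 = ((u - 1 : ℝ) : ℂ) := by push_cast; ring
    rw [Metric.mem_ball, dist_eq_norm, this, norm_real, Real.norm_eq_abs, abs_lt]
    constructor <;> linarith [hu.1, hu.2]
  have hd : ∀ u ∈ Ioo (1 / 4 : ℝ) (7 / 4), HasDerivWithinAt (fun u : ℝ => logDefect lam u)
      (lam * (logDeriv f (lam * u) - logDeriv f lam)) (Ioo (1 / 4) (7 / 4)) u := fun u hu =>
    (hasDerivAt_logDefect (by linarith) (hmem u hu)).comp_ofReal.hasDerivWithinAt
  have hbound : ∀ u ∈ Ioo (1 / 4 : ℝ) (7 / 4),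
      ‖(lam : ℂ) * (logDeriv f (lam * u) - logDeriv f lam)‖ ≤ (2 + C) * lam := by
    intro u hu
    have h1 := h (lam * u) (by nlinarith [hu.1])
    have h2 := h lam (by linarith)
    have hu0 : 0 < u := by linarith [hu.1]
    have h3 : Real.log (lam * u / (2 * Real.pi)) = Real.log u + Real.log (lam / (2 * Real.pi)) := by
      rw [← Real.log_mul hu0.ne' (by positivity)]; congr 1; ring
    have h4 : |Real.log u| ≤ 3 := by
      rw [abs_le]
      constructor
      · have := Real.one_sub_inv_le_log_of_pos hu0
        have h5 : u⁻¹ ≤ 4 := by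
          rw [inv_le_comm₀ hu0 (by norm_num)]; linarith [hu.1]
        linarith
      · have := Real.log_le_sub_one_of_pos hu0
        linarith [hu.2]
    have h5 : C / (lam * u) ≤ C / 3 := by
      gcongr; nlinarith [hu.1]
    have h6 : C / lam ≤ C / 12 := by gcongr
    rw [norm_mul, norm_real, Real.norm_of_nonneg hlam0.le, mul_comm]
    refine mul_le_mul_of_nonneg_right ?_ hlam0.le
    push_cast at h1
    have e : logDeriv f (lam * u) - logDeriv f lam =
        (logDeriv f (lam * u) - (Real.log (lam * u / (2 * Real.pi)) / 2 : ℂ)) -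
        (logDeriv f lam - (Real.log (lam / (2 * Real.pi)) / 2 : ℝ)) + ((Real.log u / 2 : ℝ) : ℂ) := by
      rw [h3]; push_cast; ring
    rw [e]
    refine (norm_add_le _ _).trans ((add_le_add (norm_sub_le _ _) le_rfl).trans ?_)
    rw [norm_real, Real.norm_eq_abs, abs_div, abs_two]
    linarith
  have := (convex_Ioo (1 / 4 : ℝ) (7 / 4)).norm_image_sub_le_of_norm_hasDerivWithin_le hd hbound
    (x := 1) (y := x) (by constructor <;> norm_num) ⟨hx1, hx2⟩
  rw [ofReal_one, logDefect_one, sub_zero] at this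
  refine this.trans ?_
  have h7 : ‖x - 1‖ ≤ 1 := by rw [Real.norm_eq_abs, abs_le]; constructor <;> linarith
  have : 0 ≤ (2 + C) * lam := by positivity
  nlinarith

theorem norm_f_le_real {lam : ℝ} (hlam : 12 ≤ lam) {z : ℂ} (hz1 : 1 / 4 < z.re) :
    ‖f (lam * z)‖ ≤ 20 * (‖z‖ ^ 2 + 1) * ‖f (lam * z.re)‖ := by
  have hre : ((lam : ℂ) * z).re = lam * z.re := re_ofReal_mul _ _
  have hx : 3 ≤ lam * z.re := by nlinarith
  have h1 := norm_f_mul_le (z := lam * z) (by rw [hre]; linarith)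
  rw [hre] at h1
  have h2 : ‖((lam : ℂ) * z) ^ 2 - 1 / 4‖ ≤ lam ^ 2 * (‖z‖ ^ 2 + 1) := by
    refine (norm_sub_le _ _).trans ?_
    rw [norm_pow, norm_mul, norm_real, Real.norm_of_nonneg (by linarith)]
    norm_num
    nlinarith
  have h3 : lam ^ 2 / 20 ≤ (lam * z.re) ^ 2 - 1 / 4 := by
    have : lam ^ 2 / 16 ≤ (lam * z.re) ^ 2 := by
      rw [mul_pow]
      have : (1 / 4 : ℝ) ^ 2 ≤ z.re ^ 2 := by gcongr
      nlinarith
    nlinarith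
  push_cast at h1
  have h4 : ‖f (lam * z)‖ * (lam ^ 2 / 20) ≤ lam ^ 2 * (‖z‖ ^ 2 + 1) * ‖f (lam * z.re)‖ :=
    (mul_le_mul_of_nonneg_left h3 (norm_nonneg _)).trans
      (h1.trans (mul_le_mul_of_nonneg_right h2 (norm_nonneg _)))
  have h5 : 0 < lam ^ 2 := by positivity
  have h6 : lam ^ 2 * (‖f (lam * z)‖) ≤ lam ^ 2 * (20 * (‖z‖ ^ 2 + 1) * ‖f (lam * z.re)‖) := by
    nlinarith
  exact le_of_mul_le_mul_left h6 h5

/-- Comparison with the real axis bounds `|f(λu)|` from above, hence the real part of the defect on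
the disc of radius `3/4`. Since the defect vanishes at `1`, Borel–Carathéodory turns this one-sided
bound into a bound for the modulus on the smaller disc. -/
theorem exists_norm_logDefect_le :
    ∃ C : ℝ, 0 ≤ C ∧ ∀ lam : ℝ, 12 ≤ lam → ∀ z ∈ Metric.ball (1 : ℂ) (1 / 2),
      ‖logDefect lam z‖ ≤ C * lam := by
  obtain ⟨C, hC, h⟩ := exists_norm_logDefect_real_le
  refine ⟨4 * (C + 120), by positivity, fun lam hlam z hz => ?_⟩
  have hlam0 : 0 < lam := by linarith
  have hre : ∀ u ∈ Metric.ball (1 : ℂ) (3 / 4), (logDefect lam u).re ≤ (C + 120) * lam := by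
    intro u hu
    obtain ⟨hu1, hu2⟩ := ball_re hu
    have hlu : 1 / 2 < lam * u.re := by nlinarith
    have e1 := logRatio_re (by linarith : 1 / 2 < lam) hlu
    have e2 := logRatio_re (z := (u.re : ℂ)) (by linarith : 1 / 2 < lam) (by simpa using hlu)
    have hf : ∀ v : ℂ, 1 / 2 < lam * v.re → 0 < ‖f (lam * v)‖ := fun v hv =>
      norm_pos_iff.2 (f_ne_zero (by rwa [re_ofReal_mul]))
    have hf0 : 0 < ‖f lam‖ := norm_pos_iff.2 (f_ne_zero (by rw [ofReal_re]; linarith))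
    have hb := norm_f_le_real hlam hu1
    have hun : ‖u‖ ≤ 7 / 4 := by
      have h1 : ‖u - 1‖ < 3 / 4 := by simpa [dist_eq_norm] using hu
      have := norm_add_le (u - 1) 1
      rw [sub_add_cancel, norm_one] at this
      linarith
    have hb2 : ‖f (lam * u)‖ ≤ 100 * ‖f (lam * u.re)‖ := by
      refine hb.trans (mul_le_mul_of_nonneg_right ?_ (norm_nonneg _))
      nlinarith [norm_nonneg u]
    have hur : 0 < ‖f (lam * u.re)‖ := hf u.re (by simpa using hlu)
    have h3 : (logRatio lam u).re ≤ 100 + (logRatio lam u.re).re := by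
      rw [e1, e2]
      have h4 : Real.log (‖f (lam * u)‖ / ‖f lam‖) ≤
          Real.log (100 * (‖f (lam * u.re)‖ / ‖f lam‖)) := by
        refine Real.log_le_log (div_pos (hf u hlu) hf0) ?_
        rw [← mul_div_assoc]
        gcongr
      rw [Real.log_mul (by norm_num) (div_pos hur hf0).ne'] at h4
      have : Real.log 100 ≤ 100 := (Real.log_le_sub_one_of_pos (by norm_num)).trans (by norm_num)
      linarith
    have h5 := (re_le_norm _).trans (h lam hlam u.re hu1 hu2)
    -- The coefficient `λ f'(λ)/f(λ)` is real, so the linear part has the same real part at `u` and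
    -- at `Re u`.
    have e3 : (lam * logDeriv f lam * (u - 1)).re = (lam * logDeriv f lam * ((u.re : ℂ) - 1)).re := by
      rw [logDeriv_f_ofReal (by linarith : 1 / 2 < lam), ← ofReal_mul, re_ofReal_mul,
        re_ofReal_mul]
      simp
    rw [logDefect, sub_re] at h5 ⊢
    rw [e3]
    nlinarith
  have hz' : ‖z - 1‖ < 1 / 2 := by simpa [dist_eq_norm] using hz
  have hmaps : MapsTo (fun u : ℂ => 1 + u) (Metric.ball 0 (3 / 4)) (Metric.ball 1 (3 / 4)) := by
    intro u hu
    simpa [dist_eq_norm] using hu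
  have hbc := borelCaratheodory_zero (f := fun u => logDefect lam (1 + u)) (M := (C + 120) * lam)
    (R := 3 / 4) (z := z - 1) (by positivity)
    ((differentiableOn_logDefect (by linarith)).comp (by fun_prop) hmaps)
    (fun u hu => hre _ (hmaps hu)) (by norm_num) (by simp [dist_eq_norm]; linarith)
    (by simp [logDefect_one])
  simp only [add_sub_cancel] at hbc
  refine hbc.trans ?_
  rw [div_le_iff₀ (by linarith)]
  have : 0 ≤ (C + 120) * lam := by positivity
  nlinarith [norm_nonneg (z - 1)]

/-- Two Cauchy estimates for the defect in the rescaled variable: its first derivative is `λ` times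
`g(z) = (f'/f)(λz) - (f'/f)(λ)`, and `g'(1) = λ (f'/f)'(λ)`. -/
theorem exists_norm_deriv_logDeriv_le :
    ∃ C : ℝ, 0 ≤ C ∧ ∀ lam : ℝ, 12 ≤ lam → lam * ‖deriv (logDeriv f) lam‖ ≤ C := by
  obtain ⟨C, hC, h⟩ := exists_norm_logDefect_le
  refine ⟨8 * (8 * C), by positivity, fun lam hlam => ?_⟩
  have hlam0 : 0 < lam := by linarith
  set g : ℂ → ℂ := fun z => logDeriv f (lam * z) - logDeriv f lam
  have hder : ∀ z ∈ Metric.ball (1 : ℂ) (3 / 4), deriv (logDefect lam) z = lam * g z := fun z hz =>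
    (hasDerivAt_logDefect (by linarith) hz).deriv
  have hg : ∀ z ∈ Metric.closedBall (1 : ℂ) (1 / 8), ‖g z‖ ≤ 8 * C := by
    intro z hz
    have hz' : ‖z - 1‖ ≤ 1 / 8 := by simpa [dist_eq_norm] using hz
    have hsub : ∀ u ∈ Metric.closedBall z (1 / 8), u ∈ Metric.ball (1 : ℂ) (1 / 2) := by
      intro u hu
      have hu' : ‖u - z‖ ≤ 1 / 8 := by simpa [dist_eq_norm] using hu
      rw [Metric.mem_ball, dist_eq_norm]
      have := norm_add_le (u - z) (z - 1)
      rw [sub_add_sub_cancel] at this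
      linarith
    have hsub' : ∀ u ∈ Metric.closedBall z (1 / 8), u ∈ Metric.ball (1 : ℂ) (3 / 4) := fun u hu =>
      Metric.ball_subset_ball (by norm_num) (hsub u hu)
    have h1 := norm_deriv_le_of_forall_mem_sphere_norm_le (f := logDefect lam) (c := z)
      (R := 1 / 8) (C := C * lam) (by norm_num)
      (((differentiableOn_logDefect (by linarith)).mono hsub').diffContOnCl_ball subset_rfl)
      (fun u hu => h lam hlam u (hsub u (Metric.sphere_subset_closedBall hu)))
    rw [hder z (hsub' z (by simp)), norm_mul, norm_real, Real.norm_of_nonneg hlam0.le] at h1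
    have h2 : lam * ‖g z‖ ≤ lam * (8 * C) := by linarith
    exact le_of_mul_le_mul_left h2 hlam0
  have hgd : ∀ z ∈ Metric.closedBall (1 : ℂ) (1 / 8), DifferentiableAt ℂ g z := by
    intro z hz
    have hz' : z ∈ Metric.ball (1 : ℂ) (3 / 4) := Metric.closedBall_subset_ball (by norm_num) hz
    have hlz : 1 / 2 < ((lam : ℂ) * z).re := by
      rw [re_ofReal_mul]; nlinarith [(ball_re hz').1]
    have h1 := (differentiableOn_logDeriv_f _ hlz).differentiableAt (isOpen_half_lt_re.mem_nhds hlz)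
    exact (DifferentiableAt.comp (g := logDeriv f) z h1 (by fun_prop)).sub_const _
  have h2 := norm_deriv_le_of_forall_mem_sphere_norm_le (f := g) (c := 1)
    (R := 1 / 8) (C := 8 * C) (by norm_num)
    (DifferentiableOn.diffContOnCl_ball (U := Metric.closedBall 1 (1 / 8))
      (fun z hz => (hgd z hz).differentiableWithinAt) subset_rfl)
    (fun u hu => hg u (Metric.sphere_subset_closedBall hu))
  have hl : 1 / 2 < ((lam : ℂ)).re := by rw [ofReal_re]; linarith
  have h3 := (differentiableOn_logDeriv_f _ hl).differentiableAt (isOpen_half_lt_re.mem_nhds hl)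
  have h4 : HasDerivAt g (deriv (logDeriv f) lam * lam) 1 := by
    have h5 : HasDerivAt (fun u : ℂ => (lam : ℂ) * u) lam 1 := by
      simpa using (hasDerivAt_id (1 : ℂ)).const_mul (lam : ℂ)
    refine (HasDerivAt.comp (h₂ := logDeriv f) (1 : ℂ) ?_ h5).sub_const _
    rw [mul_one]
    exact h3.hasDerivAt
  rw [h4.deriv, norm_mul, norm_real, Real.norm_of_nonneg hlam0.le] at h2
  linarith


/-! ### The saddle scale `λ(n)` -/

/-- `x f'(x)/f(x)` on the real axis. -/
noncomputable def eulerLogDeriv (x : ℝ) : ℝ := x * (logDeriv f x).re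

theorem isSaddleScale_iff {n : ℕ} (hn : n ≠ 0) {x : ℝ} :
    IsSaddleScale n x ↔ 1 / 2 < x ∧ eulerLogDeriv x = 2 * n := by
  have hnC : (n : ℂ) ≠ 0 := by exact_mod_cast hn
  refine and_congr_right fun hx => ?_
  rw [logDeriv_f_ofReal hx, eulerLogDeriv]
  constructor
  · intro h
    field_simp at h
    have h2 : (((x * (logDeriv f x).re : ℝ)) : ℂ) = ((2 * n : ℝ) : ℂ) := by
      push_cast; linear_combination -h
    exact_mod_cast h2
  · intro h
    have h2 : (((x * (logDeriv f x).re : ℝ)) : ℂ) = ((2 * n : ℝ) : ℂ) := by rw [h]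
    push_cast at h2
    field_simp
    linear_combination -h2

/-- The endpoint matters: `f(1/2) = ξ(1) = 1/2`, so `x f'/f` is bounded on `(1/2, X]` by compactness
of the closed interval. -/
theorem f_ofReal_ne_zero {x : ℝ} (hx : 1 / 2 ≤ x) : f x ≠ 0 := by
  rcases hx.eq_or_lt with h | h
  · rw [← h, f, xi]
    norm_num
  · exact f_ne_zero (by rwa [ofReal_re])

theorem continuousOn_eulerLogDeriv : ContinuousOn eulerLogDeriv (Ici (1 / 2)) := by
  have h : ContinuousOn (fun x : ℝ => logDeriv f x) (Ici (1 / 2)) := by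
    unfold logDeriv
    exact (differentiable_deriv_f.continuous.comp continuous_ofReal).continuousOn.div
      (differentiable_f.continuous.comp continuous_ofReal).continuousOn
      fun x hx => f_ofReal_ne_zero hx
  exact continuousOn_id.mul (continuous_re.comp_continuousOn h)

theorem exists_eulerLogDeriv_le (X : ℝ) :
    ∃ K : ℝ, ∀ x : ℝ, 1 / 2 < x → x ≤ X → eulerLogDeriv x ≤ K := by
  obtain ⟨K, hK⟩ := (isCompact_Icc (a := (1 / 2 : ℝ)) (b := X)).exists_bound_of_continuousOn
    (continuousOn_eulerLogDeriv.mono Icc_subset_Ici_self)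
  exact ⟨K, fun x h1 h2 => (le_abs_self _).trans (hK x ⟨h1.le, h2⟩)⟩

theorem exists_abs_eulerLogDeriv_sub_le :
    ∃ C : ℝ, 0 ≤ C ∧ ∀ x : ℝ, 3 ≤ x →
      |eulerLogDeriv x - x / 2 * Real.log (x / (2 * Real.pi))| ≤ C := by
  obtain ⟨C, hC, h⟩ := norm_logDeriv_f_sub_log_le
  refine ⟨C, hC, fun x hx => ?_⟩
  have hx0 : 0 < x := by linarith
  have h1 := (abs_re_le_norm _).trans (h x hx)
  rw [sub_re, ofReal_re, le_div_iff₀ hx0] at h1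
  have e : eulerLogDeriv x - x / 2 * Real.log (x / (2 * Real.pi)) =
      ((logDeriv f x).re - Real.log (x / (2 * Real.pi)) / 2) * x := by
    rw [eulerLogDeriv]; ring
  rwa [e, abs_mul, abs_of_pos hx0]

theorem tendsto_log_div_two_pi : Tendsto (fun x : ℝ => Real.log (x / (2 * Real.pi))) atTop atTop :=
  Real.tendsto_log_atTop.comp (tendsto_id.atTop_div_const (by positivity))

theorem tendsto_re_logDeriv_f : Tendsto (fun x : ℝ => (logDeriv f x).re) atTop atTop := by
  obtain ⟨C, hC, h⟩ := norm_logDeriv_f_sub_log_le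
  have h1 : Tendsto (fun x : ℝ => Real.log (x / (2 * Real.pi)) / 2 + -C) atTop atTop :=
    tendsto_atTop_add_const_right _ _ (tendsto_log_div_two_pi.atTop_div_const two_pos)
  refine tendsto_atTop_mono' _ ?_ h1
  filter_upwards [eventually_ge_atTop 3] with x hx
  have h2 := (abs_le.1 ((abs_re_le_norm _).trans (h x hx))).1
  rw [sub_re, ofReal_re] at h2
  have : C / x ≤ C / 1 := by gcongr; linarith
  linarith

/-- The derivative of `x f'/f` is `f'/f + x (f'/f)'`, in which the first term tends to infinity and
the second is bounded. -/
theorem exists_strictMonoOn_eulerLogDeriv :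
    ∃ A : ℝ, 12 ≤ A ∧ StrictMonoOn eulerLogDeriv (Ici A) := by
  obtain ⟨C, hC, h⟩ := exists_norm_deriv_logDeriv_le
  obtain ⟨A, hA⟩ := eventually_atTop.1 (tendsto_re_logDeriv_f.eventually_gt_atTop C)
  refine ⟨max A 12, le_max_right _ _, ?_⟩
  have hsub : Ici (max A 12) ⊆ Ici (1 / 2) := fun x hx =>
    mem_Ici.2 (le_trans (by norm_num) ((le_max_right _ _).trans (mem_Ici.1 hx)))
  refine strictMonoOn_of_deriv_pos (convex_Ici _) (continuousOn_eulerLogDeriv.mono hsub)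
    fun x hx => ?_
  rw [interior_Ici] at hx
  have hx12 : 12 < x := (le_max_right _ _).trans_lt hx
  have hxA : A < x := (le_max_left _ _).trans_lt hx
  have hl : 1 / 2 < ((x : ℂ)).re := by rw [ofReal_re]; linarith
  have h3 := (differentiableOn_logDeriv_f _ hl).differentiableAt (isOpen_half_lt_re.mem_nhds hl)
  have h4 := (hasDerivAt_id x).mul h3.hasDerivAt.real_of_complex
  have h5 := h4.deriv
  have e : (id * fun x : ℝ => (logDeriv f x).re) = eulerLogDeriv := rfl
  rw [e] at h5
  rw [h5]
  have h6 := h x hx12.le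
  have h7 := (abs_le.1 (abs_re_le_norm (deriv (logDeriv f) x))).1
  have h8 := hA x hxA.le
  simp only [id, one_mul]
  nlinarith

theorem tendsto_eulerLogDeriv : Tendsto eulerLogDeriv atTop atTop :=
  tendsto_id.atTop_mul_atTop₀ tendsto_re_logDeriv_f

/-- Existence, uniqueness and divergence of the saddle scale. -/
theorem exists_saddleScale :
    ∃ (n₁ : ℕ) (lam : ℕ → ℝ), 1 ≤ n₁ ∧ Tendsto lam atTop atTop ∧
      ∀ n ≥ n₁, IsSaddleScale n (lam n) ∧ ∀ μ : ℝ, IsSaddleScale n μ → μ = lam n := by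
  obtain ⟨A, hA, hmono⟩ := exists_strictMonoOn_eulerLogDeriv
  obtain ⟨K, hK⟩ := exists_eulerLogDeriv_le A
  -- With `2n` above the maximum `K` over `(1/2, A]`, every solution lies in the region of strict
  -- monotonicity.
  obtain ⟨n₁, hn₁⟩ := exists_nat_gt (max K 1)
  have hn₁1 : (1 : ℝ) < n₁ := (le_max_right _ _).trans_lt hn₁
  have hgt : ∀ n : ℕ, n₁ ≤ n → ∀ μ : ℝ, IsSaddleScale n μ → A < μ := by
    intro n hn μ hμ
    have hnR : (n₁ : ℝ) ≤ n := by exact_mod_cast hn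
    have hn0 : n ≠ 0 := by
      rintro rfl; simp at hnR; rw [hnR] at hn₁1; simp at hn₁1; linarith
    obtain ⟨h1, h2⟩ := (isSaddleScale_iff hn0).1 hμ
    by_contra h3
    have h4 := hK μ h1 (not_lt.1 h3)
    have h5 : K < n₁ := (le_max_left _ _).trans_lt hn₁
    linarith
  have hex : ∀ n : ℕ, n₁ ≤ n → ∃ μ, IsSaddleScale n μ := by
    intro n hn
    have hnR : (n₁ : ℝ) ≤ n := by exact_mod_cast hn
    have hn0 : n ≠ 0 := by
      rintro rfl; simp at hnR; rw [hnR] at hn₁1; simp at hn₁1; linarith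
    obtain ⟨B, hB⟩ := (tendsto_eulerLogDeriv.eventually_ge_atTop (2 * (n : ℝ))).exists_forall_of_atTop
    have hKA := hK A (by linarith) le_rfl
    have hKn : K < n₁ := (le_max_left _ _).trans_lt hn₁
    have hAB : A ≤ max A B := le_max_left _ _
    have hsub : Icc A (max A B) ⊆ Ici (1 / 2) := fun x hx =>
      mem_Ici.2 (by linarith [hx.1])
    obtain ⟨μ, hμ, hμ2⟩ := intermediate_value_Icc hAB (continuousOn_eulerLogDeriv.mono hsub)
      (show (2 * (n : ℝ)) ∈ Icc _ _ from ⟨by linarith, hB _ (le_max_right _ _)⟩)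
    exact ⟨μ, (isSaddleScale_iff hn0).2 ⟨by linarith [hμ.1], hμ2⟩⟩
  choose! lam hlam using hex
  have hn₁0 : 1 ≤ n₁ := by
    by_contra h
    have : n₁ = 0 := by omega
    rw [this] at hn₁1
    simp at hn₁1
    linarith
  refine ⟨n₁, lam, hn₁0, ?_, fun n hn => ⟨hlam n hn, fun μ hμ => ?_⟩⟩
  · refine tendsto_atTop.2 fun X => ?_
    obtain ⟨K', hK'⟩ := exists_eulerLogDeriv_le X
    obtain ⟨N, hN⟩ := exists_nat_gt (max K' 0)
    filter_upwards [eventually_ge_atTop (max n₁ N)] with n hn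
    have hn1 : n₁ ≤ n := (le_max_left _ _).trans hn
    have hn2 : (N : ℝ) ≤ n := by exact_mod_cast (le_max_right _ _).trans hn
    obtain ⟨h1, h2⟩ := (isSaddleScale_iff (by omega)).1 (hlam n hn1)
    by_contra h3
    have h4 := hK' _ h1 (not_le.1 h3).le
    have h5 : K' < N := (le_max_left _ _).trans_lt hN
    have h6 : (0 : ℝ) < N := (le_max_right _ _).trans_lt hN
    linarith
  · have h1 := hgt n hn μ hμ
    have h2 := hgt n hn _ (hlam n hn)
    refine hmono.injOn (mem_Ici.2 h1.le) (mem_Ici.2 h2.le) ?_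
    rw [((isSaddleScale_iff (by omega)).1 hμ).2, ((isSaddleScale_iff (by omega)).1 (hlam n hn)).2]

theorem exists_mul_exp_eq {x : ℝ} (hx : 0 ≤ x) : ∃ v : ℝ, 0 ≤ v ∧ v * Real.exp v = x := by
  have hc : ContinuousOn (fun v : ℝ => v * Real.exp v) (Icc 0 x) := by fun_prop
  obtain ⟨v, hv, hv2⟩ := intermediate_value_Icc hx hc
    (show x ∈ Icc _ _ from ⟨by simpa using hx, by
      have := Real.add_one_le_exp x
      nlinarith [Real.exp_pos x]⟩)
  exact ⟨v, hv.1, hv2⟩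

/-- The asymptotics of the saddle scale in terms of the Lambert function. -/
theorem exists_saddleScale_asymptotics {n₁ : ℕ} {lam : ℕ → ℝ} (hn₁ : 1 ≤ n₁)
    (hlam : ∀ n ≥ n₁, 7 ≤ lam n ∧ IsSaddleScale n (lam n)) :
    ∃ C : ℝ, ∀ n ≥ n₁,
      |lam n / (4 * (n : ℝ) / lambertW (2 * (n : ℝ) / Real.pi)) - 1| ≤ C / (n : ℝ) := by
  obtain ⟨C, hC, h⟩ := exists_abs_eulerLogDeriv_sub_le
  refine ⟨C, fun n hn => ?_⟩
  have hn0 : n ≠ 0 := by omega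
  have hnR : (0 : ℝ) < n := by exact_mod_cast Nat.pos_of_ne_zero hn0
  have hpi := Real.pi_pos
  obtain ⟨v, hv0, hv⟩ := exists_mul_exp_eq (x := 2 * (n : ℝ) / Real.pi) (by positivity)
  have hW : lambertW (2 * (n : ℝ) / Real.pi) = v := by
    rw [← hv, lambertW_mul_exp (by linarith)]
  have hvpos : 0 < v := by
    rcases hv0.eq_or_lt with h0 | h0
    · rw [← h0, zero_mul] at hv
      have : 0 < 2 * (n : ℝ) / Real.pi := by positivity
      linarith
    · exact h0
  have hE := Real.exp_pos v
  have h2n : 2 * (n : ℝ) = Real.pi * v * Real.exp v := by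
    rw [eq_div_iff hpi.ne'] at hv; linarith
  have hx0 : 4 * (n : ℝ) / v = 2 * Real.pi * Real.exp v := by
    rw [div_eq_iff hvpos.ne']; linarith
  rw [hW, hx0]
  obtain ⟨hl7, hs⟩ := hlam n hn
  obtain ⟨-, hs2⟩ := (isSaddleScale_iff hn0).1 hs
  have h1 := h (lam n) (by linarith)
  rw [hs2] at h1
  -- `d` is the ratio of `λ` to its claimed leading term, since `4n/v = 2π e^v`. The saddle equation
  -- becomes `|π e^v (v - d(v + log d))| ≤ C`.
  set d := lam n / (2 * Real.pi * Real.exp v) with hd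
  have hd0 : 0 < d := by positivity
  have hld : lam n = 2 * Real.pi * Real.exp v * d := by rw [hd]; field_simp
  have hlog : Real.log (lam n / (2 * Real.pi)) = v + Real.log d := by
    rw [hld, mul_assoc (2 * Real.pi), mul_div_cancel_left₀ _ (by positivity),
      Real.log_mul hE.ne' hd0.ne', Real.log_exp]
  have hlog0 : 0 ≤ v + Real.log d := by
    rw [← hlog]
    apply Real.log_nonneg
    rw [le_div_iff₀ (by positivity)]
    linarith [Real.pi_lt_d2]
  rw [hlog, h2n, hld] at h1
  have e : Real.pi * v * Real.exp v - 2 * Real.pi * Real.exp v * d / 2 * (v + Real.log d) =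
      Real.pi * Real.exp v * (v - d * (v + Real.log d)) := by ring
  rw [e] at h1
  have hP : 0 < Real.pi * Real.exp v := by positivity
  rw [le_div_iff₀ hnR]
  -- `log d` has the sign of `d - 1`, so dropping it only shrinks the bracket: `|d - 1| v ≤ |v - d(v
  -- + log d)|`.
  have hgoal : |d - 1| * (2 * n) ≤ C := by
    rw [h2n]
    rcases le_total 1 d with hd1 | hd1
    · have hl : 0 ≤ Real.log d := Real.log_nonneg hd1
      rw [abs_of_nonneg (by linarith)]
      have h2 := (abs_le.1 h1).1
      have h3 : (d - 1) * v ≤ -(v - d * (v + Real.log d)) := by nlinarith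
      calc (d - 1) * (Real.pi * v * Real.exp v) = Real.pi * Real.exp v * ((d - 1) * v) := by ring
        _ ≤ Real.pi * Real.exp v * (-(v - d * (v + Real.log d))) := by gcongr
        _ ≤ C := by linarith
    · have hl : Real.log d ≤ 0 := Real.log_nonpos hd0.le hd1
      rw [abs_of_nonpos (by linarith)]
      have h2 := (abs_le.1 h1).2
      have h3 : -(d - 1) * v ≤ v - d * (v + Real.log d) := by nlinarith
      calc -(d - 1) * (Real.pi * v * Real.exp v) = Real.pi * Real.exp v * (-(d - 1) * v) := by ring
        _ ≤ Real.pi * Real.exp v * (v - d * (v + Real.log d)) := by gcongr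
        _ ≤ C := by linarith
  nlinarith [abs_nonneg (d - 1)]

/-- The saddle equation reads `λ/n = 2/(f'/f)(λ)`, and the denominator grows like `½ log λ`. -/
theorem tendsto_saddleScale_div {n₁ : ℕ} {lam : ℕ → ℝ} (hn₁ : 1 ≤ n₁) (ht : Tendsto lam atTop atTop)
    (hlam : ∀ n ≥ n₁, IsSaddleScale n (lam n)) : Tendsto (fun n : ℕ => lam n / n) atTop (𝓝 0) := by
  have h1 : Tendsto (fun n => 2 / (logDeriv f (lam n)).re) atTop (𝓝 0) :=
    tendsto_const_nhds.div_atTop (tendsto_re_logDeriv_f.comp ht)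
  refine h1.congr' ?_
  filter_upwards [eventually_ge_atTop n₁] with n hn
  obtain ⟨h2, h3⟩ := (isSaddleScale_iff (by omega)).1 (hlam n hn)
  have hnR : (0 : ℝ) < n := by exact_mod_cast (by omega : 0 < n)
  rw [eulerLogDeriv] at h3
  have h4 : (logDeriv f (lam n)).re ≠ 0 := by
    intro h0; rw [h0, mul_zero] at h3; linarith
  field_simp
  linarith


/-! ### Laplace's method with a uniform error term -/

theorem integrable_sq_mul_exp {b : ℝ} (hb : 0 < b) :
    Integrable fun y : ℝ => y ^ 2 * Real.exp (-b * y ^ 2) := by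
  have := integrable_rpow_mul_exp_neg_mul_sq hb (s := 2) (by norm_num)
  simpa using this

theorem integral_sq_mul_exp_scale {n : ℕ} (hn : n ≠ 0) :
    ∫ y : ℝ, y ^ 2 * Real.exp (-(n / 2) * y ^ 2) =
      (∫ u : ℝ, u ^ 2 * Real.exp (-(1 / 2) * u ^ 2)) / (n * Real.sqrt n) := by
  have hnR : (0 : ℝ) < n := by exact_mod_cast Nat.pos_of_ne_zero hn
  have hs : 0 < Real.sqrt n := Real.sqrt_pos.2 hnR
  have hss : Real.sqrt n ^ 2 = n := Real.sq_sqrt hnR.le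
  have h := Measure.integral_comp_mul_left (fun u : ℝ => u ^ 2 * Real.exp (-(1 / 2) * u ^ 2))
    (Real.sqrt n)
  have e : (fun y : ℝ => y ^ 2 * Real.exp (-(n / 2) * y ^ 2)) = fun y =>
      (1 / (n : ℝ)) * ((Real.sqrt n * y) ^ 2 * Real.exp (-(1 / 2) * (Real.sqrt n * y) ^ 2)) := by
    funext y
    rw [mul_pow, hss]
    field_simp
  rw [e, integral_const_mul, h, abs_of_pos (by positivity), smul_eq_mul]
  field_simp

theorem intervalIntegral_odd_eq_zero {h : ℝ → ℂ} (hodd : ∀ y, h (-y) = -h y) (r : ℝ) :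
    ∫ y in (-r)..r, h y = 0 := by
  have h1 := intervalIntegral.integral_comp_neg (a := -r) (b := r) h
  simp only [hodd, neg_neg, intervalIntegral.integral_neg] at h1
  have : (2 : ℂ) * ∫ y in (-r)..r, h y = 0 := by linear_combination -h1
  simpa using this

theorem norm_exp_sub_le (x : ℂ) : ‖exp x - 1 - x‖ ≤ ‖x‖ ^ 2 * Real.exp ‖x‖ := by
  have := norm_exp_sub_sum_le_norm_mul_exp x 2
  simpa [Finset.sum_range_succ, sub_sub] using this

theorem poly_mul_exp_le {s : ℝ} (hs : 0 ≤ s) :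
    (1 + s) ^ 2 * Real.exp (-(4 / 5) * s) ≤ 49 * Real.exp (-(1 / 2) * s) := by
  have h1 : 1 + s ≤ 7 * Real.exp (3 / 20 * s) := by
    have := Real.add_one_le_exp (3 / 20 * s)
    linarith
  have h2 : (1 + s) ^ 2 ≤ (7 * Real.exp (3 / 20 * s)) ^ 2 := by gcongr
  calc (1 + s) ^ 2 * Real.exp (-(4 / 5) * s)
      ≤ (7 * Real.exp (3 / 20 * s)) ^ 2 * Real.exp (-(4 / 5) * s) := by gcongr
    _ = 49 * (Real.exp (3 / 20 * s) * Real.exp (3 / 20 * s) * Real.exp (-(4 / 5) * s)) := by ring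
    _ = 49 * Real.exp (-(1 / 2) * s) := by
        rw [← Real.exp_add, ← Real.exp_add]; ring_nf

/-- The correction `k₁y - n c k₀ y³` collects the first-order terms of the amplitude and of the
exponent. It is odd against the Gaussian and disappears on a symmetric interval, while what remains
is of second order; this gives a relative error `1/n` instead of `1/√n`. With `s = n y²`, the
deviation of `G` costs at most `e^(s/10)` against `e^(-9s/10)`, and the polynomial in `s` is paid
for by lowering the rate to `1/2`. -/
theorem laplace_pointwise {n : ℕ} {a M : ℝ} {G k c k0 k1 : ℂ} {y : ℝ} (ha : 9 / 10 ≤ a)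
    (hM : 1 ≤ M) (hy : |y| ≤ 1) (hG : ‖G - a‖ ≤ 1 / 10) (hG2 : ‖G - a - c * y‖ ≤ M * y ^ 2)
    (hc : ‖c‖ ≤ M) (hk : ‖k - k0 - k1 * y‖ ≤ M * y ^ 2) (hk0 : ‖k0‖ ≤ M) (hk1 : ‖k1‖ ≤ M) :
    ‖exp (-(n * y ^ 2 * G)) * k -
      exp (-(n * a * y ^ 2)) * (k0 + (k1 * y - n * c * k0 * y ^ 3))‖ ≤
      1000 * M ^ 3 * (y ^ 2 * Real.exp (-(n / 2) * y ^ 2)) := by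
  set s : ℝ := n * y ^ 2 with hs
  have hs0 : 0 ≤ s := by positivity
  have hy2 : y ^ 2 = |y| ^ 2 := (sq_abs y).symm
  have hy0 := abs_nonneg y
  have hyC : ‖(y : ℂ)‖ = |y| := by rw [norm_real, Real.norm_eq_abs]
  set δ : ℂ := n * y ^ 2 * (G - a) with hδ
  have hsn : ‖(n * y ^ 2 : ℂ)‖ = s := by
    have : (n * y ^ 2 : ℂ) = ((s : ℝ) : ℂ) := by rw [hs]; push_cast; ring
    rw [this, norm_real, Real.norm_of_nonneg hs0]
  have hδ1 : ‖δ‖ ≤ s / 10 := by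
    rw [hδ, norm_mul, hsn]
    nlinarith
  have hGa : ‖G - a‖ ≤ 2 * M * |y| := by
    have e : G - a = (G - a - c * y) + c * y := by ring
    rw [e]
    refine (norm_add_le _ _).trans ?_
    rw [norm_mul, hyC]
    have : ‖c‖ * |y| ≤ M * |y| := by gcongr
    rw [hy2] at hG2
    nlinarith [mul_nonneg (by linarith : (0 : ℝ) ≤ M) hy0]
  have hδ2 : ‖δ‖ ≤ s * (2 * M * |y|) := by
    rw [hδ, norm_mul, hsn]; gcongr
  have hkk0 : ‖k - k0‖ ≤ 2 * M * |y| := by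
    have e : k - k0 = (k - k0 - k1 * y) + k1 * y := by ring
    rw [e]
    refine (norm_add_le _ _).trans ?_
    rw [norm_mul, hyC]
    have : ‖k1‖ * |y| ≤ M * |y| := by gcongr
    rw [hy2] at hk
    nlinarith [mul_nonneg (by linarith : (0 : ℝ) ≤ M) hy0]
  have hkn : ‖k‖ ≤ 3 * M := by
    have e : k = (k - k0) + k0 := by ring
    rw [e]
    refine (norm_add_le _ _).trans ?_
    nlinarith [mul_nonneg (by linarith : (0 : ℝ) ≤ M) hy0]
  have key : exp (-(n * y ^ 2 * G)) * k -
      exp (-(n * a * y ^ 2)) * (k0 + (k1 * y - n * c * k0 * y ^ 3)) =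
      exp (-(n * a * y ^ 2)) * ((exp (-δ) - 1 - -δ) * k + -(n * y ^ 2 * (G - a - c * y)) * k +
        (k - k0 - k1 * y) + -(n * y ^ 2 * (c * y * (k - k0)))) := by
    have e : -(n * y ^ 2 * G : ℂ) = -(n * a * y ^ 2) + -δ := by rw [hδ]; ring
    have e2 : n * y ^ 2 * (G - a - c * y) = δ - n * c * y ^ 3 := by rw [hδ]; ring
    rw [e, exp_add, e2]
    ring
  have hexp : ‖exp (-(n * a * y ^ 2) : ℂ)‖ ≤ Real.exp (-(9 / 10) * s) := by
    have : (-(n * a * y ^ 2) : ℂ) = ((-(a * s) : ℝ) : ℂ) := by rw [hs]; push_cast; ring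
    rw [this, norm_exp, ofReal_re]
    apply Real.exp_le_exp.2
    nlinarith
  have h1 : ‖(exp (-δ) - 1 - -δ) * k‖ ≤
      12 * M ^ 3 * (s ^ 2 * |y| ^ 2) * Real.exp (s / 10) := by
    rw [norm_mul]
    have h2 := norm_exp_sub_le (-δ)
    rw [norm_neg] at h2
    have h3 : ‖δ‖ ^ 2 * Real.exp ‖δ‖ ≤ (s * (2 * M * |y|)) ^ 2 * Real.exp (s / 10) := by gcongr
    calc ‖exp (-δ) - 1 - -δ‖ * ‖k‖
        ≤ ((s * (2 * M * |y|)) ^ 2 * Real.exp (s / 10)) * (3 * M) := by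
          gcongr
          exact h2.trans h3
      _ = _ := by ring
  have h2 : ‖-(n * y ^ 2 * (G - a - c * y)) * k‖ ≤ 3 * M ^ 2 * (s * |y| ^ 2) := by
    rw [norm_mul, norm_neg, norm_mul, hsn]
    rw [hy2] at hG2
    calc s * ‖G - a - c * y‖ * ‖k‖ ≤ s * (M * |y| ^ 2) * (3 * M) := by gcongr
      _ = _ := by ring
  have h3 : ‖-(n * y ^ 2 * (c * y * (k - k0)))‖ ≤ 2 * M ^ 2 * (s * |y| ^ 2) := by
    rw [norm_neg, norm_mul, hsn, norm_mul, norm_mul, hyC]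
    calc s * (‖c‖ * |y| * ‖k - k0‖) ≤ s * (M * |y| * (2 * M * |y|)) := by gcongr
      _ = _ := by ring
  rw [key, norm_mul]
  have hE1 : 1 ≤ Real.exp (s / 10) := Real.one_le_exp (by positivity)
  have hM2 : M ^ 2 ≤ M ^ 3 := pow_le_pow_right₀ hM (by norm_num)
  have hM1 : M ≤ M ^ 3 := le_self_pow₀ hM (by norm_num)
  have hM3 : 0 ≤ M ^ 3 := by positivity
  have hsum : ‖(exp (-δ) - 1 - -δ) * k + -(n * y ^ 2 * (G - a - c * y)) * k +
        (k - k0 - k1 * y) + -(n * y ^ 2 * (c * y * (k - k0)))‖ ≤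
      12 * M ^ 3 * |y| ^ 2 * (1 + s) ^ 2 * Real.exp (s / 10) := by
    rw [hy2] at hk
    refine (norm_add_le _ _).trans ((add_le_add ((norm_add_le _ _).trans (add_le_add
      ((norm_add_le _ _).trans (add_le_add h1 h2)) hk)) h3).trans ?_)
    have hY : 0 ≤ |y| ^ 2 := by positivity
    have t1 : 3 * M ^ 2 * (s * |y| ^ 2) ≤ 3 * M ^ 3 * (s * |y| ^ 2) * Real.exp (s / 10) := by
      have : 3 * M ^ 2 * (s * |y| ^ 2) ≤ 3 * M ^ 3 * (s * |y| ^ 2) := by gcongr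
      exact this.trans (le_mul_of_one_le_right (by positivity) hE1)
    have t2 : 2 * M ^ 2 * (s * |y| ^ 2) ≤ 2 * M ^ 3 * (s * |y| ^ 2) * Real.exp (s / 10) := by
      have : 2 * M ^ 2 * (s * |y| ^ 2) ≤ 2 * M ^ 3 * (s * |y| ^ 2) := by gcongr
      exact this.trans (le_mul_of_one_le_right (by positivity) hE1)
    have t3 : M * |y| ^ 2 ≤ M ^ 3 * |y| ^ 2 * Real.exp (s / 10) := by
      have : M * |y| ^ 2 ≤ M ^ 3 * |y| ^ 2 := by gcongr
      exact this.trans (le_mul_of_one_le_right (by positivity) hE1)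
    have t4 : 12 * M ^ 3 * |y| ^ 2 * (1 + s) ^ 2 * Real.exp (s / 10) =
        12 * M ^ 3 * (s ^ 2 * |y| ^ 2) * Real.exp (s / 10) +
        24 * (M ^ 3 * (s * |y| ^ 2) * Real.exp (s / 10)) +
        12 * (M ^ 3 * |y| ^ 2 * Real.exp (s / 10)) := by ring
    have p1 : 0 ≤ M ^ 3 * (s * |y| ^ 2) * Real.exp (s / 10) := by positivity
    have p2 : 0 ≤ M ^ 3 * |y| ^ 2 * Real.exp (s / 10) := by positivity
    rw [t4]
    linarith
  calc ‖exp (-(n * a * y ^ 2) : ℂ)‖ * _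
      ≤ Real.exp (-(9 / 10) * s) * (12 * M ^ 3 * |y| ^ 2 * (1 + s) ^ 2 * Real.exp (s / 10)) :=
        mul_le_mul hexp hsum (norm_nonneg _) (Real.exp_pos _).le
    _ = 12 * M ^ 3 * |y| ^ 2 * ((1 + s) ^ 2 * (Real.exp (-(9 / 10) * s) * Real.exp (s / 10))) := by
        ring
    _ = 12 * M ^ 3 * |y| ^ 2 * ((1 + s) ^ 2 * Real.exp (-(4 / 5) * s)) := by
        rw [← Real.exp_add]; ring_nf
    _ ≤ 12 * M ^ 3 * |y| ^ 2 * (49 * Real.exp (-(1 / 2) * s)) := by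
        have := poly_mul_exp_le hs0
        gcongr
    _ ≤ _ := by
        have e : -(1 / 2) * s = -(n / 2) * y ^ 2 := by rw [hs]; ring
        rw [e, hy2]
        have : 0 ≤ M ^ 3 * (|y| ^ 2 * Real.exp (-(n / 2) * |y| ^ 2)) := by positivity
        nlinarith

/-- Laplace's method: the error is bounded uniformly in terms of `r` and `M`. -/
theorem exists_laplace_bound {r M : ℝ} (hr : 0 < r) (hr1 : r ≤ 1) (hM : 1 ≤ M) :
    ∃ C : ℝ, 0 ≤ C ∧ ∀ (n : ℕ) (a : ℝ) (G k : ℝ → ℂ) (c k0 k1 : ℂ), n ≠ 0 → 9 / 10 ≤ a →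
      ContinuousOn G (Icc (-r) r) → ContinuousOn k (Icc (-r) r) →
      (∀ y ∈ Icc (-r) r, ‖G y - a‖ ≤ 1 / 10) →
      (∀ y ∈ Icc (-r) r, ‖G y - a - c * y‖ ≤ M * y ^ 2) → ‖c‖ ≤ M →
      (∀ y ∈ Icc (-r) r, ‖k y - k0 - k1 * y‖ ≤ M * y ^ 2) → ‖k0‖ ≤ M → ‖k1‖ ≤ M →
      ‖(∫ y in (-r)..r, exp (-(n * y ^ 2 * G y)) * k y) - k0 * (Real.sqrt (Real.pi / (n * a)) : ℝ)‖
        ≤ C / (n * Real.sqrt n) := by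
  set K := ∫ u : ℝ, u ^ 2 * Real.exp (-(1 / 2) * u ^ 2) with hK
  have hK0 : 0 ≤ K := integral_nonneg fun u => by positivity
  refine ⟨(1000 * M ^ 3 + M / r ^ 2) * K, by positivity, ?_⟩
  intro n a G k c k0 k1 hn ha hGc hkc hG hG2 hc hk hk0 hk1
  have hnR : (0 : ℝ) < n := by exact_mod_cast Nat.pos_of_ne_zero hn
  have ha0 : 0 < a := by linarith
  have hrr : -r ≤ r := by linarith
  have hu : uIcc (-r) r = Icc (-r) r := uIcc_of_le hrr
  have hKn := integral_sq_mul_exp_scale hn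
  rw [← hK] at hKn
  have hint : Integrable fun y : ℝ => y ^ 2 * Real.exp (-(n / 2) * y ^ 2) :=
    integrable_sq_mul_exp (by positivity)
  have hi1 : IntervalIntegrable (fun y : ℝ => exp (-(n * y ^ 2 * G y)) * k y) volume (-r) r := by
    refine ContinuousOn.intervalIntegrable ?_
    rw [hu]
    fun_prop
  have hi2 : IntervalIntegrable (fun y : ℝ => exp (-(n * a * y ^ 2)) * k0) volume (-r) r :=
    (by fun_prop : Continuous fun y : ℝ => exp (-(n * a * y ^ 2)) * k0).intervalIntegrable _ _
  have hi3 : IntervalIntegrable (fun y : ℝ => exp (-(n * a * y ^ 2)) *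
      (k1 * y - n * c * k0 * y ^ 3)) volume (-r) r :=
    (by fun_prop : Continuous fun y : ℝ => exp (-(n * a * y ^ 2)) *
      (k1 * y - n * c * k0 * y ^ 3)).intervalIntegrable _ _
  have hodd : ∫ y in (-r)..r, exp (-(n * a * y ^ 2)) * (k1 * y - n * c * k0 * y ^ 3) = 0 := by
    refine intervalIntegral_odd_eq_zero (h := fun y : ℝ => exp (-(n * a * y ^ 2)) *
      (k1 * y - n * c * k0 * y ^ 3)) (fun y => ?_) r
    push_cast
    rw [neg_sq]
    ring
  have hA : ‖(∫ y in (-r)..r, exp (-(n * y ^ 2 * G y)) * k y) -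
      ∫ y in (-r)..r, exp (-(n * a * y ^ 2)) * k0‖ ≤ 1000 * M ^ 3 * (K / (n * Real.sqrt n)) := by
    have e : (∫ y in (-r)..r, exp (-(n * y ^ 2 * G y)) * k y) -
        ∫ y in (-r)..r, exp (-(n * a * y ^ 2)) * k0 =
        ∫ y in (-r)..r, (exp (-(n * y ^ 2 * G y)) * k y -
          exp (-(n * a * y ^ 2)) * (k0 + (k1 * y - n * c * k0 * y ^ 3))) := by
      have e2 : ∀ y : ℝ, exp (-(n * a * y ^ 2)) * (k0 + (k1 * y - n * c * k0 * y ^ 3)) =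
        exp (-(n * a * y ^ 2)) * k0 + exp (-(n * a * y ^ 2)) * (k1 * y - n * c * k0 * y ^ 3) :=
        fun y => by ring
      simp only [e2]
      rw [intervalIntegral.integral_sub hi1 (hi2.add hi3), intervalIntegral.integral_add hi2 hi3,
        hodd, add_zero]
    rw [e, ← hKn, ← integral_const_mul, intervalIntegral.integral_of_le hrr]
    refine (norm_integral_le_of_norm_le (hint.const_mul (1000 * M ^ 3)).integrableOn ?_).trans
      (setIntegral_le_integral (hint.const_mul _) (Eventually.of_forall fun y => by positivity))
    refine (ae_restrict_iff' measurableSet_Ioc).2 (Eventually.of_forall fun y hy => ?_)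
    have hy' := Ioc_subset_Icc_self hy
    exact laplace_pointwise ha hM ((abs_le.2 hy').trans hr1) (hG y hy') (hG2 y hy') hc (hk y hy')
      hk0 hk1
  have hgi : Integrable fun y : ℝ => Real.exp (-(n * a) * y ^ 2) :=
    integrable_exp_neg_mul_sq (by positivity)
  have hB : ‖(∫ y in (-r)..r, exp (-(n * a * y ^ 2)) * k0) -
      k0 * (Real.sqrt (Real.pi / (n * a)) : ℝ)‖ ≤ M / r ^ 2 * (K / (n * Real.sqrt n)) := by
    have e1 : (∫ y in (-r)..r, exp (-(n * a * y ^ 2)) * k0) =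
        ((∫ y in Ioc (-r) r, Real.exp (-(n * a) * y ^ 2) : ℝ) : ℂ) * k0 := by
      rw [intervalIntegral.integral_mul_const, intervalIntegral.integral_of_le hrr,
        ← integral_complex_ofReal]
      congr 1
      refine integral_congr_ae (Eventually.of_forall fun y => ?_)
      push_cast
      ring_nf
    have e2 := integral_add_compl (measurableSet_Ioc (a := -r) (b := r)) hgi
    rw [integral_gaussian] at e2
    rw [e1, ← e2]
    have e3 : ((∫ y in Ioc (-r) r, Real.exp (-(n * a) * y ^ 2) : ℝ) : ℂ) * k0 - k0 *
        (((∫ y in Ioc (-r) r, Real.exp (-(n * a) * y ^ 2)) +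
          ∫ y in (Ioc (-r) r)ᶜ, Real.exp (-(n * a) * y ^ 2) : ℝ) : ℂ) =
        -(k0 * ((∫ y in (Ioc (-r) r)ᶜ, Real.exp (-(n * a) * y ^ 2) : ℝ) : ℂ)) := by
      push_cast; ring
    rw [e3, norm_neg, norm_mul, norm_real]
    -- On the tails `1 ≤ y²/r²`, so the missing Gaussian mass is bounded by the same second moment,
    -- of order `n^(-3/2)`.
    have h1 : ‖∫ y in (Ioc (-r) r)ᶜ, Real.exp (-(n * a) * y ^ 2)‖ ≤
        1 / r ^ 2 * (K / (n * Real.sqrt n)) := by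
      rw [← hKn, ← integral_const_mul]
      refine (norm_integral_le_of_norm_le (hint.const_mul (1 / r ^ 2)).integrableOn ?_).trans
        (setIntegral_le_integral (hint.const_mul _) (Eventually.of_forall fun y => by positivity))
      refine (ae_restrict_iff' measurableSet_Ioc.compl).2 (Eventually.of_forall fun y hy => ?_)
      have hy1 : r ≤ |y| := by
        by_contra h
        rw [not_le, abs_lt] at h
        exact hy ⟨h.1, h.2.le⟩
      rw [Real.norm_of_nonneg (Real.exp_pos _).le, ← mul_assoc]
      have h2 : 1 ≤ 1 / r ^ 2 * y ^ 2 := by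
        rw [one_div, ← div_eq_inv_mul, le_div_iff₀ (by positivity), one_mul, ← sq_abs y]
        gcongr
      have h3 : Real.exp (-(n * a) * y ^ 2) ≤ Real.exp (-(n / 2) * y ^ 2) := by
        apply Real.exp_le_exp.2
        have : (n : ℝ) / 2 ≤ n * a := by nlinarith
        nlinarith [sq_nonneg y]
      exact h3.trans (le_mul_of_one_le_left (Real.exp_pos _).le h2)
    calc ‖k0‖ * _ ≤ M * (1 / r ^ 2 * (K / (n * Real.sqrt n))) := by gcongr
      _ = _ := by ring
  refine (norm_sub_le_norm_sub_add_norm_sub _ (∫ y in (-r)..r, exp (-(n * a * y ^ 2)) * k0) _).trans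
    ((add_le_add hA hB).trans (le_of_eq ?_))
  ring


/-! ### The phase near the saddle point -/

/-- A saddle scale so large that the phase is uniformly close to its limit `2 (log z - z + 1)`. -/
structure GoodScale (n : ℕ) (lam : ℝ) : Prop where
  n_ge : 16 ≤ n
  lam_ge : 12 ≤ lam
  saddle : IsSaddleScale n lam
  approx : ∀ z ∈ Metric.ball (1 : ℂ) (1 / 2),
    ‖phase n lam z - 2 * (log z - (z - 1))‖ ≤ 1 / 96000

theorem phase_eq_logDefect {n : ℕ} {lam : ℝ} (hn : n ≠ 0) (h : IsSaddleScale n lam) (z : ℂ) :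
    phase n lam z = 2 * (log z - (z - 1)) - 1 / (n : ℂ) * logDefect lam z := by
  have hnC : (n : ℂ) ≠ 0 := by exact_mod_cast hn
  have h1 := h.2
  have h2 : (lam : ℂ) * logDeriv f lam = 2 * n := by
    field_simp at h1
    linear_combination -h1
  rw [phase_eq, logDefect, h2]
  field_simp
  ring

/-- The deviation from the limit phase is the defect divided by `n`, which is `O(λ/n)`. -/
theorem eventually_goodScale {n₁ : ℕ} {lam : ℕ → ℝ} (hn₁ : 1 ≤ n₁) (ht : Tendsto lam atTop atTop)
    (hlam : ∀ n ≥ n₁, IsSaddleScale n (lam n)) : ∀ᶠ n in atTop, GoodScale n (lam n) := by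
  obtain ⟨C, hC, h⟩ := exists_norm_logDefect_le
  have h0 := (tendsto_saddleScale_div hn₁ ht hlam).const_mul C
  rw [mul_zero] at h0
  filter_upwards [eventually_ge_atTop 16, eventually_ge_atTop n₁, ht.eventually_ge_atTop 12,
    h0.eventually_lt_const (by norm_num : (0 : ℝ) < 1 / 96000)] with n h1 h2 h3 h4
  refine ⟨h1, h3, hlam n h2, fun z hz => ?_⟩
  have hnR : (0 : ℝ) < n := by exact_mod_cast (by omega : 0 < n)
  rw [phase_eq_logDefect (by omega) (hlam n h2), sub_sub_cancel_left, norm_neg, norm_mul, norm_div,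
    norm_one, norm_natCast, one_div, ← div_eq_inv_mul, div_le_iff₀ hnR]
  refine (h _ h3 z hz).trans ?_
  rw [← mul_div_assoc, div_lt_iff₀ hnR] at h4
  exact h4.le

theorem half_lt_of_mem_ball {lam : ℝ} (hlam : 12 ≤ lam) {z : ℂ}
    (hz : z ∈ Metric.ball (1 : ℂ) (3 / 4)) : 1 / 2 < lam * z.re := by
  nlinarith [(ball_re hz).1]

theorem mem_slitPlane_of_ball {z : ℂ} (hz : z ∈ Metric.ball (1 : ℂ) (3 / 4)) : z ∈ slitPlane :=
  Or.inl (by linarith [(ball_re hz).1])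

theorem phase_one (n : ℕ) (lam : ℝ) : phase n lam 1 = 0 := by
  simp [phase_eq, logRatio_one]

theorem hasDerivAt_phase (n : ℕ) {lam : ℝ} (hlam : 12 ≤ lam) {z : ℂ}
    (hz : z ∈ Metric.ball (1 : ℂ) (3 / 4)) :
    HasDerivAt (phase n lam) (2 * z⁻¹ - 1 / (n : ℂ) * (lam * logDeriv f (lam * z))) z :=
  ((hasDerivAt_log (mem_slitPlane_of_ball hz)).const_mul 2).sub
    ((hasDerivAt_logRatio (by linarith) hz).const_mul _)

theorem differentiableOn_phase (n : ℕ) {lam : ℝ} (hlam : 12 ≤ lam) :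
    DifferentiableOn ℂ (phase n lam) (Metric.ball (1 : ℂ) (3 / 4)) := fun _ hz =>
  (hasDerivAt_phase n hlam hz).differentiableAt.differentiableWithinAt

theorem one_mem_ball {r : ℝ} (hr : 0 < r) : (1 : ℂ) ∈ Metric.ball (1 : ℂ) r := by simp [hr]

theorem GoodScale.deriv_phase_one {n : ℕ} {lam : ℝ} (h : GoodScale n lam) :
    deriv (phase n lam) 1 = 0 := by
  rw [(hasDerivAt_phase n h.lam_ge (one_mem_ball (by norm_num))).deriv]
  have h1 := h.saddle.2
  rw [mul_one, inv_one, mul_one, ← h1]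
  ring

theorem phaseSecond_eq (n : ℕ) {lam : ℝ} (hlam : 12 ≤ lam) :
    phaseSecond n lam = -2 - 1 / (n : ℂ) * (lam * (deriv (logDeriv f) lam * lam)) := by
  rw [phaseSecond, iteratedDeriv_succ, iteratedDeriv_one]
  have h1 : deriv (phase n lam) =ᶠ[𝓝 1] fun z => 2 * z⁻¹ - 1 / (n : ℂ) *
      (lam * logDeriv f (lam * z)) := by
    filter_upwards [Metric.isOpen_ball.mem_nhds (one_mem_ball (by norm_num : (0 : ℝ) < 3 / 4))]
      with z hz
    exact (hasDerivAt_phase n hlam hz).deriv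
  rw [h1.deriv_eq]
  have hl : 1 / 2 < ((lam : ℂ) * 1).re := by rw [mul_one, ofReal_re]; linarith
  have h3 := (differentiableOn_logDeriv_f _ hl).differentiableAt (isOpen_half_lt_re.mem_nhds hl)
  have h5 : HasDerivAt (fun u : ℂ => (lam : ℂ) * u) lam 1 := by
    simpa using (hasDerivAt_id (1 : ℂ)).const_mul (lam : ℂ)
  have h6 := HasDerivAt.comp (h₂ := logDeriv f) (1 : ℂ) h3.hasDerivAt h5
  have h7 := ((hasDerivAt_inv (one_ne_zero : (1 : ℂ) ≠ 0)).const_mul 2).sub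
    ((h6.const_mul (lam : ℂ)).const_mul (1 / (n : ℂ)))
  refine h7.deriv.trans ?_
  rw [mul_one]
  norm_num

theorem deriv_logDeriv_f_im {x : ℝ} (hx : 1 / 2 < x) : (deriv (logDeriv f) x).im = 0 := by
  have hl : 1 / 2 < ((x : ℂ)).re := by rwa [ofReal_re]
  have h1 : (⇑(starRingEnd ℂ) ∘ logDeriv f ∘ ⇑(starRingEnd ℂ)) =ᶠ[𝓝 (x : ℂ)] logDeriv f := by
    filter_upwards [isOpen_half_lt_re.mem_nhds hl] with u hu
    simp only [Function.comp_apply]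
    rw [logDeriv_f_conj hu, conj_conj]
  have h2 := h1.deriv_eq
  rw [deriv_conj_conj] at h2
  simp only [Function.comp_apply, conj_ofReal] at h2
  exact conj_eq_iff_im.1 h2

theorem phaseSecond_im (n : ℕ) {lam : ℝ} (hlam : 12 ≤ lam) : (phaseSecond n lam).im = 0 := by
  have h1 : deriv (logDeriv f) lam = ((deriv (logDeriv f) lam).re : ℂ) :=
    Complex.ext rfl (by simp [deriv_logDeriv_f_im (by linarith : 1 / 2 < lam)])
  have h2 : phaseSecond n lam = ((-2 - 1 / (n : ℝ) *
      (lam * ((deriv (logDeriv f) lam).re * lam)) : ℝ) : ℂ) := by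
    rw [phaseSecond_eq n hlam, h1]; push_cast; simp
  rw [h2, ofReal_im]

/-- The analytic function `φ(z)/(z-1)²`. -/
noncomputable def phaseQuot (n : ℕ) (lam : ℝ) : ℂ → ℂ := dslope (dslope (phase n lam) 1) 1

theorem GoodScale.phase_eq_sq_mul {n : ℕ} {lam : ℝ} (h : GoodScale n lam) (z : ℂ) :
    phase n lam z = (z - 1) ^ 2 * phaseQuot n lam z := by
  have h1 := sub_smul_dslope (phase n lam) 1 z
  have h2 := sub_smul_dslope (dslope (phase n lam) 1) 1 z
  rw [dslope_same, h.deriv_phase_one, sub_zero, smul_eq_mul] at h2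
  rw [phase_one, sub_zero, smul_eq_mul] at h1
  rw [← h1, ← h2, phaseQuot]
  ring

theorem differentiableOn_phaseQuot (n : ℕ) {lam : ℝ} (hlam : 12 ≤ lam) :
    DifferentiableOn ℂ (phaseQuot n lam) (Metric.ball (1 : ℂ) (3 / 4)) := by
  have hm : Metric.ball (1 : ℂ) (3 / 4) ∈ 𝓝 (1 : ℂ) := Metric.ball_mem_nhds _ (by norm_num)
  exact (differentiableOn_dslope hm).2 ((differentiableOn_dslope hm).2 (differentiableOn_phase n hlam))

theorem norm_log_defect_le {u : ℂ} (hu : ‖u‖ ≤ 1 / 2) :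
    ‖2 * (log (1 + u) - u) + u ^ 2‖ ≤ 4 / 3 * ‖u‖ ^ 3 := by
  have h := norm_log_sub_logTaylor_le 2 (z := u) (by linarith)
  have e : 2 * (log (1 + u) - u) + u ^ 2 = 2 * (log (1 + u) - logTaylor (2 + 1) u) := by
    simp [logTaylor, Finset.sum_range_succ]
    ring
  rw [e, norm_mul, Complex.norm_ofNat]
  have h1 : (1 - ‖u‖)⁻¹ ≤ 2 := by
    rw [inv_le_comm₀ (by linarith) (by norm_num)]; linarith
  have h2 : ‖u‖ ^ (2 + 1) * (1 - ‖u‖)⁻¹ / (2 + 1) ≤ ‖u‖ ^ 3 * 2 / 3 := by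
    norm_num
    gcongr
  norm_num at h h2
  linarith

/-- The maximum principle reduces to the circle `|u - 1| = 1/40`, where division by `(u - 1)²` is
harmless. The budget is `1/96000` from the phase and `(4/3)/40³ = 1/48000` from the logarithm,
together `1/32000 = (1/20)/40²`. -/
theorem GoodScale.norm_phaseQuot_add_one_le {n : ℕ} {lam : ℝ} (h : GoodScale n lam) {z : ℂ}
    (hz : z ∈ Metric.ball (1 : ℂ) (1 / 40)) : ‖phaseQuot n lam z + 1‖ ≤ 1 / 20 := by
  have hd : DiffContOnCl ℂ (fun z => phaseQuot n lam z + 1) (Metric.ball (1 : ℂ) (1 / 40)) :=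
    ((differentiableOn_phaseQuot n h.lam_ge).add_const 1).diffContOnCl_ball
      (Metric.closedBall_subset_ball (by norm_num))
  refine norm_le_of_forall_mem_frontier_norm_le Metric.isBounded_ball hd (fun u hu => ?_)
    (subset_closure hz)
  rw [frontier_ball _ (by norm_num), mem_sphere_iff_norm] at hu
  have hu2 : u ∈ Metric.ball (1 : ℂ) (1 / 2) := by
    rw [Metric.mem_ball, dist_eq_norm, hu]; norm_num
  have h1 := h.approx u hu2
  have h2 := norm_log_defect_le (u := u - 1) (by rw [hu]; norm_num)
  rw [add_sub_cancel, hu] at h2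
  have h3 := h.phase_eq_sq_mul u
  have e : (u - 1) ^ 2 * (phaseQuot n lam u + 1) = (phase n lam u - 2 * (log u - (u - 1))) +
      (2 * (log u - (u - 1)) + (u - 1) ^ 2) := by
    rw [h3]; ring
  have h4 := congrArg norm e
  rw [norm_mul, norm_pow, hu] at h4
  have h5 := norm_add_le (phase n lam u - 2 * (log u - (u - 1))) (2 * (log u - (u - 1)) + (u - 1) ^ 2)
  rw [← h4] at h5
  norm_num at h1 h2 h5 ⊢
  linarith

theorem GoodScale.phaseSecond_eq_phaseQuot {n : ℕ} {lam : ℝ} (h : GoodScale n lam) :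
    phaseSecond n lam = 2 * phaseQuot n lam 1 := by
  set g := phaseQuot n lam
  have hg := differentiableOn_phaseQuot n h.lam_ge
  have hd : ∀ z ∈ Metric.ball (1 : ℂ) (3 / 4), DifferentiableAt ℂ g z := fun z hz =>
    hg.differentiableAt (Metric.isOpen_ball.mem_nhds hz)
  have hd2 : DifferentiableAt ℂ (deriv g) 1 :=
    (hg.deriv Metric.isOpen_ball).differentiableAt (Metric.ball_mem_nhds _ (by norm_num))
  have he : phase n lam = fun z => (z - 1) ^ 2 * g z := funext h.phase_eq_sq_mul
  have h1 : deriv (phase n lam) =ᶠ[𝓝 1] fun z => 2 * (z - 1) * g z + (z - 1) ^ 2 * deriv g z := by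
    filter_upwards [Metric.isOpen_ball.mem_nhds (one_mem_ball (by norm_num : (0 : ℝ) < 3 / 4))]
      with z hz
    rw [he]
    have h2 := ((((hasDerivAt_id z).sub_const 1).pow 2).mul (hd z hz).hasDerivAt).deriv
    refine Eq.trans ?_ (h2.trans ?_)
    · rfl
    · simp
  have hone := hd 1 (one_mem_ball (by norm_num))
  rw [phaseSecond, iteratedDeriv_succ, iteratedDeriv_one, h1.deriv_eq]
  have h3 := ((((hasDerivAt_id (1 : ℂ)).sub_const 1).const_mul 2).mul hone.hasDerivAt).add
    ((((hasDerivAt_id (1 : ℂ)).sub_const 1).pow 2).mul hd2.hasDerivAt)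
  refine Eq.trans ?_ (h3.deriv.trans ?_)
  · rfl
  · simp

/-- `-φ''(1)/2`. -/
noncomputable def curvature (n : ℕ) (lam : ℝ) : ℝ := -(phaseSecond n lam).re / 2

theorem GoodScale.phaseQuot_one {n : ℕ} {lam : ℝ} (h : GoodScale n lam) :
    phaseQuot n lam 1 = ((-curvature n lam : ℝ) : ℂ) := by
  have h1 := h.phaseSecond_eq_phaseQuot
  have h2 : phaseSecond n lam = ((phaseSecond n lam).re : ℂ) :=
    Complex.ext rfl (by simp [phaseSecond_im n h.lam_ge])
  have h3 : phaseQuot n lam 1 = phaseSecond n lam / 2 := by rw [h1]; ring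
  rw [h3, curvature]
  conv_lhs => rw [h2]
  push_cast
  ring

theorem GoodScale.curvature_bounds {n : ℕ} {lam : ℝ} (h : GoodScale n lam) :
    19 / 20 ≤ curvature n lam ∧ curvature n lam ≤ 21 / 20 := by
  have h1 := h.norm_phaseQuot_add_one_le (one_mem_ball (by norm_num))
  rw [h.phaseQuot_one] at h1
  have h2 : ((-curvature n lam : ℝ) : ℂ) + 1 = ((1 - curvature n lam : ℝ) : ℂ) := by
    push_cast; ring
  rw [h2, norm_real, Real.norm_eq_abs, abs_le] at h1
  constructor <;> linarith

theorem GoodScale.norm_phaseSecond {n : ℕ} {lam : ℝ} (h : GoodScale n lam) :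
    ‖phaseSecond n lam‖ = 2 * curvature n lam := by
  rw [h.phaseSecond_eq_phaseQuot, h.phaseQuot_one, norm_mul, norm_real, Complex.norm_ofNat,
    norm_neg, Real.norm_of_nonneg (by linarith [h.curvature_bounds.1])]

theorem norm_dslope_le {h : ℂ → ℂ} {c : ℂ} {R M : ℝ} (hR : 0 < R) (hM : 0 < M)
    (hd : DifferentiableOn ℂ h (Metric.ball c R)) (hb : ∀ z ∈ Metric.ball c R, ‖h z‖ ≤ M) {z : ℂ}
    (hz : z ∈ Metric.ball c R) : ‖dslope h c z‖ ≤ 3 * M / R := by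
  refine norm_dslope_le_div_of_mapsTo_ball hd (fun u hu => ?_) hz
  rw [Metric.mem_closedBall, dist_eq_norm]
  have := norm_sub_le (h u) (h c)
  have h1 := hb u hu
  have h2 := hb c (by simp [hR])
  linarith

/-- The difference quotient of a bounded holomorphic function is bounded by the Schwarz lemma;
applied twice this yields the second-order remainder. -/
theorem exists_taylor_bound {h : ℂ → ℂ} {c : ℂ} {R M : ℝ} (hR : 0 < R) (hM : 0 < M)
    (hd : DifferentiableOn ℂ h (Metric.ball c R)) (hb : ∀ z ∈ Metric.ball c R, ‖h z‖ ≤ M) :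
    ‖deriv h c‖ ≤ 3 * M / R ∧ ∀ z ∈ Metric.ball c R,
      ‖h z - h c - deriv h c * (z - c)‖ ≤ 9 * M / R ^ 2 * ‖z - c‖ ^ 2 := by
  have hm : Metric.ball c R ∈ 𝓝 c := Metric.ball_mem_nhds _ hR
  have hd1 : DifferentiableOn ℂ (dslope h c) (Metric.ball c R) := (differentiableOn_dslope hm).2 hd
  have hb1 : ∀ z ∈ Metric.ball c R, ‖dslope h c z‖ ≤ 3 * M / R := fun z hz =>
    norm_dslope_le hR hM hd hb hz
  refine ⟨?_, fun z hz => ?_⟩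
  · have := hb1 c (by simp [hR])
    rwa [dslope_same] at this
  · have h2 := norm_dslope_le hR (by positivity) hd1 hb1 hz
    have e1 := sub_smul_dslope h c z
    have e2 := sub_smul_dslope (dslope h c) c z
    rw [smul_eq_mul] at e1 e2
    rw [dslope_same] at e2
    have e3 : h z - h c - deriv h c * (z - c) = (z - c) ^ 2 * dslope (dslope h c) c z := by
      rw [← e1]
      linear_combination -(z - c) * e2
    rw [e3, norm_mul, norm_pow, mul_comm]
    have e4 : 3 * (3 * M / R) / R = 9 * M / R ^ 2 := by field_simp; ring
    rw [e4] at h2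
    gcongr


/-! ### The Taylor remainder away from the saddle points -/

/-- `e^(-nφ(t)) = f(λt)/(f(λ) t^(2n))`. -/
noncomputable def amplitude (n : ℕ) (lam : ℝ) (t : ℂ) : ℂ := f (lam * t) / (f lam * t ^ (2 * n))

theorem GoodScale.n_pos {n : ℕ} {lam : ℝ} (h : GoodScale n lam) : 0 < n := by
  have := h.n_ge; omega

theorem GoodScale.f_lam_ne_zero {n : ℕ} {lam : ℝ} (h : GoodScale n lam) : f lam ≠ 0 :=
  f_ne_zero (by rw [ofReal_re]; linarith [h.lam_ge])

theorem GoodScale.amplitude_eq_exp {n : ℕ} {lam : ℝ} (h : GoodScale n lam) {t : ℂ}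
    (ht : t ∈ Metric.ball (1 : ℂ) (3 / 4)) : amplitude n lam t = exp (-(n * phase n lam t)) := by
  have h1 := exp_phase (n := n) h.n_pos.ne' (by linarith [h.lam_ge])
    (half_lt_of_mem_ball h.lam_ge ht)
  rw [exp_neg, h1, amplitude, expPhase, inv_div]
  ring

/-- Close to the saddle `|φ| ≤ 2|x - 1|²`, so moving the line by `η` costs only a factor `e^(2nη²)`.
-/
theorem GoodScale.norm_f_real_le {n : ℕ} {lam η x : ℝ} (h : GoodScale n lam) (hη : η < 1 / 40)
    (hx : |x - 1| ≤ η) : ‖f (lam * x)‖ ≤ ‖f lam‖ * x ^ (2 * n) * Real.exp (n * (2 * η ^ 2)) := by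
  have hx1 : ‖(x : ℂ) - 1‖ = |x - 1| := by
    rw [← ofReal_one, ← ofReal_sub, norm_real, Real.norm_eq_abs]
  have hmem : (x : ℂ) ∈ Metric.ball (1 : ℂ) (1 / 40) := by
    rw [Metric.mem_ball, dist_eq_norm, hx1]; linarith
  have h1 := h.amplitude_eq_exp (Metric.ball_subset_ball (by norm_num) hmem)
  have hx0 : 0 < x := by linarith [(abs_le.1 hx).1]
  have hxC : (x : ℂ) ≠ 0 := by exact_mod_cast hx0.ne'
  have h2 := h.norm_phaseQuot_add_one_le hmem
  have h3 : ‖phaseQuot n lam x‖ ≤ 2 := by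
    have := norm_sub_le (phaseQuot n lam x + 1) 1
    rw [add_sub_cancel_right, norm_one] at this
    linarith
  rw [amplitude, div_eq_iff (mul_ne_zero h.f_lam_ne_zero (pow_ne_zero _ hxC))] at h1
  rw [h1, norm_mul, norm_mul, norm_pow, norm_real, Real.norm_of_nonneg hx0.le, mul_comm]
  refine mul_le_mul_of_nonneg_left ?_ (by positivity)
  rw [norm_exp]
  apply Real.exp_le_exp.2
  refine (re_le_norm _).trans ?_
  rw [norm_neg, norm_mul, norm_natCast, h.phase_eq_sq_mul, norm_mul, norm_pow, hx1]
  have h4 : |x - 1| ^ 2 ≤ η ^ 2 := by gcongr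
  have : |x - 1| ^ 2 * ‖phaseQuot n lam x‖ ≤ η ^ 2 * 2 := by gcongr
  have hn : (0 : ℝ) ≤ n := Nat.cast_nonneg n
  nlinarith

/-- `f` is compared with its value at `Re t`, at the cost of a quadratic factor; the decay then
comes from `t^(2n)` alone, through `x²(1 + y²/4) ≤ x² + y²` for `0 < x ≤ 2`. -/
theorem GoodScale.norm_amplitude_le {n : ℕ} {lam η : ℝ} (h : GoodScale n lam) (hη : η < 1 / 40)
    {t : ℂ} (ht : |t.re - 1| ≤ η) :
    ‖amplitude n lam t‖ ≤ 80 * Real.exp (n * (2 * η ^ 2)) * (1 + t.im ^ 2 / 4) *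
      ((1 + t.im ^ 2 / 4) ^ n)⁻¹ := by
  obtain ⟨h1, h2⟩ := abs_le.1 ht
  set x := t.re
  set y := t.im
  have hx0 : 0 < x := by linarith
  have hn2 : ‖t‖ ^ 2 = x ^ 2 + y ^ 2 := by
    rw [Complex.sq_norm, normSq_apply]; ring
  have hf0 : 0 < ‖f lam‖ := norm_pos_iff.2 h.f_lam_ne_zero
  have h3 := norm_f_le_real h.lam_ge (z := t) (by linarith)
  have h4 := h.norm_f_real_le hη ht
  have hQ : 0 < 1 + y ^ 2 / 4 := by positivity
  have hN : 0 < x ^ 2 + y ^ 2 := by positivity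
  rw [amplitude, norm_div, norm_mul, norm_pow, pow_mul, hn2,
    div_le_iff₀ (by positivity)]
  have h5 : 20 * (‖t‖ ^ 2 + 1) ≤ 80 * (1 + y ^ 2 / 4) := by rw [hn2]; nlinarith
  have h6 : (x ^ 2) ^ n * (1 + y ^ 2 / 4) ^ n ≤ (x ^ 2 + y ^ 2) ^ n := by
    rw [← mul_pow]
    refine pow_le_pow_left₀ (by positivity) ?_ n
    nlinarith [sq_nonneg y]
  have h7 : (x ^ 2) ^ n ≤ (x ^ 2 + y ^ 2) ^ n * ((1 + y ^ 2 / 4) ^ n)⁻¹ := by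
    rw [← div_eq_mul_inv, le_div_iff₀ (by positivity)]
    exact h6
  rw [pow_mul] at h4
  calc ‖f (lam * t)‖ ≤ 20 * (‖t‖ ^ 2 + 1) * ‖f (lam * x)‖ := h3
    _ ≤ 80 * (1 + y ^ 2 / 4) * (‖f lam‖ * ((x ^ 2 + y ^ 2) ^ n * ((1 + y ^ 2 / 4) ^ n)⁻¹) *
        Real.exp (n * (2 * η ^ 2))) := by
      gcongr
      exact h4.trans (by gcongr)
    _ = _ := by ring

/-- The Cauchy kernel normalized to be `1` at `t = 1`. -/
noncomputable def unitKernel (z t : ℂ) : ℂ := t * (1 - z ^ 2) / (t ^ 2 - z ^ 2)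

/-- Written as `t(1 + (1 - t²)/(t² - z²))`, the kernel has a numerator free of `z`. This makes the
bound uniform over unbounded `z`. -/
theorem norm_unitKernel_le {z t : ℂ} {d : ℝ} (hd : 0 < d) (hz : 0 ≤ z.re) (ht : 1 / 2 ≤ t.re)
    (hdt : d ≤ ‖t - z‖) : ‖unitKernel z t‖ ≤ ‖t‖ * (1 + 2 * (1 + ‖t‖ ^ 2) / d) := by
  have h1 : 1 / 2 ≤ ‖t + z‖ := by
    have := re_le_norm (t + z)
    rw [add_re] at this
    linarith
  have h2 : d / 2 ≤ ‖t ^ 2 - z ^ 2‖ := by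
    have e : t ^ 2 - z ^ 2 = (t - z) * (t + z) := by ring
    rw [e, norm_mul]
    nlinarith
  have h3 : t ^ 2 - z ^ 2 ≠ 0 := by
    intro h0; rw [h0, norm_zero] at h2; linarith
  have e : unitKernel z t = t * (1 + (1 - t ^ 2) / (t ^ 2 - z ^ 2)) := by
    rw [unitKernel]; field_simp; ring
  rw [e, norm_mul]
  refine mul_le_mul_of_nonneg_left ?_ (norm_nonneg _)
  refine (norm_add_le _ _).trans ?_
  rw [norm_one, norm_div]
  have h4 : ‖1 - t ^ 2‖ ≤ 1 + ‖t‖ ^ 2 := by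
    refine (norm_sub_le _ _).trans ?_
    rw [norm_one, norm_pow]
  have h5 : ‖1 - t ^ 2‖ / ‖t ^ 2 - z ^ 2‖ ≤ (1 + ‖t‖ ^ 2) / (d / 2) := by gcongr
  have e2 : (1 + ‖t‖ ^ 2) / (d / 2) = 2 * (1 + ‖t‖ ^ 2) / d := by field_simp
  linarith

theorem unitKernel_one {z : ℂ} (hz : z ^ 2 ≠ 1) : unitKernel z 1 = 1 := by
  have : 1 - z ^ 2 ≠ 0 := sub_ne_zero.2 hz.symm
  rw [unitKernel, one_mul, one_pow, div_self this]

theorem differentiableOn_unitKernel {z : ℂ} {s : Set ℂ} (hs : ∀ t ∈ s, t ^ 2 - z ^ 2 ≠ 0) :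
    DifferentiableOn ℂ (unitKernel z) s := by
  intro t ht
  unfold unitKernel
  exact ((by fun_prop : DifferentiableAt ℂ (fun t : ℂ => t * (1 - z ^ 2)) t).div
    (by fun_prop : DifferentiableAt ℂ (fun t : ℂ => t ^ 2 - z ^ 2) t)
    (hs t ht)).differentiableWithinAt

theorem differentiableOn_amplitude (n : ℕ) {lam : ℝ} (h : f lam ≠ 0) {s : Set ℂ}
    (hs : ∀ t ∈ s, t ≠ 0) : DifferentiableOn ℂ (amplitude n lam) s := by
  intro t ht
  have := differentiable_f
  unfold amplitude
  exact ((by fun_prop : DifferentiableAt ℂ (fun t : ℂ => f (lam * t)) t).div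
    (by fun_prop : DifferentiableAt ℂ (fun t : ℂ => f lam * t ^ (2 * n)) t)
    (mul_ne_zero h (pow_ne_zero _ (hs t ht)))).differentiableWithinAt

/-- The integrand is exponentially small off the saddle point. -/
theorem GoodScale.norm_integrand_le {n : ℕ} {lam η θ : ℝ} (h : GoodScale n lam) (hη0 : 0 < η)
    (hη : η < 1 / 40) (hθ : 0 ≤ θ) (hηθ : 4 * η ^ 2 ≤ θ) {z t : ℂ} (ht : |t.re - 1| ≤ η)
    (hz : 0 ≤ z.re) (hdt : η ≤ ‖t - z‖) (hQ : Real.exp θ ≤ 1 + t.im ^ 2 / 4) :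
    ‖amplitude n lam t * unitKernel z t‖ ≤
      5000 / η * Real.exp (-(n * (θ / 4))) * (1 + t.im ^ 2 / 4)⁻¹ := by
  obtain ⟨h1, h2⟩ := abs_le.1 ht
  have hA := h.norm_amplitude_le hη ht
  have hK := norm_unitKernel_le hη0 hz (by linarith) hdt
  set Q := 1 + t.im ^ 2 / 4 with hQdef
  have hQ1 : 1 ≤ Q := by rw [hQdef]; nlinarith [sq_nonneg t.im]
  have hn2 : ‖t‖ ^ 2 = t.re ^ 2 + t.im ^ 2 := by
    rw [Complex.sq_norm, normSq_apply]; ring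
  have hn3 : 2 + ‖t‖ ^ 2 ≤ 4 * Q := by rw [hn2, hQdef]; nlinarith
  have hn4 : ‖t‖ ≤ 2 * Q := by nlinarith [sq_nonneg (‖t‖ - 1)]
  have hK2 : ‖unitKernel z t‖ ≤ 16 / η * Q ^ 2 := by
    refine hK.trans ?_
    have e : 1 + 2 * (1 + ‖t‖ ^ 2) / η ≤ 2 * (4 * Q) / η := by
      rw [le_div_iff₀ hη0, add_mul, div_mul_cancel₀ _ hη0.ne']
      linarith
    calc ‖t‖ * (1 + 2 * (1 + ‖t‖ ^ 2) / η) ≤ (2 * Q) * (2 * (4 * Q) / η) := by gcongr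
      _ = _ := by ring
  have hn16 := h.n_ge
  have hnR : (16 : ℝ) ≤ n := by exact_mod_cast hn16
  -- Three powers of `Q` absorb the growth of amplitude and kernel, the fourth keeps the bound
  -- integrable in `Im t`. The loss of `4θ` in the exponent is covered by `nθ/4` since `n ≥ 16`.
  have hQn : Q ^ n = Q ^ 4 * Q ^ (n - 4) := by rw [← pow_add]; congr 1; omega
  have hexp : Real.exp ((n - 4 : ℝ) * θ) ≤ Q ^ (n - 4) := by
    have e : (n - 4 : ℝ) = ((n - 4 : ℕ) : ℝ) := by
      rw [Nat.cast_sub (by omega)]; norm_num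
    rw [e, Real.exp_nat_mul]
    gcongr
  have hfin : Real.exp (n * (2 * η ^ 2)) * (Q ^ (n - 4))⁻¹ ≤ Real.exp (-(n * (θ / 4))) := by
    have h3 : (Q ^ (n - 4))⁻¹ ≤ (Real.exp ((n - 4 : ℝ) * θ))⁻¹ := by gcongr
    refine (mul_le_mul_of_nonneg_left h3 (Real.exp_pos _).le).trans ?_
    rw [← Real.exp_neg, ← Real.exp_add]
    apply Real.exp_le_exp.2
    nlinarith
  rw [norm_mul]
  have hQ0 : 0 < Q := by linarith
  calc ‖amplitude n lam t‖ * ‖unitKernel z t‖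
      ≤ (80 * Real.exp (n * (2 * η ^ 2)) * Q * (Q ^ n)⁻¹) * (16 / η * Q ^ 2) := by gcongr
    _ = 1280 / η * (Real.exp (n * (2 * η ^ 2)) * (Q ^ (n - 4))⁻¹) * Q⁻¹ := by
        rw [hQn]; field_simp; norm_num
    _ ≤ 5000 / η * Real.exp (-(n * (θ / 4))) * Q⁻¹ := by
        gcongr
        norm_num

theorem sqrt_mul_exp_le {θ : ℝ} (hθ : 0 < θ) {n : ℕ} (hn : 0 < n) :
    Real.sqrt n * Real.exp (-(n * (θ / 4))) ≤ 32 / θ ^ 2 / n := by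
  have hnR : (1 : ℝ) ≤ n := by exact_mod_cast hn
  have h1 : Real.sqrt n ≤ n := by
    rw [Real.sqrt_le_left (by linarith)]; nlinarith
  have h2 := Real.pow_div_factorial_le_exp (n * (θ / 4)) (by positivity) 2
  have h3 : (n * (θ / 4)) ^ 2 / 2 ≤ Real.exp (n * (θ / 4)) := by simpa using h2
  rw [Real.exp_neg, ← div_eq_mul_inv, div_div, div_le_div_iff₀ (Real.exp_pos _) (by positivity)]
  calc Real.sqrt n * (θ ^ 2 * n) ≤ n * (θ ^ 2 * n) := by gcongr
    _ = 32 * ((n * (θ / 4)) ^ 2 / 2) := by ring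
    _ ≤ _ := by gcongr

theorem integrable_inv_quarter : Integrable fun y : ℝ => (1 + y ^ 2 / 4)⁻¹ := by
  have := integrable_inv_one_add_sq.comp_div (R := (2 : ℝ)) two_ne_zero
  refine this.congr (Eventually.of_forall fun y => ?_)
  simp only [div_pow]
  norm_num

/-- Laplace's method on the segment through the saddle point. -/
theorem exists_near_bound {r : ℝ} (hr : 0 < r) (hr1 : r ≤ 1 / 40) :
    ∃ C : ℝ, 0 ≤ C ∧ ∀ (n : ℕ) (lam : ℝ), GoodScale n lam → ∀ z : ℂ, 0 ≤ z.re → r ≤ ‖z - 1‖ →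
      ‖(∫ y in (-(r / 4))..(r / 4), amplitude n lam (1 + y * I) * unitKernel z (1 + y * I)) -
        (Real.sqrt (Real.pi / (n * curvature n lam)) : ℝ)‖ ≤ C / (n * Real.sqrt n) := by
  set M1 : ℝ := 2 * (1 + 2 * (1 + 2 ^ 2) / (r / 2)) with hM1
  have hM1p : 0 < M1 := by positivity
  -- `M` dominates the Taylor constants of both the kernel and `phaseQuot`; for the latter `9·2·40²
  -- = 28800` is required.
  set M : ℝ := 20000 + 9 * M1 / (r / 2) ^ 2 + 3 * M1 / (r / 2) with hM
  have hp1 : 0 < 9 * M1 / (r / 2) ^ 2 := by positivity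
  have hp2 : 0 < 3 * M1 / (r / 2) := by positivity
  obtain ⟨C, hC, hL⟩ := exists_laplace_bound (r := r / 4) (M := M) (by positivity) (by linarith)
    (by linarith)
  refine ⟨C, hC, fun n lam h z hz hzr => ?_⟩
  have hline : ∀ y : ℝ, (1 + y * I : ℂ) - 1 = y * I := fun y => by ring
  have hlinen : ∀ y : ℝ, ‖(y * I : ℂ)‖ = |y| := fun y => by
    rw [norm_mul, norm_I, mul_one, norm_real, Real.norm_eq_abs]
  have hball : ∀ (R : ℝ) (y : ℝ), y ∈ Icc (-(r / 4)) (r / 4) → r / 4 < R →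
      (1 + y * I : ℂ) ∈ Metric.ball (1 : ℂ) R := by
    intro R y hy hR
    rw [Metric.mem_ball, dist_eq_norm, hline, hlinen]
    exact (abs_le.2 hy).trans_lt hR
  have hnear : ∀ t ∈ Metric.ball (1 : ℂ) (r / 2), r / 2 ≤ ‖t - z‖ ∧ 1 / 2 ≤ t.re ∧ ‖t‖ ≤ 2 := by
    intro t ht
    rw [Metric.mem_ball, dist_eq_norm] at ht
    refine ⟨?_, ?_, ?_⟩
    · have := norm_sub_norm_le (z - 1) (t - 1)
      rw [sub_sub_sub_cancel_right, norm_sub_rev z t] at this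
      linarith
    · have := (abs_le.1 (abs_re_le_norm (t - 1))).1
      rw [sub_re, one_re] at this
      linarith
    · have := norm_add_le (t - 1) 1
      rw [sub_add_cancel, norm_one] at this
      linarith
  have hne : ∀ t ∈ Metric.ball (1 : ℂ) (r / 2), t ^ 2 - z ^ 2 ≠ 0 := by
    intro t ht
    obtain ⟨h1, h2, -⟩ := hnear t ht
    have e : t ^ 2 - z ^ 2 = (t - z) * (t + z) := by ring
    rw [e]
    refine mul_ne_zero (fun h0 => ?_) (fun h0 => ?_)
    · rw [h0, norm_zero] at h1; linarith
    · have := congrArg re h0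
      rw [add_re, zero_re] at this
      linarith
  have hKd : DifferentiableOn ℂ (unitKernel z) (Metric.ball (1 : ℂ) (r / 2)) :=
    differentiableOn_unitKernel hne
  have hKb : ∀ t ∈ Metric.ball (1 : ℂ) (r / 2), ‖unitKernel z t‖ ≤ M1 := by
    intro t ht
    obtain ⟨h1, h2, h3⟩ := hnear t ht
    refine (norm_unitKernel_le (by positivity) hz h2 h1).trans ?_
    rw [hM1]
    gcongr
  have hK1 : unitKernel z 1 = 1 := by
    apply unitKernel_one
    intro h0
    have := hne 1 (one_mem_ball (by positivity))
    rw [h0] at this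
    simp at this
  obtain ⟨hk1, hk2⟩ := exists_taylor_bound (by positivity) hM1p hKd hKb
  have hgd : DifferentiableOn ℂ (phaseQuot n lam) (Metric.ball (1 : ℂ) (1 / 40)) :=
    (differentiableOn_phaseQuot n h.lam_ge).mono (Metric.ball_subset_ball (by norm_num))
  have hgb : ∀ t ∈ Metric.ball (1 : ℂ) (1 / 40), ‖phaseQuot n lam t‖ ≤ 2 := by
    intro t ht
    have h1 := h.norm_phaseQuot_add_one_le ht
    have := norm_sub_le (phaseQuot n lam t + 1) 1
    rw [add_sub_cancel_right, norm_one] at this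
    linarith
  obtain ⟨hg1, hg2⟩ := exists_taylor_bound (by norm_num) two_pos hgd hgb
  have ha := h.curvature_bounds
  have hcont : Continuous fun y : ℝ => (1 + y * I : ℂ) := by fun_prop
  have hyI : ∀ y : ℝ, ‖(y * I : ℂ)‖ ^ 2 = y ^ 2 := fun y => by rw [hlinen, sq_abs]
  -- On the line `t = 1 + iy` the phase is `(iy)²` times the quotient, so `e^(-nφ)` is `e^(-n y² G)`
  -- with `G` the negative of the quotient.
  have := hL n (curvature n lam) (fun y => -phaseQuot n lam (1 + y * I))
    (fun y => unitKernel z (1 + y * I)) (-(deriv (phaseQuot n lam) 1 * I)) 1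
    (deriv (unitKernel z) 1 * I) h.n_pos.ne' (by linarith)
    ((hgd.continuousOn.comp hcont.continuousOn fun y hy => hball _ y hy (by linarith)).neg)
    (hKd.continuousOn.comp hcont.continuousOn fun y hy => hball _ y hy (by linarith))
    ?_ ?_ ?_ ?_ ?_ ?_
  · rw [one_mul] at this
    refine le_trans (le_of_eq ?_) this
    congr 2
    refine intervalIntegral.integral_congr fun y hy => ?_
    rw [uIcc_of_le (by linarith)] at hy
    rw [h.amplitude_eq_exp (hball _ y hy (by linarith)), h.phase_eq_sq_mul, hline]
    congr 2
    rw [mul_pow, I_sq]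
    ring
  · intro y hy
    have h1 := h.norm_phaseQuot_add_one_le (hball _ y hy (by linarith))
    have e : -phaseQuot n lam (1 + y * I) - (curvature n lam : ℂ) =
        -(phaseQuot n lam (1 + y * I) + 1) + ((1 - curvature n lam : ℝ) : ℂ) := by
      push_cast; ring
    rw [e]
    refine (norm_add_le _ _).trans ?_
    rw [norm_neg, norm_real, Real.norm_eq_abs]
    have : |1 - curvature n lam| ≤ 1 / 20 := by rw [abs_le]; constructor <;> linarith
    linarith
  · intro y hy
    have h1 := hg2 _ (hball _ y hy (by linarith))
    rw [h.phaseQuot_one, hline, hyI] at h1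
    have e : -phaseQuot n lam (1 + y * I) - (curvature n lam : ℂ) -
        -(deriv (phaseQuot n lam) 1 * I) * y =
        -(phaseQuot n lam (1 + y * I) - ((-curvature n lam : ℝ) : ℂ) -
          deriv (phaseQuot n lam) 1 * (y * I)) := by push_cast; ring
    rw [e, norm_neg]
    refine h1.trans ?_
    have : (9 * 2 / (1 / 40) ^ 2 : ℝ) ≤ 28800 := by norm_num
    have h2 : (28800 : ℝ) ≤ M := by
      have h3 : (40000 : ℝ) ≤ 3 * M1 / (r / 2) := by
        rw [le_div_iff₀ (by positivity), hM1]
        have h4 : (400 : ℝ) ≤ 2 * (1 + 2 ^ 2) / (r / 2) := by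
          rw [le_div_iff₀ (by positivity)]; linarith
        nlinarith
      linarith
    exact mul_le_mul_of_nonneg_right (this.trans h2) (sq_nonneg y)
  · rw [norm_neg, norm_mul, norm_I, mul_one]
    norm_num at hg1
    linarith
  · intro y hy
    have h1 := hk2 _ (hball _ y hy (by linarith))
    rw [hK1, hline, hyI] at h1
    rw [mul_assoc, mul_comm I]
    exact h1.trans (mul_le_mul_of_nonneg_right (by linarith) (sq_nonneg y))
  · rw [norm_one]; linarith
  · rw [norm_mul, norm_I, mul_one]; linarith


/-- The rescaled Cauchy integral over a vertical line next to the saddle point is `1 + O(1/n)`. -/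
theorem exists_line_bound {r : ℝ} (hr : 0 < r) (hr1 : r ≤ 1 / 40) :
    ∃ η C : ℝ, 0 < η ∧ η < 1 / 40 ∧ 0 ≤ C ∧ ∀ (n : ℕ) (lam : ℝ), GoodScale n lam → ∀ z : ℂ,
      0 ≤ z.re → r ≤ ‖z - 1‖ → ∀ x : ℝ, |x - 1| = η → η ≤ |x - z.re| →
      (Integrable fun y : ℝ => amplitude n lam (x + y * I) * unitKernel z (x + y * I)) →
      ‖(Real.sqrt n * Real.sqrt (curvature n lam / Real.pi) : ℝ) *
        lineIntegral (fun t => amplitude n lam t * unitKernel z t) x - 1‖ ≤ C / n := by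
  obtain ⟨C₁, hC₁, hnear⟩ := exists_near_bound hr hr1
  set ρ : ℝ := r / 4 with hρ
  have hρ0 : 0 < ρ := by positivity
  -- `e^(-nθ)` is the decay of `(1 + y²/4)^(-n)` where the central segment `|y| ≤ ρ` ends.
  set θ : ℝ := Real.log (1 + ρ ^ 2 / 4) with hθ
  have hθ0 : 0 < θ := Real.log_pos (by nlinarith [sq_pos_of_pos hρ0])
  have hθe : Real.exp θ = 1 + ρ ^ 2 / 4 := Real.exp_log (by positivity)
  -- The bound `r/4` keeps `z` out of the rectangle between the two lines, `1/41` stays within the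
  -- disc where the phase is controlled, and `√θ/2` makes the loss `e^(2nη²)` smaller than the gain.
  set η : ℝ := min (r / 4) (min (1 / 41) (Real.sqrt θ / 2)) with hη
  have hη0 : 0 < η := by
    have := Real.sqrt_pos.2 hθ0
    positivity
  have hηr : η ≤ r / 4 := min_le_left _ _
  have hη40 : η < 1 / 40 :=
    ((min_le_right _ _).trans (min_le_left _ _)).trans_lt (by norm_num)
  have hηθ : 4 * η ^ 2 ≤ θ := by
    have h1 : η ≤ Real.sqrt θ / 2 := (min_le_right _ _).trans (min_le_right _ _)
    have h2 := Real.sq_sqrt hθ0.le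
    nlinarith
  set J : ℝ := ∫ y : ℝ, (1 + y ^ 2 / 4)⁻¹ with hJ
  have hJ0 : 0 ≤ J := integral_nonneg fun y => by positivity
  set K : ℝ := 5000 / η * J + 10000 with hK
  have hK0 : 0 ≤ K := by positivity
  refine ⟨η, C₁ + K * (32 / θ ^ 2), hη0, hη40, by positivity, fun n lam h z hz hzr x hx hxz hint => ?_⟩
  set G : ℂ → ℂ := fun t => amplitude n lam t * unitKernel z t with hG
  set ε : ℝ := Real.exp (-(n * (θ / 4))) with hε
  have hε0 : 0 < ε := Real.exp_pos _
  have hint' : Integrable fun y : ℝ => G (x + y * I) := hint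
  have hbound : ∀ t : ℂ, |t.re - 1| ≤ η → η ≤ ‖t - z‖ → ρ ≤ |t.im| →
      ‖G t‖ ≤ 5000 / η * ε * (1 + t.im ^ 2 / 4)⁻¹ := by
    intro t ht htz him
    refine h.norm_integrand_le hη0 hη40 hθ0.le hηθ ht hz htz ?_
    rw [hθe, ← sq_abs t.im]
    gcongr
  have hI := integrable_inv_quarter.const_mul (5000 / η * ε)
  have hIJ : ∫ y : ℝ, 5000 / η * ε * (1 + y ^ 2 / 4)⁻¹ = 5000 / η * ε * J := integral_const_mul _ _
  -- The rectangle lies within `η + ρ ≤ r/2` of the saddle and `z` does not, so the central segment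
  -- can be moved without crossing the pole at `z`.
  have hdist : ∀ t : ℂ, |t.re - 1| ≤ η → |t.im| ≤ ρ → η ≤ ‖t - z‖ ∧ t ≠ z ∧ 0 < t.re := by
    intro t h1 h2
    have h3 : ‖t - 1‖ ≤ η + ρ := by
      refine (norm_le_abs_re_add_abs_im _).trans ?_
      simpa using add_le_add h1 h2
    have := norm_sub_norm_le (z - 1) (t - 1)
    rw [sub_sub_sub_cancel_right, norm_sub_rev z t] at this
    have h4 : r / 2 ≤ ‖t - z‖ := by linarith
    refine ⟨by linarith, fun h0 => ?_, by linarith [(abs_le.1 h1).1]⟩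
    rw [h0, sub_self, norm_zero] at h4
    linarith
  have hrect : ∀ t : ℂ, t ∈ (uIcc 1 x ×ℂ uIcc (-ρ) ρ) → |t.re - 1| ≤ η ∧ |t.im| ≤ ρ := by
    intro t ht
    obtain ⟨h1, h2⟩ := mem_reProdIm.1 ht
    rw [uIcc_of_le (by linarith)] at h2
    refine ⟨?_, abs_le.2 h2⟩
    rw [← hx]
    exact abs_sub_left_of_mem_uIcc h1
  have hdG : DifferentiableOn ℂ G (uIcc 1 x ×ℂ uIcc (-ρ) ρ) := by
    refine (differentiableOn_amplitude n h.f_lam_ne_zero fun t ht => ?_).mul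
      (differentiableOn_unitKernel fun t ht => ?_)
    · obtain ⟨-, -, h3⟩ := hdist t (hrect t ht).1 (hrect t ht).2
      rintro rfl
      simp at h3
    · obtain ⟨-, h2, h3⟩ := hdist t (hrect t ht).1 (hrect t ht).2
      rw [show t ^ 2 - z ^ 2 = (t - z) * (t + z) by ring]
      refine mul_ne_zero (sub_ne_zero.2 h2) fun h0 => ?_
      have := congrArg re h0
      rw [add_re, zero_re] at this
      linarith
  have hhor : ∀ v : ℝ, |v| = ρ → ‖∫ s in (1 : ℝ)..x, G (s + v * I)‖ ≤ 5000 * ε := by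
    intro v hv
    have h1 := intervalIntegral.norm_integral_le_of_norm_le_const (a := 1) (b := x)
      (f := fun s : ℝ => G (s + v * I)) (C := 5000 / η * ε) (fun s hs => ?_)
    · refine h1.trans (le_of_eq ?_)
      rw [hx]; field_simp
    · have hre : ((s : ℂ) + v * I).re = s := by simp
      have him : ((s : ℂ) + v * I).im = v := by simp
      have h2 : |((s : ℂ) + v * I).re - 1| ≤ η := by
        rw [hre, ← hx]
        exact abs_sub_left_of_mem_uIcc (uIoc_subset_uIcc hs)
      have h3 := hbound _ h2 (hdist _ h2 (by rw [him, hv])).1 (by rw [him, hv])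
      refine h3.trans ?_
      have : (1 + ((s : ℂ) + v * I).im ^ 2 / 4)⁻¹ ≤ 1 := inv_le_one_of_one_le₀ (by
        nlinarith [sq_nonneg ((s : ℂ) + v * I).im])
      exact mul_le_of_le_one_right (by positivity) this
  have hcauchy := integral_boundary_rect_eq_zero_of_differentiableOn G ⟨1, -ρ⟩ ⟨x, ρ⟩ hdG
  simp only [smul_eq_mul] at hcauchy
  set A := ∫ y in (-ρ)..ρ, G (x + y * I)
  have hshift : ‖A - ∫ y in (-ρ)..ρ, G (1 + y * I)‖ ≤ 10000 * ε := by
    have e1 : I * (A - ∫ y in (-ρ)..ρ, G (1 + y * I)) =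
        (∫ s in (1 : ℝ)..x, G (s + (ρ : ℝ) * I)) - ∫ s in (1 : ℝ)..x, G (s + ((-ρ : ℝ) : ℂ) * I) := by
      push_cast at hcauchy ⊢
      linear_combination hcauchy
    have e2 := congrArg norm e1
    rw [norm_mul, norm_I, one_mul] at e2
    rw [e2]
    refine (norm_sub_le _ _).trans ?_
    have := hhor ρ (abs_of_pos hρ0)
    have := hhor (-ρ) (by rw [abs_neg, abs_of_pos hρ0])
    linarith
  have hfar : ‖lineIntegral G x - A‖ ≤ 5000 / η * ε * J := by
    have e : lineIntegral G x - A = ∫ y in (Ioc (-ρ) ρ)ᶜ, G (x + y * I) := by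
      rw [lineIntegral, ← integral_add_compl (measurableSet_Ioc (a := -ρ) (b := ρ)) hint']
      simp only [A]
      rw [intervalIntegral.integral_of_le (by linarith)]
      ring
    rw [e, ← hIJ]
    calc ‖∫ y in (Ioc (-ρ) ρ)ᶜ, G (x + y * I)‖
        ≤ ∫ y in (Ioc (-ρ) ρ)ᶜ, 5000 / η * ε * (1 + y ^ 2 / 4)⁻¹ := by
          refine norm_integral_le_of_norm_le hI.integrableOn ?_
          filter_upwards [ae_restrict_mem measurableSet_Ioc.compl] with y hy
          have hre : ((x : ℂ) + y * I).re = x := by simp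
          have him : ((x : ℂ) + y * I).im = y := by simp
          have h3 := hbound (x + y * I) (by rw [hre, hx]) ?_ ?_
          · rwa [him] at h3
          · refine hxz.trans ?_
            have := abs_re_le_norm ((x : ℂ) + y * I - z)
            rwa [sub_re, hre] at this
          · rw [him]
            by_contra h0
            rw [not_le, abs_lt] at h0
            exact hy ⟨h0.1, h0.2.le⟩
      _ ≤ ∫ y : ℝ, 5000 / η * ε * (1 + y ^ 2 / 4)⁻¹ :=
          setIntegral_le_integral hI (Eventually.of_forall fun y => by positivity)
  have ha := h.curvature_bounds
  have hnR : (0 : ℝ) < n := by exact_mod_cast h.n_pos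
  have hsn := Real.sqrt_pos.2 hnR
  set a := curvature n lam
  have hpi := Real.pi_pos
  have hpi3 := Real.pi_gt_three
  have hN := hnear n lam h z hz hzr
  set S : ℝ := Real.sqrt n * Real.sqrt (a / Real.pi) with hS
  have hSle : S ≤ Real.sqrt n := by
    rw [hS]
    refine mul_le_of_le_one_right hsn.le ?_
    rw [Real.sqrt_le_one]
    rw [div_le_one hpi]; linarith
  have hS0 : 0 ≤ S := by positivity
  have hS1 : S * Real.sqrt (Real.pi / (n * a)) = 1 := by
    have ha0 : (0 : ℝ) < a := by linarith
    rw [hS, ← Real.sqrt_mul hnR.le, ← Real.sqrt_mul (by positivity), Real.sqrt_eq_one]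
    field_simp
  have htot : ‖lineIntegral G x - (Real.sqrt (Real.pi / (n * a)) : ℝ)‖ ≤
      C₁ / (n * Real.sqrt n) + K * ε := by
    have e : lineIntegral G x - (Real.sqrt (Real.pi / (n * a)) : ℝ) = (lineIntegral G x - A) +
      ((A - ∫ y in (-ρ)..ρ, G (1 + y * I)) + ((∫ y in (-ρ)..ρ, G (1 + y * I)) -
        (Real.sqrt (Real.pi / (n * a)) : ℝ))) := by ring
    rw [e]
    refine (norm_add_le _ _).trans ?_
    have h1 := norm_add_le (A - ∫ y in (-ρ)..ρ, G (1 + y * I))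
      ((∫ y in (-ρ)..ρ, G (1 + y * I)) - (Real.sqrt (Real.pi / (n * a)) : ℝ))
    rw [hK]
    linarith
  have e : (S : ℂ) * lineIntegral G x - 1 =
      S * (lineIntegral G x - (Real.sqrt (Real.pi / (n * a)) : ℝ)) := by
    rw [mul_sub, ← ofReal_mul, hS1, ofReal_one]
  rw [e, norm_mul, norm_real, Real.norm_of_nonneg hS0]
  calc S * ‖lineIntegral G x - (Real.sqrt (Real.pi / (n * a)) : ℝ)‖
      ≤ Real.sqrt n * (C₁ / (n * Real.sqrt n) + K * ε) := by gcongr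
    _ = C₁ / n + K * (Real.sqrt n * ε) := by field_simp
    _ ≤ C₁ / n + K * (32 / θ ^ 2 / n) := by
        gcongr
        exact sqrt_mul_exp_le hθ0 h.n_pos
    _ = _ := by ring

/-- The normalization `√n · √(πa) · (1 - z²)`, the reciprocal of `h₀(z)/√n`. -/
noncomputable def saddleFactor (n : ℕ) (lam : ℝ) (z : ℂ) : ℂ :=
  (Real.sqrt n * Real.sqrt (Real.pi * curvature n lam) : ℝ) * (1 - z ^ 2)

/-- The first-order asymptotics of the Taylor remainder and of the Taylor polynomial away from the
saddle points. -/
theorem exists_outer_bound {r : ℝ} (hr : 0 < r) (hr1 : r ≤ 1 / 40) :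
    ∃ C : ℝ, 0 ≤ C ∧ ∀ (n : ℕ) (lam : ℝ), GoodScale n lam → ∀ z : ℂ, 0 ≤ z.re → r ≤ ‖z - 1‖ →
      (z.re < 1 → ‖saddleFactor n lam z * (scaledRemainder n lam z / f lam) - 1‖ ≤ C / n) ∧
      (1 ≤ z.re →
        ‖saddleFactor n lam z * -(T (2 * n - 1) (lam * z) / (f lam * z ^ (2 * n))) - 1‖ ≤ C / n) := by
  obtain ⟨η, C, hη0, hη1, hC, hline⟩ := exists_line_bound hr hr1
  refine ⟨C, hC, fun n lam h z hz hzr => ?_⟩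
  have hf := h.f_lam_ne_zero
  have ha := h.curvature_bounds
  have hpi := Real.pi_pos
  have hSS : Real.sqrt n * Real.sqrt (curvature n lam / Real.pi) * Real.pi =
      Real.sqrt n * Real.sqrt (Real.pi * curvature n lam) := by
    rw [mul_assoc]
    congr 1
    have ha0 : 0 ≤ curvature n lam := by linarith
    rw [← Real.sqrt_mul_self hpi.le, ← Real.sqrt_mul (by positivity), Real.sqrt_mul_self hpi.le]
    congr 1
    field_simp
  have hz1 : 1 - z ^ 2 ≠ 0 := by
    rw [show 1 - z ^ 2 = -(z - 1) * (z + 1) by ring]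
    refine mul_ne_zero (neg_ne_zero.2 fun h0 => ?_) fun h0 => ?_
    · rw [h0, norm_zero] at hzr; linarith
    · have := congrArg re h0
      rw [add_re, zero_re, one_re] at this
      linarith
  have key : ∀ x : ℝ, 0 < x → |x - 1| = η → η ≤ |x - z.re| → (|z.re| < x ∨ x < z.re) →
      ‖saddleFactor n lam z * ((if |z.re| < x then 2 * Real.pi * scaledRemainder n lam z else
        -(2 * Real.pi) * (T (2 * n - 1) (lam * z) / z ^ (2 * n))) / (2 * Real.pi * f lam)) - 1‖
        ≤ C / n := by
    intro x hx0 hx hxz hcase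
    have hn2 : 2 ≤ n := by have := h.n_ge; omega
    obtain ⟨hi, hv⟩ := lineIntegral_f_div_pow hn2 lam hx0 hcase
    -- The factor `(1 - z²)/(2 f(λ))` normalizes amplitude and kernel to `1` at the saddle; its
    -- inverse reappears in `saddleFactor`.
    have e : ∀ t, f (lam * t) / t ^ (2 * n) * cauchyKernel z t * ((1 - z ^ 2) / (2 * f lam)) =
        amplitude n lam t * unitKernel z t := by
      intro t
      rw [amplitude, unitKernel, cauchyKernel, div_mul_eq_div_div_swap]
      field_simp
    have hi2 := hi.mul_const ((1 - z ^ 2) / (2 * f lam))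
    simp only [e] at hi2
    have h1 := hline n lam h z hz hzr x hx hxz hi2
    have h2 : lineIntegral (fun t => amplitude n lam t * unitKernel z t) x =
        lineIntegral (fun t => f (lam * t) / t ^ (2 * n) * cauchyKernel z t) x *
          ((1 - z ^ 2) / (2 * f lam)) := by
      simp only [lineIntegral, ← e]
      exact integral_mul_const _ _
    rw [h2, hv] at h1
    refine le_trans (le_of_eq ?_) h1
    congr 2
    rw [saddleFactor, ← hSS]
    have : (Real.pi : ℂ) ≠ 0 := by exact_mod_cast hpi.ne'
    push_cast
    field_simp
  have hpiC : (Real.pi : ℂ) ≠ 0 := by exact_mod_cast hpi.ne'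
  constructor
  · intro hz2
    have hab : |z.re| < 1 + η := by rw [abs_of_nonneg hz]; linarith
    -- The line is placed beyond the saddle, so that a `z` just left of `Re z = 1` is still at
    -- distance at least `η` from it.
    have := key (1 + η) (by linarith) (by simp [abs_of_pos hη0])
      (by rw [abs_of_pos (by linarith)]; linarith) (Or.inl hab)
    rw [if_pos hab] at this
    convert this using 4
    field_simp
  · intro hz2
    have hab : ¬ |z.re| < 1 - η := by rw [abs_of_nonneg hz]; linarith
    -- For `Re z ≥ 1` the line passes on the other side of the saddle, and the residue gives the
    -- Taylor polynomial.
    have := key (1 - η) (by linarith) (by rw [sub_sub_cancel_left, abs_neg, abs_of_pos hη0])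
      (by rw [abs_of_nonpos (by linarith)]; linarith) (Or.inr (by linarith))
    rw [if_neg hab] at this
    convert this using 4
    field_simp


/-! ### The local coordinate -/

/-- The square root of `-φ(z)/(z-1)²`. -/
noncomputable def coordRoot (n : ℕ) (lam : ℝ) (z : ℂ) : ℂ := exp (log (-phaseQuot n lam z) / 2)

/-- The local coordinate near `z = 1`. -/
noncomputable def coord (n : ℕ) (lam : ℝ) (z : ℂ) : ℂ := -I * (z - 1) * coordRoot n lam z

namespace GoodScale

variable {n : ℕ} {lam : ℝ}

theorem neg_phaseQuot_mem (h : GoodScale n lam) {z : ℂ} (hz : z ∈ Metric.ball (1 : ℂ) (1 / 40)) :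
    -phaseQuot n lam z ∈ slitPlane := by
  left
  have h1 := (abs_re_le_norm _).trans (h.norm_phaseQuot_add_one_le hz)
  rw [add_re, one_re] at h1
  rw [neg_re]
  linarith [(abs_le.1 h1).2]

theorem coordRoot_sq (h : GoodScale n lam) {z : ℂ} (hz : z ∈ Metric.ball (1 : ℂ) (1 / 40)) :
    coordRoot n lam z ^ 2 = -phaseQuot n lam z := by
  rw [coordRoot, ← exp_nat_mul]
  push_cast
  rw [mul_div_cancel₀ _ two_ne_zero, exp_log (slitPlane_ne_zero (h.neg_phaseQuot_mem hz))]

/-- `(q - 1)(q + 1) = q² - 1` is small, and `|q + 1| ≥ 1` because the chosen root has nonnegative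
real part. -/
theorem norm_coordRoot_sub_one_le (h : GoodScale n lam) {z : ℂ}
    (hz : z ∈ Metric.ball (1 : ℂ) (1 / 40)) : ‖coordRoot n lam z - 1‖ ≤ 1 / 20 := by
  have h1 := h.coordRoot_sq hz
  have h2 := h.norm_phaseQuot_add_one_le hz
  have hre : 0 ≤ (coordRoot n lam z).re := by
    rw [coordRoot, exp_re]
    refine mul_nonneg (Real.exp_pos _).le (Real.cos_nonneg_of_mem_Icc ?_)
    have e : (log (-phaseQuot n lam z) / 2).im = arg (-phaseQuot n lam z) / 2 := by
      rw [div_ofNat_im, log_im]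
    rw [e]
    have := abs_le.1 (abs_arg_le_pi (-phaseQuot n lam z))
    constructor <;> linarith [this.1, this.2]
  have h3 : 1 ≤ ‖coordRoot n lam z + 1‖ := by
    have := re_le_norm (coordRoot n lam z + 1)
    rw [add_re, one_re] at this
    linarith
  have h4 : (coordRoot n lam z - 1) * (coordRoot n lam z + 1) = -(phaseQuot n lam z + 1) := by
    linear_combination h1
  have h5 := congrArg norm h4
  rw [norm_mul, norm_neg] at h5
  nlinarith [norm_nonneg (coordRoot n lam z - 1)]

theorem norm_coordRoot_bounds (h : GoodScale n lam) {z : ℂ}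
    (hz : z ∈ Metric.ball (1 : ℂ) (1 / 40)) :
    19 / 20 ≤ ‖coordRoot n lam z‖ ∧ ‖coordRoot n lam z‖ ≤ 21 / 20 := by
  have h1 := h.norm_coordRoot_sub_one_le hz
  have h2 := norm_sub_norm_le (coordRoot n lam z) 1
  have h3 := norm_sub_norm_le 1 (coordRoot n lam z)
  rw [norm_sub_rev 1] at h3
  rw [norm_one] at h2 h3
  constructor <;> linarith

theorem differentiableOn_coordRoot (h : GoodScale n lam) :
    DifferentiableOn ℂ (coordRoot n lam) (Metric.ball (1 : ℂ) (1 / 40)) := by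
  have h1 : DifferentiableOn ℂ (phaseQuot n lam) (Metric.ball (1 : ℂ) (1 / 40)) :=
    (differentiableOn_phaseQuot n h.lam_ge).mono (Metric.ball_subset_ball (by norm_num))
  exact ((h1.neg.clog fun z hz => h.neg_phaseQuot_mem hz).div_const 2).cexp

theorem differentiableOn_coord (h : GoodScale n lam) :
    DifferentiableOn ℂ (coord n lam) (Metric.ball (1 : ℂ) (1 / 40)) :=
  DifferentiableOn.mul (by fun_prop) h.differentiableOn_coordRoot

theorem coord_sq (h : GoodScale n lam) {z : ℂ} (hz : z ∈ Metric.ball (1 : ℂ) (1 / 40)) :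
    coord n lam z ^ 2 = phase n lam z := by
  rw [h.phase_eq_sq_mul, coord, mul_pow, mul_pow, h.coordRoot_sq hz, neg_sq, I_sq]
  ring

theorem coordRoot_one (h : GoodScale n lam) :
    coordRoot n lam 1 = (Real.sqrt (curvature n lam) : ℝ) := by
  have ha : 0 < curvature n lam := by linarith [h.curvature_bounds.1]
  rw [coordRoot, h.phaseQuot_one, ← ofReal_neg, neg_neg, ← ofReal_log ha.le, Real.sqrt_eq_rpow,
    Real.rpow_def_of_pos ha]
  push_cast
  congr 1
  ring

theorem deriv_coord_one (h : GoodScale n lam) :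
    deriv (coord n lam) 1 = -I * (Real.sqrt (curvature n lam) : ℝ) := by
  have hm := Metric.ball_mem_nhds (1 : ℂ) (by norm_num : (0 : ℝ) < 1 / 40)
  have h1 := (h.differentiableOn_coordRoot.differentiableAt hm).hasDerivAt
  have h2 := ((((hasDerivAt_id (1 : ℂ)).sub_const 1).const_mul (-I)).mul h1).deriv
  refine Eq.trans ?_ (h2.trans ?_)
  · rfl
  · simp [h.coordRoot_one]

theorem norm_coord_bounds (h : GoodScale n lam) {z : ℂ} (hz : z ∈ Metric.ball (1 : ℂ) (1 / 40)) :
    19 / 20 * ‖z - 1‖ ≤ ‖coord n lam z‖ ∧ ‖coord n lam z‖ ≤ 21 / 20 * ‖z - 1‖ := by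
  obtain ⟨h1, h2⟩ := h.norm_coordRoot_bounds hz
  rw [coord, norm_mul, norm_mul, norm_neg, norm_I, one_mul, mul_comm]
  constructor <;> nlinarith [norm_nonneg (z - 1)]

/-- `w` is a perturbation of `-i(z - 1)` whose difference from it is at most `(1/40)(1/20) = 1/800`;
a Cauchy estimate on circles of radius `1/81` gives the Lipschitz constant `81/800 < 1/8`.
Injectivity and surjectivity of `w` both follow from this. -/
theorem norm_coord_add_sub_le (h : GoodScale n lam) {z z' : ℂ}
    (hz : z ∈ Metric.ball (1 : ℂ) (1 / 80)) (hz' : z' ∈ Metric.ball (1 : ℂ) (1 / 80)) :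
    ‖(coord n lam z + I * (z - 1)) - (coord n lam z' + I * (z' - 1))‖ ≤ 1 / 8 * ‖z - z'‖ := by
  set ψ : ℂ → ℂ := fun z => coord n lam z + I * (z - 1) with hψ
  have hd : DifferentiableOn ℂ ψ (Metric.ball (1 : ℂ) (1 / 40)) :=
    h.differentiableOn_coord.add (by fun_prop)
  have hb : ∀ u ∈ Metric.ball (1 : ℂ) (1 / 40), ‖ψ u‖ ≤ 1 / 800 := by
    intro u hu
    have e : ψ u = -I * (u - 1) * (coordRoot n lam u - 1) := by
      simp only [hψ, coord]; ring
    have h1 := h.norm_coordRoot_sub_one_le hu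
    rw [Metric.mem_ball, dist_eq_norm] at hu
    rw [e, norm_mul, norm_mul, norm_neg, norm_I, one_mul]
    calc ‖u - 1‖ * ‖coordRoot n lam u - 1‖ ≤ 1 / 40 * (1 / 20) := by gcongr
      _ = _ := by norm_num
  refine Convex.norm_image_sub_le_of_norm_deriv_le (f := ψ) (s := Metric.ball (1 : ℂ) (1 / 80))
    (fun u hu => hd.differentiableAt (Metric.isOpen_ball.mem_nhds
      (Metric.ball_subset_ball (by norm_num) hu))) (fun u hu => ?_) (convex_ball _ _) hz' hz
  have hsub : Metric.closedBall u (1 / 81) ⊆ Metric.ball (1 : ℂ) (1 / 40) := by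
    intro v hv
    rw [Metric.mem_closedBall] at hv
    rw [Metric.mem_ball] at hu ⊢
    linarith [dist_triangle v u 1]
  have h1 := norm_deriv_le_of_forall_mem_sphere_norm_le (by norm_num : (0 : ℝ) < 1 / 81)
    (hd.diffContOnCl_ball hsub) (fun v hv => hb v (hsub (Metric.sphere_subset_closedBall hv)))
  norm_num at h1 ⊢
  linarith

theorem injOn_coord (h : GoodScale n lam) :
    InjOn (coord n lam) (Metric.ball (1 : ℂ) (1 / 80)) := by
  intro z hz z' hz' he
  have h1 := h.norm_coord_add_sub_le hz hz'
  rw [he, add_sub_add_left_eq_sub, ← mul_sub, sub_sub_sub_cancel_right, norm_mul, norm_I,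
    one_mul] at h1
  have h2 : ‖z - z'‖ = 0 := by linarith [norm_nonneg (z - z')]
  exact sub_eq_zero.1 (norm_eq_zero.1 h2)

/-- `w(z) = v` is the fixed point equation of `z ↦ 1 + i(v - ψ(z))`, a contraction of the disc of
radius `1/100`, since `(1/8)(1/100) + 1/400 ≤ 1/100`. The radius `1/400` does not depend on `n`. -/
theorem exists_coord_eq (h : GoodScale n lam) {v : ℂ} (hv : ‖v‖ < 1 / 400) :
    ∃ z ∈ Metric.ball (1 : ℂ) (1 / 80), coord n lam z = v := by
  set ψ : ℂ → ℂ := fun z => coord n lam z + I * (z - 1) with hψ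
  set Φ : ℂ → ℂ := fun z => 1 + I * (v - ψ z) with hΦ
  set s : Set ℂ := Metric.closedBall 1 (1 / 100)
  have hs : s ⊆ Metric.ball (1 : ℂ) (1 / 80) := Metric.closedBall_subset_ball (by norm_num)
  have hΦd : ∀ z ∈ s, ∀ z' ∈ s, ‖Φ z - Φ z'‖ ≤ 1 / 8 * ‖z - z'‖ := by
    intro z hz z' hz'
    have e : Φ z - Φ z' = -I * (ψ z - ψ z') := by simp only [hΦ]; ring
    rw [e, norm_mul, norm_neg, norm_I, one_mul]
    exact h.norm_coord_add_sub_le (hs hz) (hs hz')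
  have h1s : (1 : ℂ) ∈ s := by simp [s]
  have hΦ1 : ‖Φ 1 - 1‖ < 1 / 400 := by
    have e : Φ 1 - 1 = I * v := by simp only [hΦ, hψ, coord]; ring
    rw [e, norm_mul, norm_I, one_mul]
    exact hv
  have hmaps : MapsTo Φ s s := by
    intro z hz
    have h1 := hΦd z hz 1 h1s
    have h2 := norm_add_le (Φ z - Φ 1) (Φ 1 - 1)
    rw [sub_add_sub_cancel] at h2
    simp only [s, Metric.mem_closedBall, dist_eq_norm] at hz ⊢
    linarith
  have hc : ContractingWith (1 / 8) (hmaps.restrict Φ s s) := by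
    refine ⟨by
      rw [← NNReal.coe_lt_coe]; norm_num, LipschitzWith.of_dist_le_mul fun z z' => ?_⟩
    have := hΦd z z.2 z' z'.2
    rw [Subtype.dist_eq, Subtype.dist_eq, dist_eq_norm, dist_eq_norm]
    simpa using this
  obtain ⟨z, hz, hfix, -⟩ := hc.exists_fixedPoint' (Metric.isClosed_closedBall.isComplete) hmaps h1s
    (edist_ne_top _ _)
  refine ⟨z, hs hz, ?_⟩
  have h2 : 1 + I * (v - (coord n lam z + I * (z - 1))) = z := hfix
  have h3 : I * (v - coord n lam z) = 0 := by linear_combination h2 + (z - 1) * I_sq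
  rcases mul_eq_zero.1 h3 with h4 | h4
  · exact absurd h4 I_ne_zero
  · exact (sub_eq_zero.1 h4).symm

end GoodScale

/-- The even extension of the local coordinate. -/
noncomputable def evenCoord (n : ℕ) (lam : ℝ) (z : ℂ) : ℂ :=
  if 0 ≤ z.re then coord n lam z else coord n lam (-z)

/-- The neighbourhood of `1` in which `|w| < δ`. -/
def coordDisc (n : ℕ) (lam δ : ℝ) : Set ℂ :=
  {z | z ∈ Metric.ball (1 : ℂ) (1 / 80) ∧ ‖coord n lam z‖ < δ}

theorem evenCoord_of_mem_ball {n : ℕ} {lam : ℝ} {z : ℂ} (hz : z ∈ Metric.ball (1 : ℂ) (1 / 80)) :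
    evenCoord n lam z = coord n lam z := by
  have h1 := (ball_re (Metric.ball_subset_ball (by norm_num) hz)).1
  rw [evenCoord, if_pos (by linarith)]

theorem evenCoord_neg_of_mem_ball {n : ℕ} {lam : ℝ} {z : ℂ}
    (hz : z ∈ Metric.ball (1 : ℂ) (1 / 80)) : evenCoord n lam (-z) = coord n lam z := by
  have h1 := (ball_re (Metric.ball_subset_ball (by norm_num) hz)).1
  rw [evenCoord, if_neg (by rw [neg_re]; linarith), neg_neg]

theorem GoodScale.isOpen_coordDisc {n : ℕ} {lam : ℝ} (h : GoodScale n lam) (δ : ℝ) :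
    IsOpen (coordDisc n lam δ) :=
  (h.differentiableOn_coord.continuousOn.mono
    (Metric.ball_subset_ball (by norm_num))).norm.isOpen_inter_preimage Metric.isOpen_ball isOpen_Iio

theorem coord_one (n : ℕ) (lam : ℝ) : coord n lam 1 = 0 := by simp [coord]

theorem one_mem_coordDisc (n : ℕ) (lam : ℝ) {δ : ℝ} (hδ : 0 < δ) : 1 ∈ coordDisc n lam δ :=
  ⟨one_mem_ball (by norm_num), by rwa [coord_one, norm_zero]⟩

theorem GoodScale.isLocalCoordinate {n : ℕ} {lam : ℝ} (h : GoodScale n lam) :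
    IsLocalCoordinate n lam (1 / 400) (evenCoord n lam) (coordDisc n lam (1 / 400)) := by
  have hopen := h.isOpen_coordDisc (1 / 400)
  have hd : DifferentiableOn ℂ (evenCoord n lam) (coordDisc n lam (1 / 400)) :=
    (h.differentiableOn_coord.mono fun z hz =>
      Metric.ball_subset_ball (by norm_num) hz.1).congr fun z hz => evenCoord_of_mem_ball hz.1
  refine ⟨hopen, one_mem_coordDisc n lam (by norm_num), fun z hz => ?_, hd.analyticOnNhd hopen,
    fun z hz z' hz' he => ?_, ?_, fun z hz => ?_, ?_, fun z hz => ?_⟩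
  · exact half_lt_of_mem_ball h.lam_ge (Metric.ball_subset_ball (by norm_num) hz.1)
  · rw [evenCoord_of_mem_ball hz.1, evenCoord_of_mem_ball hz'.1] at he
    exact h.injOn_coord hz.1 hz'.1 he
  · ext v
    rw [mem_ball_zero_iff]
    constructor
    · rintro ⟨z, hz, rfl⟩
      rw [evenCoord_of_mem_ball hz.1]
      exact hz.2
    · intro hv
      obtain ⟨z, hz, rfl⟩ := h.exists_coord_eq hv
      exact ⟨z, ⟨hz, hv⟩, evenCoord_of_mem_ball hz⟩
  · rw [evenCoord_of_mem_ball hz.1]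
    exact h.coord_sq (Metric.ball_subset_ball (by norm_num) hz.1)
  · have he : evenCoord n lam =ᶠ[𝓝 1] coord n lam := by
      filter_upwards [hopen.mem_nhds (one_mem_coordDisc n lam (by norm_num))] with z hz
      exact evenCoord_of_mem_ball hz.1
    rw [he.deriv_eq, h.deriv_coord_one, curvature]
  · rw [evenCoord_of_mem_ball hz.1, evenCoord_neg_of_mem_ball hz.1]

theorem mem_B_iff {n : ℕ} {lam δ : ℝ} (hδ : δ ≤ 1 / 400) {z : ℂ} :
    z ∈ B (evenCoord n lam) (coordDisc n lam (1 / 400)) δ ↔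
      z ∈ coordDisc n lam δ ∨ -z ∈ coordDisc n lam δ := by
  constructor
  · rintro ⟨h1 | h1, h2⟩
    · rw [mem_ball_zero_iff, evenCoord_of_mem_ball h1.1] at h2
      exact Or.inl ⟨h1.1, h2⟩
    · rw [mem_ball_zero_iff, ← neg_neg z, evenCoord_neg_of_mem_ball h1.1] at h2
      exact Or.inr ⟨h1.1, h2⟩
  · rintro (h1 | h1)
    · refine ⟨Or.inl ⟨h1.1, h1.2.trans_le hδ⟩, ?_⟩
      rw [mem_ball_zero_iff, evenCoord_of_mem_ball h1.1]
      exact h1.2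
    · refine ⟨Or.inr ⟨h1.1, h1.2.trans_le hδ⟩, ?_⟩
      rw [mem_ball_zero_iff, ← neg_neg z, evenCoord_neg_of_mem_ball h1.1]
      exact h1.2

/-- Outside the disc one keeps a fixed distance from the saddle point. -/
theorem GoodScale.half_le_of_not_mem_coordDisc {n : ℕ} {lam δ : ℝ} (h : GoodScale n lam)
    (hδ : δ ≤ 1 / 400) {z : ℂ} (hz : z ∉ coordDisc n lam δ) : δ / 2 ≤ ‖z - 1‖ := by
  by_contra h0
  rw [not_le] at h0
  have hb : z ∈ Metric.ball (1 : ℂ) (1 / 80) := by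
    rw [Metric.mem_ball, dist_eq_norm]; linarith
  refine hz ⟨hb, ?_⟩
  have := (h.norm_coord_bounds (Metric.ball_subset_ball (by norm_num) hb)).2
  have := norm_nonneg (z - 1)
  linarith


/-! ### The Taylor polynomial near the saddle points -/

/-- The residual inside the disc around the saddle point. -/
noncomputable def innerError (n : ℕ) (lam : ℝ) (z : ℂ) : ℂ :=
  (Real.sqrt n : ℂ) * (1 / 2 * erfc (I * (Real.sqrt n : ℂ) * coord n lam z) * amplitude n lam z -
    T (2 * n - 1) (lam * z) / (f lam * z ^ (2 * n)))

/-- The analytic continuation of `h₀(z) + 1/(2i√π w(z))` to `z = 1`. -/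
noncomputable def smoothCorrection (n : ℕ) (lam : ℝ) : ℂ → ℂ :=
  dslope (fun z => 1 / (Real.sqrt Real.pi : ℂ) * (1 / (2 * coordRoot n lam z) -
    1 / ((Real.sqrt (curvature n lam) : ℂ) * (z + 1)))) 1

theorem one_le_norm_add_one {z : ℂ} (hz : 0 ≤ z.re) : 1 ≤ ‖z + 1‖ := by
  have := re_le_norm (z + 1)
  rw [add_re, one_re] at this
  linarith

namespace GoodScale

variable {n : ℕ} {lam : ℝ}

theorem h0_eq (h : GoodScale n lam) (z : ℂ) :
    h0 n lam z = 1 / ((Real.sqrt (Real.pi * curvature n lam) : ℂ) * (1 - z ^ 2)) := by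
  have ha := h.curvature_bounds.1
  have e : Real.sqrt (2 * Real.pi * ‖phaseSecond n lam‖) =
      2 * Real.sqrt (Real.pi * curvature n lam) := by
    rw [h.norm_phaseSecond, show 2 * Real.pi * (2 * curvature n lam) =
      2 ^ 2 * (Real.pi * curvature n lam) by ring, Real.sqrt_mul (by norm_num),
      Real.sqrt_sq (by norm_num)]
  rw [h0, e]
  push_cast
  rw [div_mul_div_comm, one_mul, mul_assoc, ← div_div, div_self two_ne_zero]

theorem saddleFactor_mul_h0 (h : GoodScale n lam) {z : ℂ} (hz : 1 - z ^ 2 ≠ 0) :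
    h0 n lam z * saddleFactor n lam z = Real.sqrt n := by
  have ha := h.curvature_bounds.1
  have h1 : Real.sqrt (Real.pi * curvature n lam) ≠ 0 :=
    (Real.sqrt_pos.2 (mul_pos Real.pi_pos (by linarith))).ne'
  have h2 : (Real.sqrt (Real.pi * curvature n lam) : ℂ) ≠ 0 := by exact_mod_cast h1
  rw [h.h0_eq, saddleFactor]
  push_cast
  field_simp

theorem one_le_sqrt_pi_mul (h : GoodScale n lam) :
    1 ≤ Real.sqrt (Real.pi * curvature n lam) := by
  have ha := h.curvature_bounds.1
  rw [Real.one_le_sqrt]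
  nlinarith [Real.pi_gt_three]

theorem norm_h0_le (h : GoodScale n lam) {r : ℝ} (hr : 0 < r) {z : ℂ} (hz : 0 ≤ z.re)
    (hzr : r ≤ ‖z - 1‖) : ‖h0 n lam z‖ ≤ 1 / r := by
  rw [h.h0_eq, norm_div, norm_one, norm_mul, norm_real, Real.norm_of_nonneg (Real.sqrt_nonneg _)]
  have h1 := h.one_le_sqrt_pi_mul
  have h2 := one_le_norm_add_one hz
  have e : ‖1 - z ^ 2‖ = ‖z - 1‖ * ‖z + 1‖ := by
    rw [← norm_mul, ← norm_neg]; congr 1; ring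
  rw [e]
  apply one_div_le_one_div_of_le hr
  calc r = 1 * (r * 1) := by ring
    _ ≤ _ := by gcongr

theorem one_sub_sq_ne_zero {z : ℂ} (hz : 0 ≤ z.re) (hz1 : z ≠ 1) : 1 - z ^ 2 ≠ 0 := by
  have h2 := one_le_norm_add_one hz
  rw [show 1 - z ^ 2 = -(z - 1) * (z + 1) by ring]
  refine mul_ne_zero (neg_ne_zero.2 (sub_ne_zero.2 hz1)) fun h0 => ?_
  rw [h0, norm_zero] at h2; linarith

theorem coordRoot_ne_zero : coordRoot n lam z ≠ 0 := exp_ne_zero _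

/-- Both terms have a simple pole at `1`, with opposite residues because `coordRoot` equals `√a`
there, `a` being the curvature; the branch chosen for `w'(1)` is what makes them cancel. The sum is
thus a difference quotient of a function that vanishes at `1`. -/
theorem smoothCorrection_eq (h : GoodScale n lam) {z : ℂ} (hz : 0 ≤ z.re) (hz1 : z ≠ 1) :
    smoothCorrection n lam z =
      h0 n lam z + 1 / (2 * I * (Real.sqrt Real.pi : ℂ) * coord n lam z) := by
  have ha := h.curvature_bounds.1
  have hpi : (Real.sqrt Real.pi : ℂ) ≠ 0 := by
    exact_mod_cast (Real.sqrt_pos.2 Real.pi_pos).ne'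
  have hsa : (Real.sqrt (curvature n lam) : ℂ) ≠ 0 := by
    exact_mod_cast (Real.sqrt_pos.2 (by linarith : 0 < curvature n lam)).ne'
  have hq : coordRoot n lam z ≠ 0 := coordRoot_ne_zero
  have hd := one_sub_sq_ne_zero hz hz1
  have hz2 : z - 1 ≠ 0 := sub_ne_zero.2 hz1
  have hz3 : z + 1 ≠ 0 := fun h0 => hd (by linear_combination (1 - z) * h0)
  rw [smoothCorrection, dslope_of_ne _ hz1, slope_def_field, h.h0_eq, h.coordRoot_one, coord,
    Real.sqrt_mul Real.pi_pos.le]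
  push_cast
  have e1 : 1 - z ^ 2 = -((z - 1) * (z + 1)) := by ring
  have e2 : 2 * I * (Real.sqrt Real.pi : ℂ) * (-I * (z - 1) * coordRoot n lam z) =
      2 * (Real.sqrt Real.pi : ℂ) * (z - 1) * coordRoot n lam z := by
    linear_combination (-2 * (Real.sqrt Real.pi : ℂ) * (z - 1) * coordRoot n lam z) * I_sq
  rw [e1, e2]
  field_simp
  ring

theorem differentiableOn_smoothCorrection_and_norm_le (h : GoodScale n lam) :
    DifferentiableOn ℂ (smoothCorrection n lam) (Metric.ball (1 : ℂ) (1 / 40)) ∧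
      ∀ z ∈ Metric.ball (1 : ℂ) (1 / 40), ‖smoothCorrection n lam z‖ ≤ 240 := by
  have ha := h.curvature_bounds.1
  have hre : ∀ z ∈ Metric.ball (1 : ℂ) (1 / 40), 0 ≤ z.re := fun z hz => by
    linarith [(ball_re (Metric.ball_subset_ball (by norm_num) hz)).1]
  have hsa1 : 19 / 20 ≤ Real.sqrt (curvature n lam) := by
    apply Real.le_sqrt_of_sq_le; linarith
  have hsa : (Real.sqrt (curvature n lam) : ℂ) ≠ 0 := by
    exact_mod_cast (by linarith : 0 < Real.sqrt (curvature n lam)).ne'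
  have hd : DifferentiableOn ℂ (fun z => 1 / (Real.sqrt Real.pi : ℂ) *
      (1 / (2 * coordRoot n lam z) - 1 / ((Real.sqrt (curvature n lam) : ℂ) * (z + 1))))
      (Metric.ball (1 : ℂ) (1 / 40)) := by
    refine DifferentiableOn.const_mul (DifferentiableOn.sub ?_ ?_) _
    · exact (differentiableOn_const 1).div (h.differentiableOn_coordRoot.const_mul 2)
        fun z hz => mul_ne_zero two_ne_zero coordRoot_ne_zero
    · refine (differentiableOn_const 1).div (by fun_prop) fun z hz => mul_ne_zero hsa fun h0 => ?_
      have := one_le_norm_add_one (hre z hz)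
      rw [h0, norm_zero] at this
      linarith
  refine ⟨(differentiableOn_dslope (Metric.ball_mem_nhds _ (by norm_num))).2 hd, fun z hz => ?_⟩
  -- The bound `240` is `3·2/(1/40)`.
  have h1 := norm_dslope_le (by norm_num) two_pos hd (fun u hu => ?_) hz
  · refine h1.trans (by norm_num)
  · have hq := (h.norm_coordRoot_bounds hu).1
    have h3 := one_le_norm_add_one (hre u hu)
    have hspi : 1 ≤ Real.sqrt Real.pi := by
      rw [Real.one_le_sqrt]; linarith [Real.pi_gt_three]
    rw [norm_mul, norm_div, norm_one, norm_real, Real.norm_of_nonneg (Real.sqrt_nonneg _)]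
    have h4 : ‖1 / (2 * coordRoot n lam u)‖ ≤ 10 / 19 := by
      rw [norm_div, norm_one, norm_mul, Complex.norm_ofNat, div_le_div_iff₀ (by linarith)
        (by norm_num)]
      linarith
    have h5 : ‖1 / ((Real.sqrt (curvature n lam) : ℂ) * (u + 1))‖ ≤ 20 / 19 := by
      rw [norm_div, norm_one, norm_mul, norm_real, Real.norm_of_nonneg (Real.sqrt_nonneg _),
        div_le_div_iff₀ (by nlinarith) (by norm_num)]
      nlinarith
    have h6 := norm_sub_le (1 / (2 * coordRoot n lam u))
      (1 / ((Real.sqrt (curvature n lam) : ℂ) * (u + 1)))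
    have h7 : 1 / Real.sqrt Real.pi ≤ 1 := by rw [div_le_one (by linarith)]; exact hspi
    calc _ ≤ 1 * (2 : ℝ) := by gcongr; linarith
      _ = 2 := one_mul _

theorem differentiableOn_innerError (h : GoodScale n lam) :
    DifferentiableOn ℂ (innerError n lam) (Metric.ball (1 : ℂ) (1 / 40)) := by
  have hne : ∀ z ∈ Metric.ball (1 : ℂ) (1 / 40), z ≠ 0 := by
    rintro z hz rfl
    have := (ball_re (Metric.ball_subset_ball (by norm_num) hz)).1
    simp at this
    linarith
  have h1 := h.differentiableOn_coord
  have h2 := differentiable_T (2 * n - 1)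
  refine DifferentiableOn.const_mul (DifferentiableOn.sub (DifferentiableOn.mul ?_
    (differentiableOn_amplitude n h.f_lam_ne_zero hne)) ?_) _
  · exact (differentiable_erfc.comp_differentiableOn (h1.const_mul _)).const_mul _
  · exact DifferentiableOn.div (by fun_prop) (by fun_prop) fun z hz =>
      mul_ne_zero h.f_lam_ne_zero (pow_ne_zero _ (hne z hz))

theorem amplitude_eq_add (h : GoodScale n lam) {z : ℂ} (hz : z ≠ 0) :
    amplitude n lam z = T (2 * n - 1) (lam * z) / (f lam * z ^ (2 * n)) +
      scaledRemainder n lam z / f lam := by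
  have := h.f_lam_ne_zero
  rw [amplitude, f_eq_T_add_scaledRemainder h.n_pos]
  field_simp

/-- `e^(-nφ)` is exponentially small where `Re (z - 1)` and `Re (i w)` have different signs. -/
theorem norm_amplitude_le_of_opposite (h : GoodScale n lam) {z : ℂ}
    (hz : z ∈ Metric.ball (1 : ℂ) (1 / 40))
    (hs : (I * coord n lam z).re * (z - 1).re ≤ 0) :
    ‖amplitude n lam z‖ ≤ Real.exp (-(n * (2 * ‖coord n lam z‖ ^ 2 / 4))) := by
  set p := I * coord n lam z with hp
  have hpn : ‖p‖ = ‖coord n lam z‖ := by rw [hp, norm_mul, norm_I, one_mul]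
  have e : p = (z - 1) * coordRoot n lam z := by
    rw [hp, coord]; linear_combination (-(z - 1) * coordRoot n lam z) * I_sq
  have h1 := (h.norm_coord_bounds hz).1
  have h2 : |p.re - (z - 1).re| ≤ 1 / 20 * ‖z - 1‖ := by
    rw [← sub_re]
    refine (abs_re_le_norm _).trans ?_
    have e2 : p - (z - 1) = (z - 1) * (coordRoot n lam z - 1) := by rw [e]; ring
    rw [e2, norm_mul, mul_comm]
    exact mul_le_mul_of_nonneg_right (h.norm_coordRoot_sub_one_le hz) (norm_nonneg _)
  rw [← hpn] at h1
  -- Two reals of opposite sign are each at most their distance, and `p = iw` is within five percent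
  -- of `z - 1`. So `p` is almost imaginary and `Re p²` is at most `-|p|²/2`.
  have h3 : p.re ^ 2 ≤ (p.re - (z - 1).re) ^ 2 := by nlinarith [sq_nonneg (z - 1).re]
  have h4 : (p.re - (z - 1).re) ^ 2 ≤ (1 / 20 * ‖z - 1‖) ^ 2 := sq_le_sq' (abs_le.1 h2).1 (abs_le.1 h2).2
  have h5 : (1 / 20 * ‖z - 1‖) ^ 2 ≤ (1 / 19 * ‖p‖) ^ 2 := by
    apply pow_le_pow_left₀ (by positivity); linarith
  have h6 : ‖p‖ ^ 2 = p.re ^ 2 + p.im ^ 2 := by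
    rw [Complex.sq_norm, normSq_apply]; ring
  have h7 : phase n lam z = -p ^ 2 := by
    rw [← h.coord_sq hz, hp, mul_pow, I_sq]; ring
  rw [h.amplitude_eq_exp (Metric.ball_subset_ball (by norm_num) hz), norm_exp, h7, ← hpn]
  apply Real.exp_le_exp.2
  have e3 : (-((n : ℂ) * -p ^ 2)).re = -(n * (p.im ^ 2 - p.re ^ 2)) := by
    simp [sq]
    ring
  rw [e3]
  have hn : (0 : ℝ) ≤ n := Nat.cast_nonneg n
  nlinarith [sq_nonneg ‖p‖]

end GoodScale

/-- On the boundary of the disc the residual is known from the asymptotics of `erfc` and from the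
outer estimate. -/
theorem exists_boundary_bound {δ : ℝ} (hδ : 0 < δ) (hδ1 : δ ≤ 1 / 400) :
    ∃ C : ℝ, 0 ≤ C ∧ ∀ (n : ℕ) (lam : ℝ), GoodScale n lam → ∀ z ∈ Metric.ball (1 : ℂ) (1 / 80),
      ‖coord n lam z‖ = δ → ‖innerError n lam z - smoothCorrection n lam z‖ ≤ C / n := by
  obtain ⟨Ce, hCe, herfc⟩ := exists_norm_erfc_sub_le
  obtain ⟨Co, hCo, hout⟩ := exists_outer_bound (half_pos hδ) (by linarith)
  refine ⟨Ce / δ ^ 3 + Co * (1 / (δ / 2)) + 32 / (2 * δ ^ 2) ^ 2, by positivity,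
    fun n lam h z hz hzδ => ?_⟩
  have hz40 : z ∈ Metric.ball (1 : ℂ) (1 / 40) := Metric.ball_subset_ball (by norm_num) hz
  have hzre : 0 ≤ z.re := by
    linarith [(ball_re (Metric.ball_subset_ball (by norm_num) hz)).1]
  have hzr : δ / 2 ≤ ‖z - 1‖ := h.half_le_of_not_mem_coordDisc hδ1 fun h0 => by
    linarith [h0.2]
  have hz1 : z ≠ 1 := by
    rintro rfl
    rw [sub_self, norm_zero] at hzr; linarith
  have hz0 : z ≠ 0 := by
    rintro rfl
    have := (ball_re (Metric.ball_subset_ball (by norm_num) hz)).1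
    rw [zero_re] at this
    linarith
  have hnR : (0 : ℝ) < n := by exact_mod_cast h.n_pos
  have hsn := Real.sqrt_pos.2 hnR
  have hsnC : (Real.sqrt n : ℂ) ≠ 0 := by exact_mod_cast hsn.ne'
  have hpiC : (Real.sqrt Real.pi : ℂ) ≠ 0 := by
    exact_mod_cast (Real.sqrt_pos.2 Real.pi_pos).ne'
  set w := coord n lam z with hw
  have hw0 : w ≠ 0 := by rw [← norm_pos_iff, hzδ]; exact hδ
  set s : ℂ := I * (Real.sqrt n : ℂ) * w with hs
  set A := amplitude n lam z with hA
  set W := T (2 * n - 1) (lam * z) / (f lam * z ^ (2 * n)) with hW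
  have hAexp : exp (s ^ 2) = A := by
    rw [hA, h.amplitude_eq_exp (Metric.ball_subset_ball (by norm_num) hz), ← h.coord_sq hz40, hs]
    congr 1
    have : ((Real.sqrt n : ℂ)) ^ 2 = n := by
      rw [← ofReal_pow, Real.sq_sqrt hnR.le, ofReal_natCast]
    rw [mul_pow, mul_pow, I_sq, this]
    ring
  have hsnorm : ‖s‖ = Real.sqrt n * δ := by
    rw [hs, norm_mul, norm_mul, norm_I, one_mul, norm_real, Real.norm_of_nonneg hsn.le, hzδ]
  have hs0 : s ≠ 0 := by rw [← norm_pos_iff, hsnorm]; positivity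
  have hErf : ∀ u : ℂ, u ^ 2 = s ^ 2 → ‖u‖ = ‖s‖ → 0 ≤ u.re →
      ‖(Real.sqrt n : ℂ) * (A * (1 / 2 * erfc u) - 1 / (2 * (Real.sqrt Real.pi : ℂ) * u))‖ ≤
        Ce / δ ^ 3 / n := by
    intro u hu1 hu2 hu3
    have hu0 : u ≠ 0 := by rw [← norm_pos_iff, hu2, norm_pos_iff]; exact hs0
    have h1 := herfc u hu3 hu0
    rw [hu1, hAexp, hu2, hsnorm] at h1
    rw [norm_mul, norm_real, Real.norm_of_nonneg hsn.le]
    calc _ ≤ Real.sqrt n * (Ce / (Real.sqrt n * δ) ^ 3) := by gcongr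
      _ = Ce / δ ^ 3 / (Real.sqrt n) ^ 2 := by field_simp
      _ = _ := by rw [Real.sq_sqrt hnR.le]
  -- Covers the slivers of the circle between the steepest descent curve `Re s = 0` and the line `Re
  -- z = 1`, where the expansions of `erfc` and of the integral change form at different places.
  have hexp : s.re * (z - 1).re ≤ 0 → ‖(Real.sqrt n : ℂ) * A‖ ≤ 32 / (2 * δ ^ 2) ^ 2 / n := by
    intro h1
    have e : s.re = Real.sqrt n * (I * w).re := by
      rw [← re_ofReal_mul]; congr 1; rw [hs]; ring
    rw [e, mul_assoc] at h1
    have h2 := h.norm_amplitude_le_of_opposite hz40 (nonpos_of_mul_nonpos_right h1 hsn)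
    rw [← hw, hzδ] at h2
    rw [norm_mul, norm_real, Real.norm_of_nonneg hsn.le]
    exact (mul_le_mul_of_nonneg_left h2 hsn.le).trans (sqrt_mul_exp_le (by positivity) h.n_pos)
  have hH := h.smoothCorrection_eq hzre hz1
  have hh0 := h.norm_h0_le (half_pos hδ) hzre hzr
  have hfac := h.saddleFactor_mul_h0 (GoodScale.one_sub_sq_ne_zero hzre hz1)
  have hscale : ∀ X : ℂ, ‖saddleFactor n lam z * X - 1‖ ≤ Co / n →
      ‖(Real.sqrt n : ℂ) * X - h0 n lam z‖ ≤ Co * (1 / (δ / 2)) / n := by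
    intro X hX
    have e : (Real.sqrt n : ℂ) * X - h0 n lam z =
        (saddleFactor n lam z * X - 1) * h0 n lam z := by
      rw [← hfac]; ring
    rw [e, norm_mul]
    calc _ ≤ Co / n * (1 / (δ / 2)) := by gcongr
      _ = _ := by ring
  have hX := h.amplitude_eq_add hz0
  rw [← hA, ← hW] at hX
  set R := scaledRemainder n lam z / f lam with hR
  obtain ⟨ho1, ho2⟩ := hout n lam h z hzre hzr
  have hEin : innerError n lam z = (Real.sqrt n : ℂ) * (1 / 2 * erfc s * A - W) := rfl
  have hcorr : (Real.sqrt n : ℂ) * (1 / (2 * (Real.sqrt Real.pi : ℂ) * s)) =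
      1 / (2 * I * (Real.sqrt Real.pi : ℂ) * w) := by
    rw [hs]; field_simp
  rw [hEin, hH, ← hcorr, add_div, add_div]
  have hp1 : 0 ≤ 32 / (2 * δ ^ 2) ^ 2 / (n : ℝ) := by positivity
  have hrez : (z - 1).re = z.re - 1 := by rw [sub_re, one_re]
  -- For `Re s ≥ 0` the expansion of `erfc` is paired with `-W`, for `Re s < 0` that of `erfc(-s)`
  -- with `R`, since `½ erfc(s) A - W = R - ½ erfc(-s) A` by `A = W + R`. When `Re z - 1` has the
  -- other sign, the discrepancy is the exponentially small `A`.
  rcases le_or_gt 0 s.re with hsre | hsre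
  · have b1 := hErf s rfl rfl hsre
    rcases le_or_gt 1 z.re with hz2 | hz2
    · have b2 := hscale _ (ho2 hz2)
      have e : (Real.sqrt n : ℂ) * (1 / 2 * erfc s * A - W) - (h0 n lam z +
          (Real.sqrt n : ℂ) * (1 / (2 * (Real.sqrt Real.pi : ℂ) * s))) =
          (Real.sqrt n : ℂ) * (A * (1 / 2 * erfc s) - 1 / (2 * (Real.sqrt Real.pi : ℂ) * s)) +
          ((Real.sqrt n : ℂ) * -W - h0 n lam z) := by ring
      rw [e]
      refine (norm_add_le _ _).trans ?_
      linarith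
    · have b2 := hscale _ (ho1 hz2)
      have b3 := hexp (by rw [hrez]; nlinarith)
      have e : (Real.sqrt n : ℂ) * (1 / 2 * erfc s * A - W) - (h0 n lam z +
          (Real.sqrt n : ℂ) * (1 / (2 * (Real.sqrt Real.pi : ℂ) * s))) =
          (Real.sqrt n : ℂ) * (A * (1 / 2 * erfc s) - 1 / (2 * (Real.sqrt Real.pi : ℂ) * s)) +
          ((Real.sqrt n : ℂ) * R - h0 n lam z) - (Real.sqrt n : ℂ) * A := by
        linear_combination (Real.sqrt n : ℂ) * hX
      rw [e]
      refine (norm_sub_le _ _).trans ((add_le_add_left (norm_add_le _ _) _).trans ?_)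
      linarith
  · have b1 := hErf (-s) (neg_sq s) (norm_neg s) (by rw [neg_re]; linarith)
    have hneg := erfc_neg s
    have hinv : 1 / (2 * (Real.sqrt Real.pi : ℂ) * -s) = -(1 / (2 * (Real.sqrt Real.pi : ℂ) * s)) := by
      rw [mul_neg, div_neg]
    rw [hinv, hneg] at b1
    rcases le_or_gt 1 z.re with hz2 | hz2
    · have b2 := hscale _ (ho2 hz2)
      have b3 := hexp (by rw [hrez]; nlinarith)
      have e : (Real.sqrt n : ℂ) * (1 / 2 * erfc s * A - W) - (h0 n lam z +
          (Real.sqrt n : ℂ) * (1 / (2 * (Real.sqrt Real.pi : ℂ) * s))) =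
          ((Real.sqrt n : ℂ) * -W - h0 n lam z) + (Real.sqrt n : ℂ) * A -
          (Real.sqrt n : ℂ) * (A * (1 / 2 * (2 - erfc s)) -
            -(1 / (2 * (Real.sqrt Real.pi : ℂ) * s))) := by ring
      rw [e]
      refine (norm_sub_le _ _).trans ((add_le_add_left (norm_add_le _ _) _).trans ?_)
      linarith
    · have b2 := hscale _ (ho1 hz2)
      have e : (Real.sqrt n : ℂ) * (1 / 2 * erfc s * A - W) - (h0 n lam z +
          (Real.sqrt n : ℂ) * (1 / (2 * (Real.sqrt Real.pi : ℂ) * s))) =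
          ((Real.sqrt n : ℂ) * R - h0 n lam z) -
          (Real.sqrt n : ℂ) * (A * (1 / 2 * (2 - erfc s)) -
            -(1 / (2 * (Real.sqrt Real.pi : ℂ) * s))) := by
        linear_combination (Real.sqrt n : ℂ) * hX
      rw [e]
      refine (norm_sub_le _ _).trans ?_
      linarith

/-- The lower bound for `|w|` keeps the disc well inside the ball on which `w` is analytic, so that
its frontier is cut out by `|w| = δ` and not by the ball. -/
theorem GoodScale.closure_coordDisc {n : ℕ} {lam δ : ℝ} (h : GoodScale n lam) (hδ : δ ≤ 1 / 400)
    {z : ℂ} (hz : z ∈ closure (coordDisc n lam δ)) :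
    z ∈ Metric.ball (1 : ℂ) (1 / 80) ∧ ‖coord n lam z‖ ≤ δ := by
  have h1 : coordDisc n lam δ ⊆ Metric.closedBall 1 (1 / 100) := by
    intro u hu
    have h2 := (h.norm_coord_bounds (Metric.ball_subset_ball (by norm_num) hu.1)).1
    rw [Metric.mem_closedBall, dist_eq_norm]
    linarith [hu.2]
  have h2 : z ∈ Metric.ball (1 : ℂ) (1 / 80) := Metric.closedBall_subset_ball (by norm_num)
    (closure_minimal h1 Metric.isClosed_closedBall hz)
  refine ⟨h2, ?_⟩
  have h3 : ContinuousAt (coord n lam) z := (h.differentiableOn_coord.differentiableAt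
    (Metric.isOpen_ball.mem_nhds (Metric.ball_subset_ball (by norm_num) h2))).continuousAt
  have h4 := h3.continuousWithinAt.mem_closure_image hz
  rw [← mem_closedBall_zero_iff]
  refine closure_minimal ?_ Metric.isClosed_closedBall h4
  rintro _ ⟨u, hu, rfl⟩
  rw [mem_closedBall_zero_iff]
  exact hu.2.le

/-- The residual inside the disc around the saddle point. -/
theorem exists_inner_bound {δ : ℝ} (hδ : 0 < δ) (hδ1 : δ ≤ 1 / 400) :
    ∃ C : ℝ, 0 ≤ C ∧ ∀ (n : ℕ) (lam : ℝ), GoodScale n lam → ∀ z ∈ coordDisc n lam δ,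
      ‖innerError n lam z - smoothCorrection n lam z‖ ≤ C / n := by
  obtain ⟨C, hC, hb⟩ := exists_boundary_bound hδ hδ1
  refine ⟨C, hC, fun n lam h z hz => ?_⟩
  have hd : DifferentiableOn ℂ (fun z => innerError n lam z - smoothCorrection n lam z)
      (closure (coordDisc n lam δ)) :=
    (h.differentiableOn_innerError.sub h.differentiableOn_smoothCorrection_and_norm_le.1).mono fun u hu =>
      Metric.ball_subset_ball (by norm_num) (h.closure_coordDisc hδ1 hu).1
  -- Residual and correction are both analytic across `z = 1`, so the boundary estimate controls
  -- their difference inside.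
  refine norm_le_of_forall_mem_frontier_norm_le (U := coordDisc n lam δ)
    (Metric.isBounded_ball.subset fun u hu => hu.1) hd.diffContOnCl (fun u hu => ?_)
    (subset_closure hz)
  obtain ⟨h1, h2⟩ := h.closure_coordDisc hδ1 hu.1
  refine hb n lam h u h1 (h2.antisymm ?_)
  by_contra h3
  rw [(h.isOpen_coordDisc δ).frontier_eq] at hu
  exact hu.2 ⟨h1, not_le.1 h3⟩


/-! ### The residual -/

/-- The residual away from the saddle points. -/
noncomputable def outerError (n : ℕ) (lam : ℝ) (z : ℂ) : ℂ :=
  if |z.re| < 1 then saddleFactor n lam z * (scaledRemainder n lam z / f lam) - 1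
  else saddleFactor n lam z * -(T (2 * n - 1) (lam * z) / (f lam * z ^ (2 * n))) - 1

open Classical in
/-- The residual `𝓔(z)`. -/
noncomputable def residual (n : ℕ) (lam δ : ℝ) (z : ℂ) : ℂ :=
  if z ∈ coordDisc n lam δ then innerError n lam z
  else if -z ∈ coordDisc n lam δ then innerError n lam (-z)
  else outerError n lam z

theorem saddleFactor_neg (n : ℕ) (lam : ℝ) (z : ℂ) :
    saddleFactor n lam (-z) = saddleFactor n lam z := by
  rw [saddleFactor, saddleFactor, neg_sq]

theorem h0_neg (n : ℕ) (lam : ℝ) (z : ℂ) : h0 n lam (-z) = h0 n lam z := by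
  rw [h0, h0, neg_sq]

theorem pow_two_mul_neg (n : ℕ) (z : ℂ) : (-z) ^ (2 * n) = z ^ (2 * n) := by
  rw [pow_mul, neg_sq, ← pow_mul]

theorem re_pos_of_mem_coordDisc {n : ℕ} {lam δ : ℝ} {z : ℂ} (hz : z ∈ coordDisc n lam δ) :
    0 < z.re := by
  linarith [(ball_re (Metric.ball_subset_ball (by norm_num) hz.1)).1]

theorem residual_of_mem {n : ℕ} {lam δ : ℝ} {z : ℂ} (hz : z ∈ coordDisc n lam δ) :
    residual n lam δ z = innerError n lam z := if_pos hz

theorem residual_of_neg_mem {n : ℕ} {lam δ : ℝ} {z : ℂ} (hz : -z ∈ coordDisc n lam δ) :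
    residual n lam δ z = innerError n lam (-z) := by
  have h1 : z ∉ coordDisc n lam δ := fun h => by
    have h2 := re_pos_of_mem_coordDisc hz
    rw [neg_re] at h2
    linarith [re_pos_of_mem_coordDisc h]
  rw [residual, if_neg h1, if_pos hz]

theorem residual_of_not_mem {n : ℕ} {lam δ : ℝ} (hδ : δ ≤ 1 / 400) {z : ℂ}
    (hz : z ∉ B (evenCoord n lam) (coordDisc n lam (1 / 400)) δ) :
    residual n lam δ z = outerError n lam z := by
  rw [mem_B_iff hδ, not_or] at hz
  rw [residual, if_neg hz.1, if_neg hz.2]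

theorem outerError_neg {n : ℕ} (hn : 1 ≤ n) (lam : ℝ) (z : ℂ) :
    outerError n lam (-z) = outerError n lam z := by
  rw [outerError, outerError, neg_re, abs_neg, saddleFactor_neg, scaledRemainder_neg hn,
    mul_neg (lam : ℂ), T_sub_one_neg hn, pow_two_mul_neg]

theorem evenCoord_of_neg_mem {n : ℕ} {lam δ : ℝ} {z : ℂ} (hz : -z ∈ coordDisc n lam δ) :
    evenCoord n lam z = coord n lam (-z) := by
  conv_lhs => rw [← neg_neg z]
  exact evenCoord_neg_of_mem_ball hz.1

namespace GoodScale

variable {n : ℕ} {lam : ℝ}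

theorem one_sub_sq_ne_zero_of_not_mem_B {δ : ℝ} (hδ : 0 < δ) (hδ1 : δ ≤ 1 / 400) {z : ℂ}
    (hz : z ∉ B (evenCoord n lam) (coordDisc n lam (1 / 400)) δ) : 1 - z ^ 2 ≠ 0 := by
  rw [mem_B_iff hδ1, not_or] at hz
  intro h0
  have h1 : (1 - z) * (1 + z) = 0 := by linear_combination h0
  rcases mul_eq_zero.1 h1 with h2 | h2
  · exact hz.1 (sub_eq_zero.1 h2 ▸ one_mem_coordDisc n lam hδ)
  · refine hz.2 ?_
    rw [show -z = 1 by linear_combination -h2]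
    exact one_mem_coordDisc n lam hδ

/-- `outerError` is the relative error in approximating `R/f(λ)` or `-W` by `h₀/√n`; multiplying
back by `z^(2n) f(λ)` involves no division by `f(λz)`, so its zeros need no separate treatment. -/
theorem T_eq_of_outerError (h : GoodScale n lam) {z : ℂ} (hz : 1 - z ^ 2 ≠ 0) :
    T (2 * n - 1) (lam * z) = f (lam * z) * chi z -
      z ^ (2 * n) * f lam / (Real.sqrt n : ℂ) * h0 n lam z * (1 + outerError n lam z) := by
  have hf := h.f_lam_ne_zero
  have hnR : (0 : ℝ) < n := by exact_mod_cast h.n_pos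
  have hsn : (Real.sqrt n : ℂ) ≠ 0 := by exact_mod_cast (Real.sqrt_pos.2 hnR).ne'
  have hfac := h.saddleFactor_mul_h0 hz
  have key : ∀ X : ℂ, z ^ (2 * n) * f lam / (Real.sqrt n : ℂ) * h0 n lam z *
      (1 + (saddleFactor n lam z * X - 1)) = z ^ (2 * n) * f lam * X := by
    intro X
    calc _ = z ^ (2 * n) * f lam / (Real.sqrt n : ℂ) * (h0 n lam z * saddleFactor n lam z) * X := by
          ring
      _ = _ := by rw [hfac]; field_simp
  by_cases hre : |z.re| < 1
  · have hchi : chi z = 1 := indicator_of_mem (s := {z : ℂ | |z.re| < 1}) hre _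
    rw [outerError, if_pos hre, key, hchi, f_eq_T_add_scaledRemainder h.n_pos]
    field_simp
    ring
  · have hchi : chi z = 0 := indicator_of_notMem (s := {z : ℂ | |z.re| < 1}) hre _
    have hz0 : z ≠ 0 := by
      rintro rfl
      simp at hre
    rw [outerError, if_neg hre, key, hchi]
    field_simp
    ring

theorem T_eq_of_innerError (h : GoodScale n lam) {z : ℂ} (hz : z ∈ Metric.ball (1 : ℂ) (1 / 80)) :
    T (2 * n - 1) (lam * z) = f (lam * z) *
      (1 / 2 * erfc (I * (Real.sqrt n : ℂ) * coord n lam z) -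
        expPhase n lam z / (Real.sqrt n : ℂ) * innerError n lam z) := by
  have hf := h.f_lam_ne_zero
  have hnR : (0 : ℝ) < n := by exact_mod_cast h.n_pos
  have hsn : (Real.sqrt n : ℂ) ≠ 0 := by exact_mod_cast (Real.sqrt_pos.2 hnR).ne'
  have hb := half_lt_of_mem_ball h.lam_ge (Metric.ball_subset_ball (by norm_num) hz)
  have hfz : f (lam * z) ≠ 0 := f_ne_zero (by simpa using hb)
  have hz0 : z ≠ 0 := by
    rintro rfl
    have := (ball_re (Metric.ball_subset_ball (by norm_num) hz)).1
    rw [zero_re] at this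
    linarith
  rw [innerError, amplitude, expPhase]
  field_simp
  ring

theorem analyticAt_innerError (h : GoodScale n lam) {δ : ℝ} {z : ℂ} (hz : z ∈ coordDisc n lam δ) :
    AnalyticAt ℂ (innerError n lam) z :=
  h.differentiableOn_innerError.analyticAt
    (Metric.isOpen_ball.mem_nhds (Metric.ball_subset_ball (by norm_num) hz.1))

/-- Off the contour the point has a neighbourhood on which one of the defining branches applies
throughout: the definition changes only at the boundary of `B_δ` and, outside `B_δ`, where `|Re z| =
1`. -/
theorem analyticOnNhd_residual (h : GoodScale n lam) {δ : ℝ} (hδ1 : δ ≤ 1 / 400) :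
    AnalyticOnNhd ℂ (residual n lam δ)
      (errContour (evenCoord n lam) (coordDisc n lam (1 / 400)) δ)ᶜ := by
  intro z hz
  set s := B (evenCoord n lam) (coordDisc n lam (1 / 400)) δ with hs
  have hopen := h.isOpen_coordDisc δ
  have hf := h.f_lam_ne_zero
  by_cases hzB : z ∈ s
  · rcases (mem_B_iff hδ1).1 hzB with h1 | h1
    · refine (h.analyticAt_innerError h1).congr ?_
      filter_upwards [hopen.mem_nhds h1] with u hu
      exact (residual_of_mem hu).symm
    · have h2 := (h.analyticAt_innerError h1).comp_of_eq (analyticAt_id.neg (x := z)) rfl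
      refine h2.congr ?_
      filter_upwards [(hopen.preimage continuous_neg).mem_nhds h1] with u hu
      exact (residual_of_neg_mem hu).symm
  · have hcl : z ∉ closure s := fun h1 => hz (Or.inr ⟨h1, fun h2 => hzB (interior_subset h2)⟩)
    have hev : ∀ᶠ u in 𝓝 z, u ∉ s := by
      filter_upwards [isClosed_closure.isOpen_compl.mem_nhds hcl] with u hu hus
      exact hu (subset_closure hus)
    have hre : |z.re| ≠ 1 := fun h1 => hz (Or.inl ⟨h1, hzB⟩)
    have hcont : Continuous fun u : ℂ => |u.re| := continuous_re.abs
    have hT := differentiable_T (2 * n - 1)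
    have hR := differentiable_scaledRemainder n lam
    have hS : Differentiable ℂ (saddleFactor n lam) := by unfold saddleFactor; fun_prop
    rcases lt_or_gt_of_ne hre with h1 | h1
    · have hd : Differentiable ℂ fun u => saddleFactor n lam u * (scaledRemainder n lam u / f lam) - 1 := by
        fun_prop
      refine (hd.analyticAt z).congr ?_
      filter_upwards [hev, (isOpen_Iio.preimage hcont).mem_nhds h1] with u hu hu1
      rw [residual_of_not_mem hδ1 hu, outerError,
        if_pos (show |u.re| < 1 from hu1)]
    · have hopen2 := isOpen_Ioi.preimage hcont (t := Ioi 1)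
      have hd : DifferentiableOn ℂ (fun u => saddleFactor n lam u *
          -(T (2 * n - 1) (lam * u) / (f lam * u ^ (2 * n))) - 1)
          ((fun u : ℂ => |u.re|) ⁻¹' Ioi 1) := by
        refine (DifferentiableOn.mul hS.differentiableOn (DifferentiableOn.neg
          (DifferentiableOn.div (by fun_prop) (by fun_prop) fun u hu => ?_))).sub_const 1
        refine mul_ne_zero hf (pow_ne_zero _ ?_)
        rintro rfl
        have : (1 : ℝ) < |(0 : ℂ).re| := hu
        simp at this
        linarith
      refine (hd.analyticAt (hopen2.mem_nhds h1)).congr ?_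
      filter_upwards [hev, hopen2.mem_nhds h1] with u hu hu1
      rw [residual_of_not_mem hδ1 hu, outerError, if_neg (not_lt.2 (show 1 < |u.re| from hu1).le)]

end GoodScale

/-- The estimates for the residual. -/
theorem exists_residual_bound {δ : ℝ} (hδ : 0 < δ) (hδ1 : δ ≤ 1 / 400) :
    ∃ C : ℝ, ∀ (n : ℕ) (lam : ℝ), GoodScale n lam →
      (∀ z, ‖residual n lam δ z‖ ≤ C) ∧
      (∀ z ∉ B (evenCoord n lam) (coordDisc n lam (1 / 400)) δ,
        ‖residual n lam δ z‖ ≤ C / n) ∧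
      ∀ z ∈ B (evenCoord n lam) (coordDisc n lam (1 / 400)) δ, z ≠ 1 → z ≠ -1 →
        ‖residual n lam δ z - (h0 n lam z +
          1 / (2 * I * (Real.sqrt Real.pi : ℂ) * evenCoord n lam z))‖ ≤ C / n := by
  obtain ⟨Co, hCo, hout⟩ := exists_outer_bound (half_pos hδ) (by linarith)
  obtain ⟨Ci, hCi, hin⟩ := exists_inner_bound hδ hδ1
  refine ⟨Co + Ci + 240, fun n lam h => ?_⟩
  have hnR : (1 : ℝ) ≤ n := by exact_mod_cast h.n_pos
  have hout' : ∀ z, 0 ≤ z.re → z ∉ coordDisc n lam δ → ‖outerError n lam z‖ ≤ Co / n := by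
    intro z hz hzd
    obtain ⟨h1, h2⟩ := hout n lam h z hz (h.half_le_of_not_mem_coordDisc hδ1 hzd)
    rw [outerError, abs_of_nonneg hz]
    split_ifs with h3
    · exact h1 h3
    · exact h2 (not_lt.1 h3)
  have hB : ∀ z ∉ B (evenCoord n lam) (coordDisc n lam (1 / 400)) δ,
      ‖residual n lam δ z‖ ≤ Co / n := by
    intro z hz
    rw [residual_of_not_mem hδ1 hz]
    rw [mem_B_iff hδ1, not_or] at hz
    rcases le_or_gt 0 z.re with h1 | h1
    · exact hout' z h1 hz.1
    -- The left half plane follows by evenness.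
    · rw [← outerError_neg h.n_pos]
      exact hout' (-z) (by rw [neg_re]; linarith) hz.2
  have hdisc : ∀ z ∈ coordDisc n lam δ, ‖innerError n lam z‖ ≤ Ci / n + 240 := by
    intro z hz
    have h1 := hin n lam h z hz
    have h2 := h.differentiableOn_smoothCorrection_and_norm_le.2 z (Metric.ball_subset_ball (by norm_num) hz.1)
    have h3 := norm_add_le (innerError n lam z - smoothCorrection n lam z)
      (smoothCorrection n lam z)
    rw [sub_add_cancel] at h3
    linarith
  have hinner : ∀ z ∈ coordDisc n lam δ, z ≠ 1 → ‖innerError n lam z - (h0 n lam z +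
      1 / (2 * I * (Real.sqrt Real.pi : ℂ) * coord n lam z))‖ ≤ Ci / n := by
    intro z hz hz1
    rw [← h.smoothCorrection_eq (re_pos_of_mem_coordDisc hz).le hz1]
    exact hin n lam h z hz
  have hCo1 : Co / n ≤ Co := div_le_self hCo hnR
  have hCi1 : Ci / n ≤ Ci := div_le_self hCi hnR
  refine ⟨fun z => ?_, fun z hz => (hB z hz).trans (by gcongr; linarith), fun z hz h1 h2 => ?_⟩
  · by_cases hz : z ∈ B (evenCoord n lam) (coordDisc n lam (1 / 400)) δ
    · rcases (mem_B_iff hδ1).1 hz with h3 | h3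
      · rw [residual_of_mem h3]
        linarith [hdisc _ h3]
      · rw [residual_of_neg_mem h3]
        linarith [hdisc _ h3]
    · linarith [hB z hz]
  · have hle : Ci / n ≤ (Co + Ci + 240) / n := by gcongr; linarith
    refine le_trans ?_ hle
    rcases (mem_B_iff hδ1).1 hz with h3 | h3
    · rw [residual_of_mem h3, evenCoord_of_mem_ball h3.1]
      exact hinner z h3 h1
    · rw [residual_of_neg_mem h3, evenCoord_of_neg_mem h3, ← h0_neg]
      exact hinner (-z) h3 fun h4 => h2 (by rw [← h4, neg_neg])

theorem GoodScale.T_eq_of_mem_B {n : ℕ} {lam δ : ℝ} (h : GoodScale n lam) (hδ1 : δ ≤ 1 / 400)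
    {z : ℂ} (hz : z ∈ B (evenCoord n lam) (coordDisc n lam (1 / 400)) δ) :
    T (2 * n - 1) (lam * z) = f (lam * z) *
      (1 / 2 * erfc (I * (Real.sqrt n : ℂ) * evenCoord n lam z) -
        expPhase n lam z / (Real.sqrt n : ℂ) * residual n lam δ z) := by
  rcases (mem_B_iff hδ1).1 hz with h1 | h1
  · rw [residual_of_mem h1, evenCoord_of_mem_ball h1.1]
    exact h.T_eq_of_innerError h1.1
  · have h2 := h.T_eq_of_innerError h1.1
    rw [residual_of_neg_mem h1, evenCoord_of_neg_mem h1]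
    rwa [expPhase, pow_two_mul_neg, mul_neg, T_sub_one_neg h.n_pos, f_neg, ← expPhase] at h2

end XiTaylor

/-! ### Assembly of the theorem. -/

theorem theorem3p1 :
    ∃ (n₀ : ℕ) (δ₀ : ℝ) (lam : ℕ → ℝ) (w : ℕ → ℂ → ℂ) (U : ℕ → Set ℂ),
      0 < δ₀ ∧
      -- the scaling `λ(n)`, the unique one with a stationary point at `1`, and its asymptotics
      (∀ n ≥ n₀, XiTaylor.IsSaddleScale n (lam n) ∧
        ∀ μ : ℝ, XiTaylor.IsSaddleScale n μ → μ = lam n) ∧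
      (∃ C : ℝ, ∀ n ≥ n₀,
        |lam n / (4 * (n : ℝ) / XiTaylor.lambertW (2 * (n : ℝ) / Real.pi)) - 1| ≤ C / (n : ℝ)) ∧
      -- the local coordinate near `1`, on a neighbourhood that does not shrink in the `w` plane
      (∀ n ≥ n₀, XiTaylor.IsLocalCoordinate n (lam n) δ₀ (w n) (U n)) ∧
      -- the uniform asymptotics of the Taylor polynomials
      ∀ δ : ℝ, 0 < δ → δ ≤ δ₀ →
        ∃ (E : ℕ → ℂ → ℂ) (C : ℝ), ∀ n ≥ n₀,
          (∀ z : ℂ, XiTaylor.T (2 * n - 2) (lam n * z) = XiTaylor.T (2 * n - 1) (lam n * z)) ∧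
          -- outside `B_δ`, where `f(λz) e^(nφ(z)) = z^(2n) f(λ)` also at the zeros of `f(λz)`
          (∀ z ∉ XiTaylor.B (w n) (U n) δ,
            XiTaylor.T (2 * n - 2) (lam n * z) =
              XiTaylor.f (lam n * z) * XiTaylor.chi z -
                z ^ (2 * n) * XiTaylor.f (lam n) / (Real.sqrt n : ℂ) *
                  XiTaylor.h0 n (lam n) z * (1 + E n z)) ∧
          (∀ z ∉ XiTaylor.B (w n) (U n) δ, XiTaylor.f (lam n * z) ≠ 0 →
            XiTaylor.T (2 * n - 2) (lam n * z) =
              XiTaylor.f (lam n * z) * (XiTaylor.chi z -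
                XiTaylor.expPhase n (lam n) z / (Real.sqrt n : ℂ) *
                  XiTaylor.h0 n (lam n) z * (1 + E n z))) ∧
          -- inside `B_δ`
          (∀ z ∈ XiTaylor.B (w n) (U n) δ,
            XiTaylor.T (2 * n - 2) (lam n * z) =
              XiTaylor.f (lam n * z) *
                (1 / 2 * XiTaylor.erfc (Complex.I * (Real.sqrt n : ℂ) * w n z) -
                  XiTaylor.expPhase n (lam n) z / (Real.sqrt n : ℂ) * E n z)) ∧
          -- the residual is bounded, analytic off the contour, and satisfies the two estimates
          (∀ z : ℂ, ‖E n z‖ ≤ C) ∧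
          AnalyticOnNhd ℂ (E n) (XiTaylor.errContour (w n) (U n) δ)ᶜ ∧
          (∀ z ∉ XiTaylor.B (w n) (U n) δ, ‖E n z‖ ≤ C / (n : ℝ)) ∧
          (∀ z ∈ XiTaylor.B (w n) (U n) δ, z ≠ 1 → z ≠ -1 →
            ‖E n z - (XiTaylor.h0 n (lam n) z +
              1 / (2 * Complex.I * (Real.sqrt Real.pi : ℂ) * w n z))‖ ≤ C / (n : ℝ)) := by
  open XiTaylor in
  obtain ⟨n₁, lam, hn₁, ht, hlam⟩ := exists_saddleScale
  obtain ⟨N, hN⟩ := Filter.eventually_atTop.1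
    (eventually_goodScale hn₁ ht fun n hn => (hlam n hn).1)
  -- All constants above are uniform over good scales, so a single threshold for `n` serves every
  -- `δ`.
  have hgood : ∀ n ≥ max N n₁, GoodScale n (lam n) := fun n hn => hN n (le_of_max_le_left hn)
  refine ⟨max N n₁, 1 / 400, lam, fun n => evenCoord n (lam n),
    fun n => coordDisc n (lam n) (1 / 400), by norm_num,
    fun n hn => hlam n (le_of_max_le_right hn), ?_, fun n hn => (hgood n hn).isLocalCoordinate, ?_⟩
  · exact exists_saddleScale_asymptotics (hn₁.trans (le_max_right _ _)) fun n hn =>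
      ⟨by linarith [(hgood n hn).lam_ge], (hgood n hn).saddle⟩
  · intro δ hδ hδ1
    obtain ⟨C, hC⟩ := exists_residual_bound hδ hδ1
    refine ⟨fun n => residual n (lam n) δ, C, fun n hn => ?_⟩
    have h := hgood n hn
    obtain ⟨hb, hbo, hbi⟩ := hC n (lam n) h
    have houter : ∀ z ∉ B (evenCoord n (lam n)) (coordDisc n (lam n) (1 / 400)) δ,
        T (2 * n - 2) (lam n * z) = f (lam n * z) * chi z -
          z ^ (2 * n) * f (lam n) / (Real.sqrt n : ℂ) * h0 n (lam n) z *
            (1 + residual n (lam n) δ z) := by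
      intro z hz
      rw [T_sub_two_eq h.n_pos, residual_of_not_mem hδ1 hz]
      exact h.T_eq_of_outerError (GoodScale.one_sub_sq_ne_zero_of_not_mem_B hδ hδ1 hz)
    refine ⟨fun z => T_sub_two_eq h.n_pos _, houter, fun z hz hfz => ?_, fun z hz => ?_, hb,
      h.analyticOnNhd_residual hδ1, hbo, hbi⟩
    · rw [houter z hz, expPhase]
      field_simp
    · rw [T_sub_two_eq h.n_pos]
      exact h.T_eq_of_mem_B hδ1 hz
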